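/- Write $p_0(x,\xi)=\tfrac12(x^2+\xi^2)$, and let $p$ be a real-valued, real analytic function near $(0,0)$ in $\mathbf R^2$ with $p(x,\xi)\sim (x,\xi)^2$, i.e. $c(x^2+\xi^2)\le p(x,\xi)\le C(x^2+\xi^2)$ near $(0,0)$ for some constants $c,C>0$. Say that a real-valued function $f$, real analytic near $0\in\mathbf R$, is *normalizing for $p$* if $f(0)=0$, $f'(0)>0$ and the Hamilton flow of $f\circ p$ near $(0,0)$ is $2\pi$-periodic, with $2\pi$ as the minimal period of every trajectory except the fixed point $(0,0)$. 1. A normalizing $f$ exists. For every normalizing $f$ there is a real analytic canonical transformation $\kappa$ (an injective map preserving $d\xi\wedge dx$) from a neighbourhood of $(0,0)$ in $\mathbf R^2$ onto a neighbourhood of $(0,0)$, with $\kappa(0,0)=(0,0)$ and $$f\circ p\circ\kappa=p_0 \quad\text{near }(0,0).$$ 2. Suppose that $p=p_\mu$ depends on finitely many real parameters $\mu$ near $\mu_0\in\mathbf R^d$ and that $p_\mu\sim(x,\xi)^2$ for every $\mu$ near $\mu_0$. If $p_\mu(x,\xi)$ is real analytic in $(\mu,x,\xi)$ near $(\mu_0,0,0)$,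 then for $\mu$ near $\mu_0$ one can choose a normalizing $f_\mu$ for $p_\mu$ and a canonical transformation $\kappa_\mu$ as in 1, on a neighbourhood of $(0,0)$ independent of $\mu$, such that $f_\mu\circ p_\mu\circ\kappa_\mu=p_0$ there, with $f_\mu(E)$ and $\kappa_\mu(x,\xi)$ real analytic in $(\mu,E)$ near $(\mu_0,0)$ and in $(\mu,x,\xi)$ near $(\mu_0,0,0)$ respectively. 3. The same holds with smooth instead of analytic dependence on $\mu$. Here a family of real functions $g_\mu$, analytic near $0\in\mathbf R^n$, is said to depend smoothly on $\mu$ near $\mu_0$ if for $\mu$ near $\mu_0$ the $g_\mu$ extend holomorphically to a common neighbourhood of $0$ in $\mathbf C^n$ and the extension is $C^\infty$ jointly in $\mu$ and the complex variable. -/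

import Mathlib

open Set Filter
open scoped Topology ContDiff

/-- `p ∼ (x, ξ)²` near the origin: `p` lies between two positive multiples of `x² + ξ²`. -/
def ComparableToSquare (p : ℝ × ℝ → ℝ) : Prop :=
  ∃ c C : ℝ, 0 < c ∧ 0 < C ∧ ∀ᶠ ρ in 𝓝 (0 : ℝ × ℝ),
    c * (ρ.1 ^ 2 + ρ.2 ^ 2) ≤ p ρ ∧ p ρ ≤ C * (ρ.1 ^ 2 + ρ.2 ^ 2)

/-- The harmonic oscillator `p₀(x, ξ) = (x² + ξ²) / 2`. -/
noncomputable def harmonicOscillator (ρ : ℝ × ℝ) : ℝ := (ρ.1 ^ 2 + ρ.2 ^ 2) / 2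

/-- The Hamilton vector field `(∂H/∂ξ, -∂H/∂x)` of a function `H(x, ξ)`. -/
noncomputable def hamiltonField (H : ℝ × ℝ → ℝ) (ρ : ℝ × ℝ) : ℝ × ℝ :=
  (fderiv ℝ H ρ (0, 1), -fderiv ℝ H ρ (1, 0))

/-- The Hamilton flow of `H` near the origin is `2π`-periodic, and `2π` is the minimal period of
every trajectory other than the origin itself. -/
def HamiltonFlowTwoPiPeriodic (H : ℝ × ℝ → ℝ) : Prop :=
  ∀ᶠ ρ in 𝓝 (0 : ℝ × ℝ), ∃ γ : ℝ → ℝ × ℝ, γ 0 = ρ ∧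
    (∀ t, HasDerivAt γ (hamiltonField H (γ t)) t) ∧
    Function.Periodic γ (2 * Real.pi) ∧
    (ρ ≠ 0 → ∀ T ∈ Ioo 0 (2 * Real.pi), ¬ Function.Periodic γ T)

/-- `f` is real analytic near `0`, `f 0 = 0`, `f' 0 > 0`, and the Hamilton flow of `f ∘ p` near
the origin is `2π`-periodic with minimal period `2π` away from the origin. -/
def NormalizesPeriod (p : ℝ × ℝ → ℝ) (f : ℝ → ℝ) : Prop :=
  AnalyticAt ℝ f 0 ∧ f 0 = 0 ∧ 0 < deriv f 0 ∧ HamiltonFlowTwoPiPeriodic (f ∘ p)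

/-- The standard symplectic form `dξ ∧ dx` on `ℝ²`. -/
def symplecticForm (u v : ℝ × ℝ) : ℝ := u.2 * v.1 - u.1 * v.2

/-- `κ` is an analytic canonical transformation from the open neighbourhood `V` of the origin onto
its image, fixing the origin: it is analytic, injective and preserves the symplectic form.
(Its derivative is then invertible at every point of `V`, so that the image is open and the inverse
is analytic.) -/
def IsAnalyticCanonicalOn (κ : ℝ × ℝ → ℝ × ℝ) (V : Set (ℝ × ℝ)) : Prop :=
  IsOpen V ∧ (0 : ℝ × ℝ) ∈ V ∧ κ 0 = 0 ∧ AnalyticOnNhd ℝ κ V ∧ InjOn κ V ∧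
    ∀ ρ ∈ V, ∀ u v : ℝ × ℝ,
      symplecticForm (fderiv ℝ κ ρ u) (fderiv ℝ κ ρ v) = symplecticForm u v

/-- The real function `g μ` of the variable in `E`, analytic near `0`, depends smoothly on the real
parameters `μ` near `μ₀`: the `g μ` extend holomorphically to a common complex neighbourhood `V` of
`0`, and the extension `G (μ, z)` is `C^∞` in `(μ, z)`. Here `c : E → Ec` is the inclusion of `E` in
its complexification. -/
def DependsSmoothlyNear {d : ℕ} {E Ec : Type*} [NormedAddCommGroup Ec] [NormedSpace ℂ Ec]
    (c : E → Ec) (μ₀ : Fin d → ℝ) (g : (Fin d → ℝ) → E → ℝ) : Prop :=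
  ∃ (U : Set (Fin d → ℝ)) (V : Set Ec) (G : (Fin d → ℝ) × Ec → ℂ),
    IsOpen U ∧ μ₀ ∈ U ∧ IsOpen V ∧ (0 : Ec) ∈ V ∧
    ContDiffOn ℝ ∞ G (U ×ˢ V) ∧
    (∀ μ ∈ U, DifferentiableOn ℂ (fun z => G (μ, z)) V) ∧
    ∀ μ ∈ U, ∀ ρ : E, c ρ ∈ V → G (μ, c ρ) = (g μ ρ : ℂ)

/-- The inclusion `ℝ² → ℂ²`. -/
def complexifyPlane (ρ : ℝ × ℝ) : ℂ × ℂ := ((ρ.1 : ℂ), (ρ.2 : ℂ))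

/-! It suffices to find an area-preserving chart `χ` in which the oscillator energy is a function of
`p`: if the energy of `χ` is `p · a(p)` with `a(0) > 0`, then `f(E) = E a(E)` and `κ = χ⁻¹` are as
required. The Morse lemma (`exists_morse_chart`) writes `p` as the oscillator in a chart `φ` that
need not preserve area. Let `J` be the Jacobian of `φ⁻¹`. The defect is repaired by a map `ψ` that
has Jacobian `J` and sends energy levels to energy levels (`exists_twist`); then `χ = ψ ∘ φ` has
Jacobian one (`exists_normal_form`).

For `ψ` take multiplication by `S(E)` followed by rotation through the angle `u`. If `∂` denotes the
derivative along rotations, its Jacobian is `(E S²)' (1 + ∂u)` (`jac_twist`). Let `m(E)` be the mean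
of `J` over the circle of energy `E`. With `S² = a` the mean of `m` over `[0, E]`, one has `(E a)' =
m`. It remains to solve `∂u = J/m - 1`, whose right side has mean zero on every circle; the first
angular moment of `J` divided by its mean is an explicit solution
(`fderiv_circleMoment_quarterTurn`). Holomorphy of `m` across `E = 0` is the delicate point
(`exists_radial_profile`). The circle mean, extended to `ℂ²`, is rotation invariant, so it may be
evaluated at the complex point `x + iξ = 2E/δ`, `x - iξ = δ` of energy `E` instead of at a real
point. This point is affine in `E`, so no square root of `E` appears.

Analytic and smooth parameters are treated together. Every construction consists of algebra,
derivatives, integrals and local inverses applied to a complex extension of `p`, and `HolAt R` is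
stable under all of these. The relation `R` records the parameter directions in which derivatives
are complex linear: all of them for analytic families, none for smooth ones. In the analytic case
`analyticAt_of_complexSmooth` recovers joint analyticity at the end. In parallel, `RealNear` tracks
that real points keep real values.

In canonical coordinates the trajectories of `g(p₀)` are rotations of angular speed `g'(p₀)`
(`eventually_trajectory`). For `g = id` this gives minimal period `2π`, so the `f` found above is
normalizing. Conversely, for another normalizing function the reduced `g` must have a positive
integer derivative `n` on each small circle, with minimal period `2π/n`; hence `n = 1` and `g` is
the identity on small nonnegative energies (`eq_harmonicOscillator_of_twoPiPeriodic`). The same `κ`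
therefore serves every normalizing function. -/

/-! ### Calculus of functions holomorphic in `z` and smooth in parameters -/

section HolAt

variable {N Z Z' W W' : Type} [NormedAddCommGroup N] [NormedSpace ℝ N]
  [NormedAddCommGroup Z] [NormedSpace ℂ Z] [NormedAddCommGroup Z'] [NormedSpace ℂ Z']
  [NormedAddCommGroup W] [NormedSpace ℂ W] [NormedAddCommGroup W'] [NormedSpace ℂ W']
  {R : N → N → Prop}

/-- `F (ν, z)` is smooth at `x`, and its derivative is complex linear in `z` and along the pairs of
parameter directions that `R` relates (a direction and its product with `i`). -/
def HolAt (R : N → N → Prop) (F : N × Z → W) (x : N × Z) : Prop :=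
  ContDiffAt ℝ ∞ F x ∧ ∀ n n' z, R n n' →
    fderiv ℝ F x (n', Complex.I • z) = Complex.I • fderiv ℝ F x (n, z)

theorem HolAt.differentiableAt {F : N × Z → W} {x : N × Z} (h : HolAt R F x) :
    DifferentiableAt ℝ F x := h.1.differentiableAt (by simp)

theorem HolAt.hasFDerivAt {F : N × Z → W} {x : N × Z} (h : HolAt R F x) :
    HasFDerivAt F (fderiv ℝ F x) x := h.differentiableAt.hasFDerivAt

theorem HolAt.continuousAt {F : N × Z → W} {x : N × Z} (h : HolAt R F x) :
    ContinuousAt F x := h.1.continuousAt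

theorem HolAt.of_hasFDerivAt {F : N × Z → W} {x : N × Z} {F' : N × Z →L[ℝ] W}
    (hc : ContDiffAt ℝ ∞ F x) (hF : HasFDerivAt F F' x)
    (h : ∀ n n' z, R n n' → F' (n', Complex.I • z) = Complex.I • F' (n, z)) : HolAt R F x :=
  ⟨hc, by rw [hF.fderiv]; exact h⟩

/-- The hypothesis `R 0 0` is what makes the derivative in `z` alone commute with `i`; real
linearity then gives all complex scalars. -/
theorem HolAt.fderiv_smul {F : N × Z → W} {x : N × Z} (h : HolAt R F x) (hR : R 0 0) (c : ℂ)
    (z : Z) : fderiv ℝ F x (0, c • z) = c • fderiv ℝ F x (0, z) := by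
  have h1 : ((0 : N), c • z) = c.re • ((0 : N), z) + c.im • ((0 : N), Complex.I • z) := by
    ext
    · simp
    · simp only [Prod.smul_mk, Prod.mk_add_mk]
      conv_lhs => rw [← Complex.re_add_im c, add_smul, mul_smul]
      simp
  rw [h1, map_add, map_smul, map_smul, h.2 0 0 z hR]
  conv_rhs => rw [← Complex.re_add_im c, add_smul, mul_smul]
  simp

theorem holAt_const (w : W) (x : N × Z) : HolAt R (fun _ => w) x :=
  HolAt.of_hasFDerivAt contDiffAt_const (hasFDerivAt_const w x) (by simp)

theorem holAt_snd (x : N × Z) : HolAt R (fun y : N × Z => y.2) x :=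
  HolAt.of_hasFDerivAt contDiffAt_snd hasFDerivAt_snd (by simp)

/-- Substituting into the complex variable. -/
theorem HolAt.subst {F : N × Z' → W} {g : N × Z → Z'} {x : N × Z}
    (hF : HolAt R F (x.1, g x)) (hg : HolAt R g x) : HolAt R (fun y => F (y.1, g y)) x := by
  have h1 : HasFDerivAt (fun y : N × Z => (y.1, g y))
      ((ContinuousLinearMap.fst ℝ N Z).prod (fderiv ℝ g x)) x :=
    hasFDerivAt_fst.prodMk hg.hasFDerivAt
  refine HolAt.of_hasFDerivAt ?_ (HasFDerivAt.comp x hF.hasFDerivAt h1) ?_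
  · exact ContDiffAt.comp x hF.1 (contDiffAt_fst.prodMk hg.1)
  · intro n n' z hn
    simp only [ContinuousLinearMap.comp_apply, ContinuousLinearMap.prod_apply,
      ContinuousLinearMap.coe_fst']
    rw [hg.2 n n' z hn, hF.2 n n' _ hn]

/-- Composition with a holomorphic function. -/
theorem HolAt.comp {F : N × Z → W} {x : N × Z} {h : W → W'} (hh : DifferentiableAt ℂ h (F x))
    (hc : ContDiffAt ℝ ∞ h (F x)) (hF : HolAt R F x) : HolAt R (fun y => h (F y)) x := by
  refine HolAt.of_hasFDerivAt (hc.comp x hF.1)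
    ((hh.hasFDerivAt.restrictScalars ℝ).comp x hF.hasFDerivAt) ?_
  intro n n' z hn
  simp only [ContinuousLinearMap.comp_apply, ContinuousLinearMap.coe_restrictScalars']
  rw [hF.2 n n' z hn, map_smul]

theorem HolAt.comp_contDiffAt {F : N × Z → W} {x : N × Z} {h : W → W'}
    (hh : ContDiffAt ℂ ∞ h (F x)) (hF : HolAt R F x) : HolAt R (fun y => h (F y)) x :=
  hF.comp (hh.differentiableAt (by simp)) (hh.restrict_scalars ℝ)

theorem HolAt.prodMk {F : N × Z → W} {G : N × Z → W'} {x : N × Z} (hF : HolAt R F x)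
    (hG : HolAt R G x) : HolAt R (fun y => (F y, G y)) x := by
  refine HolAt.of_hasFDerivAt (hF.1.prodMk hG.1) (hF.hasFDerivAt.prodMk hG.hasFDerivAt) ?_
  intro n n' z hn
  simp [hF.2 n n' z hn, hG.2 n n' z hn]

theorem HolAt.fst {F : N × Z → W × W'} {x : N × Z} (hF : HolAt R F x) :
    HolAt R (fun y => (F y).1) x :=
  hF.comp_contDiffAt (h := Prod.fst) contDiffAt_fst

theorem HolAt.snd {F : N × Z → W × W'} {x : N × Z} (hF : HolAt R F x) :
    HolAt R (fun y => (F y).2) x :=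
  hF.comp_contDiffAt (h := Prod.snd) contDiffAt_snd

theorem HolAt.add {F G : N × Z → W} {x : N × Z} (hF : HolAt R F x) (hG : HolAt R G x) :
    HolAt R (fun y => F y + G y) x :=
  (hF.prodMk hG).comp_contDiffAt (h := fun p : W × W => p.1 + p.2) (by fun_prop)

theorem HolAt.sub {F G : N × Z → W} {x : N × Z} (hF : HolAt R F x) (hG : HolAt R G x) :
    HolAt R (fun y => F y - G y) x :=
  (hF.prodMk hG).comp_contDiffAt (h := fun p : W × W => p.1 - p.2) (by fun_prop)

theorem HolAt.mul {F G : N × Z → ℂ} {x : N × Z} (hF : HolAt R F x) (hG : HolAt R G x) :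
    HolAt R (fun y => F y * G y) x :=
  (hF.prodMk hG).comp_contDiffAt (h := fun p : ℂ × ℂ => p.1 * p.2) (by fun_prop)

theorem HolAt.inv {F : N × Z → ℂ} {x : N × Z} (hF : HolAt R F x) (h0 : F x ≠ 0) :
    HolAt R (fun y => (F y)⁻¹) x :=
  hF.comp_contDiffAt (h := fun p : ℂ => p⁻¹) (contDiffAt_inv ℂ h0)

theorem HolAt.div {F G : N × Z → ℂ} {x : N × Z} (hF : HolAt R F x) (hG : HolAt R G x)
    (h0 : G x ≠ 0) : HolAt R (fun y => F y / G y) x := by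
  simpa only [div_eq_mul_inv] using hF.mul (hG.inv h0)

/-- Differentiating in a direction of the complex variable. -/
theorem HolAt.fderiv_apply {F : N × Z → W} {x : N × Z} (hF : ∀ᶠ y in 𝓝 x, HolAt R F y) (v : Z) :
    HolAt R (fun y => fderiv ℝ F y (0, v)) x := by
  have h0 := hF.self_of_nhds
  have hc : ContDiffAt ℝ ∞ (fderiv ℝ F) x := h0.1.fderiv_right (by simp)
  have hd : HasFDerivAt (fderiv ℝ F) (fderiv ℝ (fderiv ℝ F) x) x :=
    (hc.differentiableAt (by simp)).hasFDerivAt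
  have hs : IsSymmSndFDerivAt ℝ F x := h0.1.isSymmSndFDerivAt (by simpa using WithTop.coe_le_coe.2 (le_top : (2 : ℕ∞) ≤ ⊤))
  have key : ∀ w : N × Z, HasFDerivAt (fun y => fderiv ℝ F y w)
      ((ContinuousLinearMap.apply ℝ W w).comp (fderiv ℝ (fderiv ℝ F) x)) x := fun w =>
    (ContinuousLinearMap.apply ℝ W w).hasFDerivAt.comp x hd
  refine HolAt.of_hasFDerivAt ?_ (key (0, v)) ?_
  · exact (ContinuousLinearMap.apply ℝ W ((0 : N), v)).contDiff.contDiffAt.comp x hc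
  · intro n n' z hn
    simp only [ContinuousLinearMap.comp_apply, ContinuousLinearMap.apply_apply]
    -- Symmetry of the second derivative puts `v` outermost, so that the linearity relation, valid
    -- at all nearby points, can be differentiated along `v`.
    rw [hs (n', Complex.I • z), hs (n, z)]
    have e : (fun y => fderiv ℝ F y (n', Complex.I • z)) =ᶠ[𝓝 x]
        fun y => Complex.I • fderiv ℝ F y (n, z) := by
      filter_upwards [hF] with y hy using hy.2 n n' z hn
    have h1 := (key (n', Complex.I • z)).congr_of_eventuallyEq e.symm
    have h2 := (key (n, z)).const_smul Complex.I
    have h3 := congrArg (fun L : N × Z →L[ℝ] W => L (0, v)) (h1.unique h2)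
    simpa using h3

end HolAt

/-! ### Differentiation under the integral sign -/

section ParametricIntegral

variable {X X' W W' : Type} [NormedAddCommGroup X] [NormedSpace ℝ X]
  [NormedAddCommGroup X'] [NormedSpace ℝ X'] [NormedAddCommGroup W] [NormedSpace ℝ W]
  [NormedAddCommGroup W'] [NormedSpace ℝ W'] {a b : ℝ}

/-- If `P` holds near every `L t x`, then it holds near every `L t y`, for `y` near `x`. -/
theorem eventually_forall_uIcc {L : ℝ → X →L[ℝ] X'} (hL : Continuous L) {P : X' → Prop} {x : X}
    (h : ∀ t ∈ uIcc a b, ∀ᶠ y in 𝓝 (L t x), P y) :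
    ∀ᶠ y in 𝓝 x, ∀ t ∈ uIcc a b, P (L t y) := by
  refine isCompact_uIcc.eventually_forall_of_forall_eventually fun t ht => ?_
  have hc : ContinuousAt (fun z : X × ℝ => L z.2 z.1) (x, t) := by fun_prop
  exact hc.eventually (h t ht)

/-- The integrand's derivative is jointly continuous and the interval compact, so near `x` it is
bounded by a constant and dominated differentiation applies. The weights `B t` are operators, not
scalars, so that the derivative is again an integral of this shape. -/
theorem hasFDerivAt_integral_comp [CompleteSpace W'] {L : ℝ → X →L[ℝ] X'} (hL : Continuous L)
    {B : ℝ → W →L[ℝ] W'} (hB : Continuous B) {G : X' → W} {x : X}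
    (h : ∀ t ∈ uIcc a b, ∀ᶠ y in 𝓝 (L t x), ContDiffAt ℝ 1 G y) :
    HasFDerivAt (fun y => ∫ t in a..b, B t (G (L t y)))
      (∫ t in a..b, (B t).comp ((fderiv ℝ G (L t x)).comp (L t))) x := by
  set Q : X → ℝ → X →L[ℝ] W' := fun y t => (B t).comp ((fderiv ℝ G (L t y)).comp (L t)) with hQ
  have hQc : ∀ y t, ContDiffAt ℝ 1 G (L t y) → ContinuousAt (fun z : X × ℝ => Q z.1 z.2) (y, t) := by
    intro y t hy
    have h1 : ContinuousAt (fun z : X × ℝ => fderiv ℝ G (L z.2 z.1)) (y, t) := by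
      have h2 : ContinuousAt (fun z : X × ℝ => L z.2 z.1) (y, t) := by fun_prop
      exact ContinuousAt.comp (f := fun z : X × ℝ => L z.2 z.1) (x := (y, t))
        (g := fderiv ℝ G) ((hy.fderiv_right (m := 0) (by simp)).continuousAt) h2
    have h3 : ContinuousAt (fun z : X × ℝ => B z.2) (y, t) := by fun_prop
    have h4 : ContinuousAt (fun z : X × ℝ => L z.2) (y, t) := by fun_prop
    exact h3.clm_comp (h1.clm_comp h4)
  have hFc : ∀ y, (∀ t ∈ uIcc a b, ContDiffAt ℝ 1 G (L t y)) →
      ContinuousOn (fun t => B t (G (L t y))) (uIcc a b) := by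
    intro y hy t ht
    have h2 : ContinuousAt (fun t => L t y) t := by fun_prop
    have h3 : ContinuousAt (fun t => G (L t y)) t :=
      ContinuousAt.comp (f := fun t => L t y) (x := t) (g := G) (hy t ht).continuousAt h2
    exact (hB.continuousAt.clm_apply h3).continuousWithinAt
  have hself : ∀ t ∈ uIcc a b, ContDiffAt ℝ 1 G (L t x) := fun t ht => (h t ht).self_of_nhds
  have hQon : ContinuousOn (Q x) (uIcc a b) := fun t ht => by
    have h2 : ContinuousAt (fun t : ℝ => (x, t)) t := by fun_prop
    exact (ContinuousAt.comp (f := fun t : ℝ => (x, t)) (x := t) (hQc x t (hself t ht))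
      h2).continuousWithinAt
  obtain ⟨C, hC⟩ := isCompact_uIcc.exists_bound_of_continuousOn hQon
  have hbd : ∀ᶠ y in 𝓝 x, ∀ t ∈ uIcc a b, ‖Q y t‖ < C + 1 := by
    refine isCompact_uIcc.eventually_forall_of_forall_eventually fun t ht => ?_
    exact ((hQc x t (hself t ht)).norm).eventually
      (gt_mem_nhds (show ‖Q x t‖ < C + 1 from (hC t ht).trans_lt (lt_add_one C)))
  have hgood := eventually_forall_uIcc hL h
  have hs : {y | (∀ t ∈ uIcc a b, ‖Q y t‖ < C + 1) ∧ ∀ t ∈ uIcc a b, ContDiffAt ℝ 1 G (L t y)} ∈ 𝓝 x :=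
    hbd.and hgood
  refine intervalIntegral.hasFDerivAt_integral_of_dominated_of_fderiv_le (bound := fun _ => C + 1)
    (F := fun y t => B t (G (L t y))) (F' := Q) hs ?_ ?_ ?_ ?_ ?_ ?_
  · filter_upwards [hgood] with y hy
    exact ((hFc y hy).mono uIoc_subset_uIcc).aestronglyMeasurable measurableSet_uIoc
  · exact (hFc x hself).intervalIntegrable
  · exact (hQon.mono uIoc_subset_uIcc).aestronglyMeasurable measurableSet_uIoc
  · exact Eventually.of_forall fun t ht y hy => (hy.1 t (uIoc_subset_uIcc ht)).le
  · exact intervalIntegrable_const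
  · refine Eventually.of_forall fun t ht y hy => ?_
    have h1 := ((hy.2 t (uIoc_subset_uIcc ht)).differentiableAt (by simp)).hasFDerivAt
    exact (B t).hasFDerivAt.comp y (h1.comp y (L t).hasFDerivAt)

/-- Induction on `n`, replacing `G` by its derivative. One order of differentiability is lost, which
costs nothing for smooth `G`. -/
theorem contDiffAt_integral_comp (n : ℕ) {X X' W W' : Type} [NormedAddCommGroup X]
    [NormedSpace ℝ X] [NormedAddCommGroup X'] [NormedSpace ℝ X'] [NormedAddCommGroup W]
    [NormedSpace ℝ W] [NormedAddCommGroup W'] [NormedSpace ℝ W'] [CompleteSpace W']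
    {L : ℝ → X →L[ℝ] X'} (hL : Continuous L)
    {B : ℝ → W →L[ℝ] W'} (hB : Continuous B) {G : X' → W} {x : X}
    (h : ∀ t ∈ uIcc a b, ∀ᶠ y in 𝓝 (L t x), ContDiffAt ℝ (n + 1) G y) :
    ContDiffAt ℝ n (fun y => ∫ t in a..b, B t (G (L t y))) x := by
  induction n generalizing W W' with
  | zero =>
    have h1 : ∀ t ∈ uIcc a b, ∀ᶠ y in 𝓝 (L t x), ∀ᶠ y in 𝓝 y, ContDiffAt ℝ 1 G y := by
      intro t ht
      filter_upwards [(h t ht).eventually_nhds] with y hy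
      simpa using hy
    rw [Nat.cast_zero, contDiffAt_zero]
    exact ⟨_, eventually_forall_uIcc hL h1, fun y hy =>
      (hasFDerivAt_integral_comp hL hB hy).continuousAt.continuousWithinAt⟩
  | succ n ih =>
    rw [Nat.cast_succ, contDiffAt_succ_iff_hasFDerivAt]
    have h1 : ∀ t ∈ uIcc a b, ∀ᶠ y in 𝓝 (L t x), ∀ᶠ y in 𝓝 y, ContDiffAt ℝ 1 G y := by
      intro t ht
      filter_upwards [(h t ht).eventually_nhds] with y hy
      filter_upwards [hy] with z hz
      exact hz.of_le (by simp)
    refine ⟨fun y => ∫ t in a..b, (B t).comp ((fderiv ℝ G (L t y)).comp (L t)),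
      ⟨_, eventually_forall_uIcc hL h1, fun y hy => hasFDerivAt_integral_comp hL hB hy⟩, ?_⟩
    -- Composition with `B t` on the left and `L t` on the right: with these weights the derivative
    -- is the integral attached to `fderiv ℝ G`, and the induction hypothesis applies.
    let B' : ℝ → (X' →L[ℝ] W) →L[ℝ] (X →L[ℝ] W') := fun t =>
      (ContinuousLinearMap.compL ℝ X W W' (B t)).comp
        ((ContinuousLinearMap.compL ℝ X X' W).flip (L t))
    have hB' : Continuous B' := by fun_prop
    refine ih (B := B') hB' (G := fderiv ℝ G) fun t ht => ?_
    filter_upwards [h t ht] with y hy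
    exact hy.fderiv_right (by norm_cast)

variable {N Z Z' V : Type} [NormedAddCommGroup N] [NormedSpace ℝ N]
  [NormedAddCommGroup Z] [NormedSpace ℂ Z] [NormedAddCommGroup Z'] [NormedSpace ℂ Z']
  [NormedAddCommGroup V] [NormedSpace ℂ V] {R : N → N → Prop}

/-- The real linear map `(ν, z) ↦ (ν, A z)`. -/
noncomputable def liftSnd (N : Type) [NormedAddCommGroup N] [NormedSpace ℝ N]
    (A : Z →L[ℂ] Z') : N × Z →L[ℝ] N × Z' :=
  (ContinuousLinearMap.id ℝ N).prodMap (A.restrictScalars ℝ)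

theorem liftSnd_apply (A : Z →L[ℂ] Z') (x : N × Z) : liftSnd N A x = (x.1, A x.2) := rfl

theorem continuous_liftSnd {A : ℝ → Z →L[ℂ] Z'} (hA : Continuous A) :
    Continuous fun t => liftSnd N (A t) := by
  have h1 : Continuous fun t => (A t).restrictScalars ℝ :=
    (ContinuousLinearMap.restrictScalarsL ℂ Z Z' ℝ ℝ).continuous.comp hA
  exact continuous_const.prod_mapL ℝ h1

/-- The derivative of the integral is the integral of the derivatives, and each of these commutes
with `i` because `A t` and multiplication by `w t` do. -/
theorem HolAt.integral [CompleteSpace V] {F : N × Z' → V} {A : ℝ → Z →L[ℂ] Z'}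
    (hA : Continuous A) {w : ℝ → ℂ} (hw : Continuous w) {x : N × Z}
    (h : ∀ t ∈ uIcc a b, ∀ᶠ y in 𝓝 (x.1, A t x.2), HolAt R F y) :
    HolAt R (fun y => ∫ t in a..b, w t • F (y.1, A t y.2)) x := by
  let B : ℝ → V →L[ℝ] V := fun t => w t • ContinuousLinearMap.id ℝ V
  have hB : Continuous B := by fun_prop
  have hL := continuous_liftSnd (N := N) hA
  have hc1 : ∀ n : ℕ, ∀ t ∈ uIcc a b,
      ∀ᶠ y in 𝓝 (liftSnd N (A t) x), ContDiffAt ℝ n F y := by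
    intro n t ht
    filter_upwards [h t ht] with y hy
    exact hy.1.of_le (by exact_mod_cast le_top)
  have hd := hasFDerivAt_integral_comp (a := a) (b := b) hL hB (G := F) (x := x)
    (by simpa using hc1 1)
  have hc : ContDiffAt ℝ ∞ (fun y => ∫ t in a..b, B t (F (liftSnd N (A t) y))) x := by
    rw [contDiffAt_infty]
    exact fun n => contDiffAt_integral_comp n hL hB (by simpa using hc1 (n + 1))
  refine HolAt.of_hasFDerivAt (F := fun y => ∫ t in a..b, B t (F (liftSnd N (A t) y))) hc hd ?_
  intro n n' z hn
  have hint : IntervalIntegrable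
      (fun t => (B t).comp ((fderiv ℝ F (liftSnd N (A t) x)).comp (liftSnd N (A t))))
      MeasureTheory.volume a b := by
    refine ContinuousOn.intervalIntegrable fun t ht => ContinuousAt.continuousWithinAt ?_
    have h2 : ContinuousAt (fun t => liftSnd N (A t) x) t :=
      (hL.clm_apply continuous_const).continuousAt
    have h1 : ContinuousAt (fun t => fderiv ℝ F (liftSnd N (A t) x)) t :=
      ContinuousAt.comp (f := fun t => liftSnd N (A t) x) (x := t) (g := fderiv ℝ F)
        (((h t ht).self_of_nhds.1.fderiv_right (m := 0) (by simp)).continuousAt) h2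
    exact hB.continuousAt.clm_comp (h1.clm_comp hL.continuousAt)
  rw [ContinuousLinearMap.intervalIntegral_apply hint,
    ContinuousLinearMap.intervalIntegral_apply hint, ← intervalIntegral.integral_smul]
  refine intervalIntegral.integral_congr fun t ht => ?_
  have h3 := (h t ht).self_of_nhds.2 n n' (A t z) hn
  simp only [ContinuousLinearMap.comp_apply, liftSnd_apply, map_smul, B] at h3 ⊢
  rw [h3]
  simp only [smul_apply, ContinuousLinearMap.id_apply]
  rw [smul_comm]

theorem eventually_holAt_integral [CompleteSpace V] {F : N × Z' → V} {A : ℝ → Z →L[ℂ] Z'}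
    (hA : Continuous A) {w : ℝ → ℂ} (hw : Continuous w) {x : N × Z}
    (h : ∀ t ∈ uIcc a b, ∀ᶠ y in 𝓝 (x.1, A t x.2), HolAt R F y) :
    ∀ᶠ y in 𝓝 x, HolAt R (fun y => ∫ t in a..b, w t • F (y.1, A t y.2)) y := by
  filter_upwards [eventually_forall_uIcc (continuous_liftSnd (N := N) hA)
    fun t ht => (h t ht).eventually_nhds] with y hy
  exact HolAt.integral hA hw hy

end ParametricIntegral

/-! ### Smooth maps with complex linear derivatives are analytic -/

section Osgood

variable {E W W' : Type*} [NormedAddCommGroup E] [NormedSpace ℂ E]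
  [NormedAddCommGroup W] [NormedSpace ℂ W] [NormedAddCommGroup W'] [NormedSpace ℂ W']

/-- `f` is real smooth at `x`, with complex linear derivative at `x`. -/
def ComplexSmoothAt (f : E → W) (x : E) : Prop :=
  ContDiffAt ℝ ∞ f x ∧ ∀ v, fderiv ℝ f x (Complex.I • v) = Complex.I • fderiv ℝ f x v

theorem ContinuousLinearMap.exists_restrictScalars_eq (L : E →L[ℝ] W)
    (h : ∀ v, L (Complex.I • v) = Complex.I • L v) :
    ∃ L' : E →L[ℂ] W, L'.restrictScalars ℝ = L := by
  refine ⟨{ toFun := L, map_add' := map_add L, map_smul' := fun c v => ?_, cont := L.cont }, ?_⟩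
  · simp only [RingHom.id_apply]
    rw [← Complex.re_add_im c, add_smul, add_smul, mul_smul, mul_smul, map_add]
    simp [h]
  · ext v; rfl

theorem ComplexSmoothAt.differentiableAt {f : E → W} {x : E} (h : ComplexSmoothAt f x) :
    DifferentiableAt ℂ f x := by
  obtain ⟨L', hL'⟩ := (fderiv ℝ f x).exists_restrictScalars_eq h.2
  exact (hasFDerivAt_of_restrictScalars ℝ (h.1.differentiableAt (by simp)).hasFDerivAt
    hL').differentiableAt

theorem ComplexSmoothAt.fderiv_apply_eq {f : E → W} {x : E} (h : ComplexSmoothAt f x) (v : E) :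
    fderiv ℂ f x v = fderiv ℝ f x v := by
  rw [h.differentiableAt.fderiv_restrictScalars ℝ]; rfl

/-- Symmetry of the second derivative moves `i` to the inner slot, where linearity is known at all
nearby points. -/
theorem ComplexSmoothAt.fderiv {f : E → W} {x : E} (h : ∀ᶠ y in 𝓝 x, ComplexSmoothAt f y) :
    ComplexSmoothAt (fderiv ℝ f) x := by
  have h0 := h.self_of_nhds
  have hc : ContDiffAt ℝ ∞ (_root_.fderiv ℝ f) x := h0.1.fderiv_right (by simp)
  have hd : HasFDerivAt (_root_.fderiv ℝ f) (_root_.fderiv ℝ (_root_.fderiv ℝ f) x) x :=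
    (hc.differentiableAt (by simp)).hasFDerivAt
  have hs : IsSymmSndFDerivAt ℝ f x :=
    h0.1.isSymmSndFDerivAt (by simpa using WithTop.coe_le_coe.2 (le_top : (2 : ℕ∞) ≤ ⊤))
  have key : ∀ w : E, HasFDerivAt (fun y => _root_.fderiv ℝ f y w)
      ((ContinuousLinearMap.apply ℝ W w).comp (_root_.fderiv ℝ (_root_.fderiv ℝ f) x)) x := fun w =>
    (ContinuousLinearMap.apply ℝ W w).hasFDerivAt.comp x hd
  refine ⟨hc, fun v => ?_⟩
  ext w
  rw [hs (Complex.I • v) w, FunLike.coe_smul, Pi.smul_apply, hs v w]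
  have e : (fun y => _root_.fderiv ℝ f y (Complex.I • v)) =ᶠ[𝓝 x]
      fun y => Complex.I • _root_.fderiv ℝ f y v := by
    filter_upwards [h] with y hy using hy.2 v
  have h1 := (key (Complex.I • v)).congr_of_eventuallyEq e.symm
  have h2 := (key v).const_smul Complex.I
  have h3 := congrArg (fun L : E →L[ℝ] W => L w) (h1.unique h2)
  simpa using h3

theorem ComplexSmoothAt.clm_comp {f : E → W} {x : E} (A : W →L[ℝ] W')
    (hA : ∀ w, A (Complex.I • w) = Complex.I • A w) (h : ComplexSmoothAt f x) :
    ComplexSmoothAt (fun y => A (f y)) x := by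
  refine ⟨A.contDiff.contDiffAt.comp x h.1, fun v => ?_⟩
  have h1 : HasFDerivAt (fun y => A (f y)) (A.comp (_root_.fderiv ℝ f x)) x :=
    A.hasFDerivAt.comp x (h.1.differentiableAt (by simp)).hasFDerivAt
  rw [h1.fderiv]
  simp only [ContinuousLinearMap.comp_apply, h.2 v, hA]

theorem ComplexSmoothAt.iteratedFDeriv {f : E → W} {x : E} (k : ℕ)
    (h : ∀ᶠ y in 𝓝 x, ComplexSmoothAt f y) :
    ∀ᶠ y in 𝓝 x, ComplexSmoothAt (iteratedFDeriv ℝ k f) y := by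
  induction k with
  | zero =>
    filter_upwards [h] with y hy
    refine ComplexSmoothAt.clm_comp (W' := E [×0]→L[ℝ] W)
      (continuousMultilinearCurryFin0 ℝ E W).symm.toContinuousLinearEquiv.toContinuousLinearMap (fun w => ?_) hy
    ext m
    rfl
  | succ k ih =>
    filter_upwards [ih.eventually_nhds] with y hy
    refine ComplexSmoothAt.clm_comp (W' := E [×(k + 1)]→L[ℝ] W)
      (continuousMultilinearCurryLeftEquiv ℝ (fun _ : Fin (k + 1) =>
        E) W).symm.toContinuousLinearEquiv.toContinuousLinearMap (fun w => ?_) (ComplexSmoothAt.fderiv hy)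
    ext m
    rfl

/-- A Schwarz-type estimate. The `2` arises because the image is measured in a ball around `f x`,
not around the origin. -/
theorem ComplexSmoothAt.norm_fderiv_le {f : E → W} {x : E} {s M : ℝ} (hs : 0 < s)
    (h : ∀ y ∈ Metric.ball x s, ComplexSmoothAt f y) (hM : ∀ y ∈ Metric.ball x s, ‖f y‖ ≤ M) :
    ‖_root_.fderiv ℝ f x‖ ≤ 2 * M / s := by
  have hx := h x (Metric.mem_ball_self hs)
  have h1 := Complex.norm_fderiv_le_div_of_mapsTo_ball (f := f) (c := x) (R₁ := s) (R₂ := 2 * M)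
    (fun y hy => (h y hy).differentiableAt.differentiableWithinAt) (fun y hy => by
      rw [mem_closedBall_iff_norm]
      have := norm_sub_le (f y) (f x)
      linarith [hM y hy, hM x (Metric.mem_ball_self hs)]) hs
  refine le_trans (ContinuousLinearMap.opNorm_le_bound _ (norm_nonneg _) fun v => ?_) h1
  rw [← hx.fderiv_apply_eq]
  exact ContinuousLinearMap.le_opNorm _ _

/-- Each differentiation gives up a layer of thickness `r / n`; after `n` of them a ball of radius
`r` remains, at the price of a factor `2n / r` each time. -/
theorem norm_iteratedFDeriv_le_of_complexSmooth {f : E → W} {x : E} {r M : ℝ} (hr : 0 < r)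
    (h : ∀ y ∈ Metric.ball x (2 * r), ComplexSmoothAt f y)
    (hM : ∀ y ∈ Metric.ball x (2 * r), ‖f y‖ ≤ M) (n : ℕ) (k : ℕ) (hk : k ≤ n) :
    ∀ y ∈ Metric.ball x (2 * r - k * (r / n)), ‖iteratedFDeriv ℝ k f y‖ ≤ M * (2 * n / r) ^ k := by
  induction k with
  | zero =>
    intro y hy
    simpa using hM y (by simpa using hy)
  | succ k ih =>
    intro y hy
    have hn : (0 : ℝ) < n := by exact_mod_cast (Nat.succ_pos k).trans_le hk
    have hsub : Metric.ball y (r / n) ⊆ Metric.ball x (2 * r - k * (r / n)) := by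
      refine Metric.ball_subset_ball' ?_
      rw [Metric.mem_ball] at hy
      push_cast at hy
      linarith
    have h1 := ComplexSmoothAt.norm_fderiv_le (f := iteratedFDeriv ℝ k f) (x := y) (s := r / n)
      (M := M * (2 * n / r) ^ k) (by positivity) (fun z hz => ?_)
      fun z hz => ih (by omega) z (hsub hz)
    · rw [norm_fderiv_iteratedFDeriv] at h1
      refine h1.trans (le_of_eq ?_)
      rw [pow_succ]
      field_simp
    · have hz2 : z ∈ Metric.ball x (2 * r) :=
        Metric.ball_subset_ball (by have : 0 ≤ (k : ℝ) * (r / n) := by positivity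
                                    linarith) (hsub hz)
      exact (ComplexSmoothAt.iteratedFDeriv k
        (Filter.eventually_of_mem (Metric.isOpen_ball.mem_nhds hz2) h)).self_of_nhds

/-- A real smooth function with complex linear derivatives is analytic. -/
theorem analyticAt_of_complexSmooth [CompleteSpace W] {f : E → W} {x : E}
    (h : ∀ᶠ y in 𝓝 x, ComplexSmoothAt f y) : AnalyticAt ℝ f x := by
  have hc : ContinuousAt f x := h.self_of_nhds.1.continuousAt
  have hb : ∀ᶠ y in 𝓝 x, ‖f y‖ < ‖f x‖ + 1 :=
    hc.norm.eventually (gt_mem_nhds (lt_add_one _))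
  obtain ⟨ε, hε, hball⟩ := Metric.eventually_nhds_iff_ball.1 (h.and hb)
  set r := ε / 2 with hrdef
  have hr : 0 < r := by positivity
  have hr2 : 2 * r = ε := by rw [hrdef]; ring
  set M := ‖f x‖ + 1 with hMdef
  have hM0 : 0 ≤ M := by positivity
  have hs : ∀ y ∈ Metric.ball x (2 * r), ComplexSmoothAt f y := fun y hy => (hball y (hr2 ▸ hy)).1
  have hM : ∀ y ∈ Metric.ball x (2 * r), ‖f y‖ ≤ M := fun y hy => (hball y (hr2 ▸ hy)).2.le
  -- The Taylor series of `f`. The factors `n ^ n` in the derivative bounds are absorbed by the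
  -- factorials through `n ^ n / n! ≤ e ^ n`.
  let p : FormalMultilinearSeries ℝ E W := fun n => (n.factorial : ℝ)⁻¹ • iteratedFDeriv ℝ n f x
  have hp : ∀ n, ‖p n‖ ≤ M * (2 * Real.exp 1 / r) ^ n := by
    intro n
    have h1 : ‖iteratedFDeriv ℝ n f x‖ ≤ M * (2 * n / r) ^ n := by
      refine norm_iteratedFDeriv_le_of_complexSmooth hr hs hM n n le_rfl x (Metric.mem_ball_self ?_)
      rcases Nat.eq_zero_or_pos n with rfl | hn
      · simpa using hr
      · have : (0 : ℝ) < n := by exact_mod_cast hn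
        field_simp
        linarith
    have h2 := Real.pow_div_factorial_le_exp (n : ℝ) (Nat.cast_nonneg n) n
    have h3 : Real.exp n = Real.exp 1 ^ n := by rw [← Real.exp_nat_mul, mul_one]
    rw [h3] at h2
    have h4 : ‖p n‖ = (n.factorial : ℝ)⁻¹ * ‖iteratedFDeriv ℝ n f x‖ := by
      simp only [p, norm_smul, norm_inv, Real.norm_natCast]
    rw [h4]
    calc (n.factorial : ℝ)⁻¹ * ‖iteratedFDeriv ℝ n f x‖
        ≤ (n.factorial : ℝ)⁻¹ * (M * (2 * n / r) ^ n) := by gcongr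
      _ = M * (2 / r) ^ n * ((n : ℝ) ^ n / n.factorial) := by
        rw [show (2 * (n : ℝ) / r) = 2 / r * n by ring, mul_pow]; ring
      _ ≤ M * (2 / r) ^ n * Real.exp 1 ^ n := by gcongr
      _ = _ := by rw [mul_assoc, ← mul_pow]; congr 2; ring
  -- Chosen so that the geometric ratio in the coefficient bound is exactly one.
  obtain ⟨ρ, hρ⟩ : ∃ ρ : NNReal, (ρ : ℝ) = r / (2 * Real.exp 1) :=
    ⟨⟨r / (2 * Real.exp 1), by positivity⟩, rfl⟩
  have hρ0 : 0 < ρ := by rw [← NNReal.coe_pos, hρ]; positivity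
  have hρr : (ρ : ℝ) ≤ r := by
    rw [hρ]
    exact div_le_self hr.le (by linarith [Real.add_one_le_exp 1])
  refine ⟨p, ρ, ?_, by exact_mod_cast hρ0, ?_⟩
  · refine p.le_radius_of_bound M fun n => ?_
    calc ‖p n‖ * (ρ : ℝ) ^ n ≤ M * (2 * Real.exp 1 / r) ^ n * (ρ : ℝ) ^ n := by gcongr; exact hp n
      _ = M * (2 * Real.exp 1 / r * ρ) ^ n := by rw [mul_assoc, mul_pow]
      _ = M := by
        have : 2 * Real.exp 1 / r * ρ = 1 := by
          rw [hρ]; field_simp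
        rw [this]; simp
      _ ≤ M := le_rfl
  · intro y hy
    have hy' : ‖y‖ < r := by
      have : ‖y‖ < ρ := by simpa using hy
      exact this.trans_le hρr
    -- Convergence to `f` is checked on complex lines: `c ↦ f (x + c • y)` is holomorphic for `|c| <
    -- 2`, and its Taylor series at `0`, evaluated at `c = 1`, is the series `p` at `y`.
    have hmem : ∀ c ∈ Metric.ball (0 : ℂ) 2, x + c • y ∈ Metric.ball x (2 * r) := by
      intro c hc
      rw [mem_ball_zero_iff] at hc
      rw [mem_ball_iff_norm, add_sub_cancel_left, norm_smul]
      exact mul_lt_mul'' hc hy' (norm_nonneg _) (norm_nonneg _)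
    have hl : ∀ c : ℂ, HasDerivAt (fun c : ℂ => x + c • y) y c := fun c => by
      simpa using ((hasDerivAt_id c).smul_const y).const_add x
    have hit : ∀ n, ∀ c ∈ Metric.ball (0 : ℂ) 2,
        iteratedDeriv n (fun c : ℂ => f (x + c • y)) c =
          iteratedFDeriv ℝ n f (x + c • y) fun _ => y := by
      intro n
      induction n with
      | zero => intro c _; simp
      | succ n ih =>
        intro c hc
        have h1 : iteratedDeriv n (fun c : ℂ => f (x + c • y)) =ᶠ[𝓝 c]
            fun c => iteratedFDeriv ℝ n f (x + c • y) fun _ => y :=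
          Filter.eventually_of_mem (Metric.isOpen_ball.mem_nhds hc) ih
        have h2 : ComplexSmoothAt (iteratedFDeriv ℝ n f) (x + c • y) :=
          (ComplexSmoothAt.iteratedFDeriv n (Filter.eventually_of_mem
            (Metric.isOpen_ball.mem_nhds (hmem c hc)) hs)).self_of_nhds
        have h3 : HasDerivAt (fun c : ℂ => iteratedFDeriv ℝ n f (x + c • y))
            (fderiv ℂ (iteratedFDeriv ℝ n f) (x + c • y) y) c :=
          h2.differentiableAt.hasFDerivAt.comp_hasDerivAt c (hl c)
        have h4 : HasDerivAt (fun c : ℂ => iteratedFDeriv ℝ n f (x + c • y) fun _ => y)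
            (fderiv ℂ (iteratedFDeriv ℝ n f) (x + c • y) y fun _ => y) c :=
          (ContinuousMultilinearMap.apply ℝ (fun _ : Fin n => E) W
            (fun _ => y)).exists_restrictScalars_eq (fun _ => rfl) |>.elim fun A hA => by
            have := A.hasFDerivAt.comp_hasDerivAt c h3
            have hAv : ∀ v, A v = v fun _ => y := fun v =>
              congrArg (fun L : (E [×n]→L[ℝ] W) →L[ℝ] W => L v) hA
            simpa only [Function.comp_def, hAv] using this
        rw [iteratedDeriv_succ, h1.deriv_eq, h4.deriv, h2.fderiv_apply_eq,
          iteratedFDeriv_succ_apply_left]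
        rfl
    have hdiff : DifferentiableOn ℂ (fun c : ℂ => f (x + c • y)) (Metric.ball 0 2) := by
      intro c hc
      exact ((hs _ (hmem c hc)).differentiableAt.hasFDerivAt.comp_hasDerivAt c
        (hl c)).differentiableAt.differentiableWithinAt
    have hsum := Complex.hasSum_taylorSeries_on_ball hdiff
      (show (1 : ℂ) ∈ Metric.ball (0 : ℂ) 2 by simp)
    have h0 : (0 : ℂ) ∈ Metric.ball (0 : ℂ) 2 := by simp
    simp only [sub_zero, one_pow, one_smul, hit _ 0 h0, zero_smul, add_zero] at hsum
    convert hsum using 2 with n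
    simp only [p, smul_apply]
    rw [← Complex.ofReal_natCast, ← Complex.ofReal_inv, Complex.coe_smul]

end Osgood

/-! ### Holomorphic extension of real analytic functions -/

section Complexification

variable {ι : Type*} [Fintype ι]

/-- The complex multilinear extension of a real multilinear form on `ι → ℝ`. -/
noncomputable def complexifyMultilinear [DecidableEq ι] {n : ℕ} (p : (ι → ℝ) [×n]→L[ℝ] ℝ) :
    (ι → ℂ) [×n]→L[ℂ] ℂ :=
  ∑ s : Fin n → ι, ((p fun k => Pi.single (s k) 1 : ℝ) : ℂ) •
    (ContinuousMultilinearMap.mkPiAlgebra ℂ (Fin n) ℂ).compContinuousLinearMap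
      fun k => ContinuousLinearMap.proj (R := ℂ) (φ := fun _ : ι => ℂ) (s k)

theorem complexifyMultilinear_ofReal [DecidableEq ι] {n : ℕ} (p : (ι → ℝ) [×n]→L[ℝ] ℝ)
    (v : Fin n → ι → ℝ) :
    complexifyMultilinear p (fun k i => (v k i : ℂ)) = (p v : ℂ) := by
  have h1 : v = fun k => ∑ i, v k i • (Pi.single i 1 : ι → ℝ) := by
    ext k i
    simp [Finset.sum_apply, Pi.single_apply]
  have h2 : p v = ∑ s : Fin n → ι, (∏ k, v k (s k)) * p fun k => Pi.single (s k) 1 := by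
    conv_lhs => rw [h1]
    rw [ContinuousMultilinearMap.map_sum]
    refine Finset.sum_congr rfl fun s _ => ?_
    rw [ContinuousMultilinearMap.map_smul_univ, smul_eq_mul]
  rw [h2, complexifyMultilinear, sum_apply]
  push_cast
  refine Finset.sum_congr rfl fun s _ => ?_
  simp [mul_comm]

/-- There are `card ι ^ n` monomials; each has coefficient at most `‖p‖`, since basis vectors have
sup norm at most one. -/
theorem norm_complexifyMultilinear_le [DecidableEq ι] {n : ℕ} (p : (ι → ℝ) [×n]→L[ℝ] ℝ) :
    ‖complexifyMultilinear p‖ ≤ (Fintype.card ι : ℝ) ^ n * ‖p‖ := by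
  refine (norm_sum_le _ _).trans ?_
  have h : ∀ s ∈ (Finset.univ : Finset (Fin n → ι)), ‖((p fun k => Pi.single (s k) 1 : ℝ) : ℂ) •
      (ContinuousMultilinearMap.mkPiAlgebra ℂ (Fin n) ℂ).compContinuousLinearMap
      fun k => ContinuousLinearMap.proj (R := ℂ) (φ := fun _ : ι => ℂ) (s k)‖ ≤ ‖p‖ := by
    intro s _
    rw [norm_smul, Complex.norm_real]
    have h1 : ‖p fun k => Pi.single (s k) 1‖ ≤ ‖p‖ := by
      refine (p.le_opNorm _).trans (mul_le_of_le_one_right (norm_nonneg _)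
        (Finset.prod_le_one (fun _ _ => norm_nonneg _) fun k _ => ?_))
      refine (pi_norm_le_iff_of_nonneg zero_le_one).2 fun i => ?_
      rw [Pi.single_apply]
      split_ifs <;> simp
    have h2 : ‖(ContinuousMultilinearMap.mkPiAlgebra ℂ (Fin n) ℂ).compContinuousLinearMap
        fun k => ContinuousLinearMap.proj (R := ℂ) (φ := fun _ : ι => ℂ) (s k)‖ ≤ 1 := by
      refine ContinuousMultilinearMap.opNorm_le_bound zero_le_one fun m => ?_
      simp only [ContinuousMultilinearMap.compContinuousLinearMap_apply,
        ContinuousMultilinearMap.mkPiAlgebra_apply, ContinuousLinearMap.proj_apply, norm_prod,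
        one_mul]
      exact Finset.prod_le_prod (fun _ _ => norm_nonneg _) fun k _ => norm_le_pi_norm (m k) (s k)
    calc _ ≤ ‖p‖ * 1 := mul_le_mul h1 h2 (norm_nonneg _) (norm_nonneg _)
      _ = ‖p‖ := mul_one _
  refine (Finset.sum_le_sum h).trans (le_of_eq ?_)
  simp

/-- A real analytic function of several variables extends holomorphically. -/
theorem AnalyticAt.exists_complex_extension {f : (ι → ℝ) → ℝ} {x : ι → ℝ}
    (hf : AnalyticAt ℝ f x) :
    ∃ G : (ι → ℂ) → ℂ, AnalyticAt ℂ G (fun i => (x i : ℂ)) ∧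
      ∀ᶠ y in 𝓝 x, G (fun i => (y i : ℂ)) = f y := by
  classical
  obtain ⟨p, r, hp⟩ := hf
  let q : FormalMultilinearSeries ℂ (ι → ℂ) ℂ := fun n => complexifyMultilinear (p n)
  obtain ⟨ρ, hρ0, hρ⟩ := ENNReal.lt_iff_exists_nnreal_btwn.1 hp.r_pos
  obtain ⟨C, hC0, hC⟩ := p.norm_mul_pow_le_of_lt_radius (hρ.trans_le hp.r_le)
  have hρ0' : 0 < ρ := by exact_mod_cast hρ0
  -- The growth factor `card ι ^ n` shrinks the radius by `card ι`; the added one avoids division by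
  -- zero when there are no variables.
  set ρ' : NNReal := ρ / (Fintype.card ι + 1) with hρ'
  have hρ'0 : 0 < ρ' := by positivity
  have hqr : (ρ' : ENNReal) ≤ q.radius := by
    refine q.le_radius_of_bound C fun n => ?_
    calc ‖q n‖ * (ρ' : ℝ) ^ n
        ≤ ((Fintype.card ι : ℝ) ^ n * ‖p n‖) * (ρ' : ℝ) ^ n := by
          gcongr; exact norm_complexifyMultilinear_le _
      _ = ‖p n‖ * ((Fintype.card ι : ℝ) * ρ') ^ n := by rw [mul_pow]; ring
      _ ≤ ‖p n‖ * (ρ : ℝ) ^ n := by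
          gcongr
          rw [hρ']
          push_cast
          rw [mul_div_assoc', div_le_iff₀ (by positivity)]
          nlinarith [ρ.coe_nonneg]
      _ ≤ C := hC n
  have hqb := q.hasFPowerSeriesOnBall ((by exact_mod_cast hρ'0 : (0 : ENNReal) < ρ').trans_le hqr)
  refine ⟨fun z => q.sum (z - fun i => (x i : ℂ)), ?_, ?_⟩
  · have h1 : AnalyticAt ℂ q.sum ((fun i => (x i : ℂ)) - fun i => (x i : ℂ)) := by
      rw [sub_self]; exact hqb.analyticAt
    exact h1.comp (f := fun z : ι → ℂ => z - fun i => (x i : ℂ)) (analyticAt_id.sub analyticAt_const)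
  · have hnear : ∀ᶠ y in 𝓝 x, ‖y - x‖ < min ρ ρ' := by
      have hc : ContinuousAt (fun y => ‖y - x‖) x := by fun_prop
      refine hc.eventually (gt_mem_nhds ?_)
      simp [hρ0', hρ'0]
    filter_upwards [hnear] with y hy
    have hy1 : ‖y - x‖ < ρ := hy.trans_le (min_le_left _ _)
    have hy2 : ‖y - x‖ < ρ' := hy.trans_le (min_le_right _ _)
    have hcast : ((fun i => (y i : ℂ)) - fun i => (x i : ℂ)) = fun i => (((y - x) i : ℝ) : ℂ) := by
      ext i; simp
    have hn : ‖(fun i => (((y - x) i : ℝ) : ℂ))‖ = ‖y - x‖ := by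
      simp only [Pi.norm_def, Complex.nnnorm_real]
    have h1 : HasSum (fun n => p n fun _ => y - x) (f y) := by
      have := hp.hasSum (y := y - x) (by
        rw [Metric.mem_eball, edist_zero_right, enorm_eq_nnnorm]
        exact lt_trans (by exact_mod_cast hy1) hρ)
      simpa using this
    have h2 : HasSum (fun n => q n fun _ => fun i => (((y - x) i : ℝ) : ℂ))
        (q.sum fun i => (((y - x) i : ℝ) : ℂ)) := by
      have := hqb.hasSum (y := fun i => (((y - x) i : ℝ) : ℂ)) (by
        rw [Metric.mem_eball, edist_zero_right, enorm_eq_nnnorm]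
        refine lt_of_lt_of_le ?_ hqr
        have h3 : ‖(fun i => (((y - x) i : ℝ) : ℂ))‖₊ < ρ' := by
          rw [← NNReal.coe_lt_coe, coe_nnnorm, hn]; exact hy2
        exact_mod_cast h3)
      simpa using this
    have h3 : (fun n => q n fun _ => fun i => (((y - x) i : ℝ) : ℂ)) =
        fun n => ((p n fun _ => y - x : ℝ) : ℂ) :=
      funext fun n => complexifyMultilinear_ofReal (p n) fun _ => y - x
    rw [h3] at h2
    rw [hcast]
    exact h2.unique (Complex.hasSum_ofReal.2 h1)

/-- A function of parameters and a point of the plane that is real analytic extends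
holomorphically. -/
theorem exists_complex_extension_plane {d : ℕ} {p : (Fin d → ℝ) × (ℝ × ℝ) → ℝ} {μ₀ : Fin d → ℝ}
    (hp : AnalyticAt ℝ p (μ₀, 0)) :
    ∃ G : (Fin d → ℂ) × (ℂ × ℂ) → ℂ, AnalyticAt ℂ G (fun i => (μ₀ i : ℂ), 0) ∧
      ∀ᶠ y in 𝓝 (μ₀, (0 : ℝ × ℝ)),
        G (fun i => (y.1 i : ℂ), complexifyPlane y.2) = p y := by
  -- Parameters and the two plane coordinates are packed into one finite index type, to which the
  -- extension of functions on `ι → ℝ` applies.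
  let S : ((Fin d ⊕ Bool) → ℝ) →L[ℝ] (Fin d → ℝ) × (ℝ × ℝ) :=
    (ContinuousLinearMap.pi fun i => ContinuousLinearMap.proj (Sum.inl i)).prod
      ((ContinuousLinearMap.proj (Sum.inr false)).prod (ContinuousLinearMap.proj (Sum.inr true)))
  let T : (Fin d → ℂ) × (ℂ × ℂ) →L[ℂ] ((Fin d ⊕ Bool) → ℂ) :=
    ContinuousLinearMap.pi fun j => Sum.elim
      (fun i => (ContinuousLinearMap.proj i).comp (ContinuousLinearMap.fst ℂ (Fin d → ℂ) (ℂ × ℂ)))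
      (fun b => if b then (ContinuousLinearMap.snd ℂ ℂ ℂ).comp
          (ContinuousLinearMap.snd ℂ (Fin d → ℂ) (ℂ × ℂ))
        else (ContinuousLinearMap.fst ℂ ℂ ℂ).comp
          (ContinuousLinearMap.snd ℂ (Fin d → ℂ) (ℂ × ℂ))) j
  let Tr : (Fin d → ℝ) × (ℝ × ℝ) → ((Fin d ⊕ Bool) → ℝ) := fun y =>
    Sum.elim y.1 fun b => if b then y.2.2 else y.2.1
  have hTr : Continuous Tr := by
    refine continuous_pi fun j => ?_
    rcases j with i | b
    · simp only [Tr, Sum.elim_inl]; fun_prop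
    · cases b <;> simp only [Tr, Sum.elim_inr] <;> simp <;> fun_prop
  have hST : ∀ y, S (Tr y) = y := by
    intro y; rfl
  have hTT : ∀ y : (Fin d → ℝ) × (ℝ × ℝ), T (fun i => (y.1 i : ℂ), complexifyPlane y.2) =
      fun j => ((Tr y j : ℝ) : ℂ) := by
    intro y
    ext j
    rcases j with i | b
    · rfl
    · cases b <;> rfl
  have h1 : AnalyticAt ℝ (fun v => p (S v)) (Tr (μ₀, 0)) := by
    have : AnalyticAt ℝ p (S (Tr (μ₀, 0))) := by rw [hST]; exact hp
    exact this.comp (f := S) (S.analyticAt _)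
  obtain ⟨G, hG, hGp⟩ := h1.exists_complex_extension
  refine ⟨fun x => G (T x), ?_, ?_⟩
  · have h2 := hTT (μ₀, 0)
    have h0 : complexifyPlane 0 = 0 := by simp [complexifyPlane]
    simp only [h0] at h2
    rw [← h2] at hG
    exact hG.comp (f := T) (T.analyticAt _)
  · have := (hTr.continuousAt (x := (μ₀, (0 : ℝ × ℝ)))).eventually hGp
    filter_upwards [this] with y hy
    rw [hTT, hy, hST]

end Complexification

/-! ### Jacobians in `z` and the inverse function theorem with parameters -/

section Jacobian

variable {N : Type} [NormedAddCommGroup N] [NormedSpace ℝ N] {R : N → N → Prop}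

/-- The Jacobian determinant in the complex variables. -/
noncomputable def jac (F : N × (ℂ × ℂ) → ℂ × ℂ) (x : N × (ℂ × ℂ)) : ℂ :=
  (fderiv ℝ F x (0, (1, 0))).1 * (fderiv ℝ F x (0, (0, 1))).2 -
    (fderiv ℝ F x (0, (0, 1))).1 * (fderiv ℝ F x (0, (1, 0))).2

theorem HolAt.fderiv_pair {W : Type} [NormedAddCommGroup W] [NormedSpace ℂ W]
    {F : N × (ℂ × ℂ) → W} {x : N × (ℂ × ℂ)} (h : HolAt R F x) (hR : R 0 0) (α β : ℂ) :
    fderiv ℝ F x (0, (α, β)) = α • fderiv ℝ F x (0, (1, 0)) + β • fderiv ℝ F x (0, (0, 1)) := by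
  rw [← h.fderiv_smul hR, ← h.fderiv_smul hR, ← map_add]
  simp

theorem fderiv_subst {Z Z' W : Type} [NormedAddCommGroup Z] [NormedSpace ℝ Z]
    [NormedAddCommGroup Z'] [NormedSpace ℝ Z'] [NormedAddCommGroup W] [NormedSpace ℝ W]
    {F : N × Z' → W} {g : N × Z → Z'} {x : N × Z}
    (hF : DifferentiableAt ℝ F (x.1, g x)) (hg : DifferentiableAt ℝ g x) (v : N × Z) :
    fderiv ℝ (fun y => F (y.1, g y)) x v = fderiv ℝ F (x.1, g x) (v.1, fderiv ℝ g x v) := by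
  have h1 : HasFDerivAt (fun y : N × Z => (y.1, g y))
      ((ContinuousLinearMap.fst ℝ N Z).prod (fderiv ℝ g x)) x :=
    hasFDerivAt_fst.prodMk hg.hasFDerivAt
  have h2 : HasFDerivAt (fun y => F (y.1, g y))
      ((fderiv ℝ F (x.1, g x)).comp ((ContinuousLinearMap.fst ℝ N Z).prod (fderiv ℝ g x))) x :=
    HasFDerivAt.comp x hF.hasFDerivAt h1
  rw [h2.fderiv]
  rfl

/-- The chain rule at fixed parameter; complex linearity in `z` is what makes a `2 × 2` complex
determinant multiplicative here. -/
theorem jac_subst {F g : N × (ℂ × ℂ) → ℂ × ℂ} {x : N × (ℂ × ℂ)} (hR : R 0 0)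
    (hF : HolAt R F (x.1, g x)) (hg : HolAt R g x) :
    jac (fun y => F (y.1, g y)) x = jac F (x.1, g x) * jac g x := by
  have key : ∀ v, fderiv ℝ (fun y => F (y.1, g y)) x (0, v) =
      (fderiv ℝ g x (0, v)).1 • fderiv ℝ F (x.1, g x) (0, (1, 0)) +
      (fderiv ℝ g x (0, v)).2 • fderiv ℝ F (x.1, g x) (0, (0, 1)) := by
    intro v
    rw [fderiv_subst hF.differentiableAt hg.differentiableAt, ← hF.fderiv_pair hR]
  simp only [jac, key, Prod.fst_add, Prod.snd_add, Prod.smul_fst, Prod.smul_snd, smul_eq_mul]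
  ring

theorem jac_congr {F G : N × (ℂ × ℂ) → ℂ × ℂ} {x : N × (ℂ × ℂ)} (h : F =ᶠ[𝓝 x] G) :
    jac F x = jac G x := by
  simp only [jac, h.fderiv_eq]

theorem jac_snd (x : N × (ℂ × ℂ)) : jac (fun y : N × (ℂ × ℂ) => y.2) x = 1 := by
  have h : fderiv ℝ (fun y : N × (ℂ × ℂ) => y.2) x = ContinuousLinearMap.snd ℝ N (ℂ × ℂ) :=
    hasFDerivAt_snd.fderiv
  simp [jac, h]

theorem HolAt.jac {F : N × (ℂ × ℂ) → ℂ × ℂ} {x : N × (ℂ × ℂ)} (h : ∀ᶠ y in 𝓝 x, HolAt R F y) :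
    HolAt R (jac F) x := by
  have h1 := HolAt.fderiv_apply h (1, 0)
  have h2 := HolAt.fderiv_apply h (0, 1)
  exact (h1.fst.mul h2.snd).sub (h2.fst.mul h1.snd)

/-- The derivative of `(ν, z) ↦ (ν, Φ (ν, z))` is block triangular with the identity on parameters,
so only the `z` block has to be inverted, by Cramer's rule. -/
theorem HolAt.exists_equiv [CompleteSpace N] {Φ : N × (ℂ × ℂ) → ℂ × ℂ} {x : N × (ℂ × ℂ)}
    (hR : R 0 0) (h : HolAt R Φ x) (hj : _root_.jac Φ x ≠ 0) :
    ∃ L : (N × (ℂ × ℂ)) ≃L[ℝ] N × (ℂ × ℂ),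
      (L : N × (ℂ × ℂ) →L[ℝ] N × (ℂ × ℂ)) =
        (ContinuousLinearMap.fst ℝ N (ℂ × ℂ)).prod (fderiv ℝ Φ x) := by
  set D := (ContinuousLinearMap.fst ℝ N (ℂ × ℂ)).prod (fderiv ℝ Φ x) with hD
  set A := fderiv ℝ Φ x (0, (1, 0)) with hA
  set B := fderiv ℝ Φ x (0, (0, 1)) with hB
  have hj' : A.1 * B.2 - B.1 * A.2 ≠ 0 := hj
  have hinj : LinearMap.ker (D : N × (ℂ × ℂ) →ₗ[ℝ] N × (ℂ × ℂ)) = ⊥ := by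
    rw [LinearMap.ker_eq_bot']
    rintro ⟨n, α, β⟩ hn
    have hn1 : n = 0 := congrArg Prod.fst hn
    subst hn1
    have hn2 : fderiv ℝ Φ x (0, (α, β)) = 0 := congrArg Prod.snd hn
    rw [h.fderiv_pair hR, ← hA, ← hB] at hn2
    have e1 : α * A.1 + β * B.1 = 0 := congrArg Prod.fst hn2
    have e2 : α * A.2 + β * B.2 = 0 := congrArg Prod.snd hn2
    have hα : α * (A.1 * B.2 - B.1 * A.2) = 0 := by linear_combination B.2 * e1 - B.1 * e2
    have hβ : β * (A.1 * B.2 - B.1 * A.2) = 0 := by linear_combination A.1 * e2 - A.2 * e1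
    rw [(mul_eq_zero.1 hα).resolve_right hj', (mul_eq_zero.1 hβ).resolve_right hj']
    rfl
  have hsurj : LinearMap.range (D : N × (ℂ × ℂ) →ₗ[ℝ] N × (ℂ × ℂ)) = ⊤ := by
    rw [LinearMap.range_eq_top]
    rintro ⟨n, w⟩
    set w' := w - fderiv ℝ Φ x (n, 0) with hw'
    refine ⟨(n, ((w'.1 * B.2 - B.1 * w'.2) / (A.1 * B.2 - B.1 * A.2),
      (A.1 * w'.2 - w'.1 * A.2) / (A.1 * B.2 - B.1 * A.2))), ?_⟩
    refine Prod.ext rfl ?_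
    change fderiv ℝ Φ x (n, _) = w
    have hs : ∀ z : ℂ × ℂ, (n, z) = (n, (0 : ℂ × ℂ)) + ((0 : N), z) := by intro z; simp
    rw [hs, map_add, h.fderiv_pair hR, ← hA, ← hB]
    have hw : w = fderiv ℝ Φ x (n, 0) + w' := by rw [hw']; abel
    rw [hw, add_right_inj]
    ext
    · simp only [Prod.fst_add, Prod.smul_fst, smul_eq_mul]
      rw [div_mul_eq_mul_div, div_mul_eq_mul_div, ← add_div, div_eq_iff hj']
      ring
    · simp only [Prod.snd_add, Prod.smul_snd, smul_eq_mul]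
      rw [div_mul_eq_mul_div, div_mul_eq_mul_div, ← add_div, div_eq_iff hj']
      ring
  exact ⟨ContinuousLinearEquiv.ofBijective D hinj hsurj, by ext v <;> rfl⟩

/-- The inverse function theorem with parameters. -/
theorem exists_inverse [CompleteSpace N] {Φ : N × (ℂ × ℂ) → ℂ × ℂ} {ν₀ : N} (hR : R 0 0)
    (h : ∀ᶠ x in 𝓝 (ν₀, (0 : ℂ × ℂ)), HolAt R Φ x) (h0 : Φ (ν₀, 0) = 0)
    (hj : jac Φ (ν₀, 0) ≠ 0) :
    ∃ Ψ : N × (ℂ × ℂ) → ℂ × ℂ, (∀ᶠ x in 𝓝 (ν₀, (0 : ℂ × ℂ)), HolAt R Ψ x) ∧ Ψ (ν₀, 0) = 0 ∧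
      (∀ᶠ x in 𝓝 (ν₀, (0 : ℂ × ℂ)), Ψ (x.1, Φ x) = x.2) ∧
      ∀ᶠ x in 𝓝 (ν₀, (0 : ℂ × ℂ)), Φ (x.1, Ψ x) = x.2 := by
  let Θ : N × (ℂ × ℂ) → N × (ℂ × ℂ) := fun x => (x.1, Φ x)
  have hΘ : ∀ x, HolAt R Φ x → HasFDerivAt Θ
      ((ContinuousLinearMap.fst ℝ N (ℂ × ℂ)).prod (fderiv ℝ Φ x)) x := fun x hx =>
    hasFDerivAt_fst.prodMk hx.hasFDerivAt
  have hΘc : ∀ x, HolAt R Φ x → ContDiffAt ℝ ∞ Θ x := fun x hx => contDiffAt_fst.prodMk hx.1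
  have hx0 := h.self_of_nhds
  obtain ⟨L, hL⟩ := hx0.exists_equiv hR hj
  have hd : HasFDerivAt Θ (L : N × (ℂ × ℂ) →L[ℝ] N × (ℂ × ℂ)) (ν₀, 0) := hL ▸ hΘ _ hx0
  let e := (hΘc _ hx0).toOpenPartialHomeomorph Θ hd (by simp)
  have he : ∀ x, e x = Θ x := fun x => rfl
  have hΘ0 : Θ (ν₀, 0) = (ν₀, 0) := by simp only [Θ, h0]
  have hsrc : (ν₀, (0 : ℂ × ℂ)) ∈ e.source :=
    (hΘc _ hx0).mem_toOpenPartialHomeomorph_source hd (by simp)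
  have htgt : (ν₀, (0 : ℂ × ℂ)) ∈ e.target := by
    have := e.map_source hsrc
    rwa [he, hΘ0] at this
  have hsymm0 : e.symm (ν₀, 0) = (ν₀, 0) := by
    have := e.left_inv hsrc
    rwa [he, hΘ0] at this
  have hfst : ∀ y ∈ e.target, (e.symm y).1 = y.1 ∧ Φ (e.symm y) = y.2 := by
    intro y hy
    have h1 : Θ (e.symm y) = y := e.right_inv hy
    exact Prod.ext_iff.1 h1
  have htnear : ∀ᶠ y in 𝓝 (ν₀, (0 : ℂ × ℂ)), y ∈ e.target := e.open_target.mem_nhds htgt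
  have hsnear : ∀ᶠ y in 𝓝 (ν₀, (0 : ℂ × ℂ)), y ∈ e.source := e.open_source.mem_nhds hsrc
  have hjn : ∀ᶠ x in 𝓝 (ν₀, (0 : ℂ × ℂ)), jac Φ x ≠ 0 :=
    (HolAt.jac h).continuousAt.eventually_ne hj
  have hcs : Tendsto e.symm (𝓝 (ν₀, 0)) (𝓝 (ν₀, 0)) := by
    have := e.symm.continuousAt htgt
    rwa [ContinuousAt, hsymm0] at this
  refine ⟨fun y => (e.symm y).2, ?_, ?_, ?_, ?_⟩
  · filter_upwards [htnear, hcs.eventually (h.and hjn)] with y hy hgood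
    obtain ⟨hhol, hjy⟩ := hgood
    obtain ⟨L', hL'⟩ := hhol.exists_equiv hR hjy
    have hd' : HasFDerivAt e (L' : N × (ℂ × ℂ) →L[ℝ] N × (ℂ × ℂ)) (e.symm y) := hL' ▸ hΘ _ hhol
    have hcd : ContDiffAt ℝ ∞ e.symm y := e.contDiffAt_symm hy hd' (hΘc _ hhol)
    have hds : HasFDerivAt e.symm (L'.symm : N × (ℂ × ℂ) →L[ℝ] N × (ℂ × ℂ)) y :=
      e.hasFDerivAt_symm hy hd'
    refine HolAt.of_hasFDerivAt (contDiffAt_snd.comp y hcd)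
      ((ContinuousLinearMap.snd ℝ N (ℂ × ℂ)).hasFDerivAt.comp y hds) ?_
    intro n n' w hn
    have hLap : ∀ v, L' v = (v.1, fderiv ℝ Φ (e.symm y) v) := fun v =>
      congrArg (fun T : N × (ℂ × ℂ) →L[ℝ] N × (ℂ × ℂ) => T v) hL'
    have h1 : L' (L'.symm (n, w)) = (n, w) := L'.apply_symm_apply _
    set v := L'.symm (n, w) with hv
    rw [hLap] at h1
    have hv1 : v.1 = n := congrArg Prod.fst h1
    have hv2 : fderiv ℝ Φ (e.symm y) (n, v.2) = w := by
      rw [← hv1]; exact congrArg Prod.snd h1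
    -- The inverse derivative inherits the relation between directions: applying `L'` reduces this
    -- to the relation for `Φ` at the preimage.
    have h2 : L'.symm (n', Complex.I • w) = (n', Complex.I • v.2) := by
      rw [ContinuousLinearEquiv.symm_apply_eq, hLap, hhol.2 n n' v.2 hn, hv2]
    change (L'.symm (n', Complex.I • w)).2 = Complex.I • (L'.symm (n, w)).2
    rw [h2]
  · simp only [hsymm0]
  · filter_upwards [hsnear] with x hx
    have : e.symm (x.1, Φ x) = x := e.left_inv hx
    rw [this]
  · filter_upwards [htnear] with y hy
    have h1 := hfst y hy
    have h2 : (y.1, (e.symm y).2) = e.symm y := by rw [← h1.1]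
    rw [h2, h1.2]

end Jacobian

/-! ### Real values at real points -/

section Reality

variable {N : Type} [NormedAddCommGroup N] [NormedSpace ℝ N] {R : N → N → Prop}
  {M : Type} [NormedAddCommGroup M] [NormedSpace ℝ M] {ι : M →L[ℝ] N} {μ₀ : M}

/-- The inclusion `ℝ² → ℂ²` as a linear map. -/
noncomputable def planeCLM : ℝ × ℝ →L[ℝ] ℂ × ℂ := Complex.ofRealCLM.prodMap Complex.ofRealCLM

theorem planeCLM_apply (ρ : ℝ × ℝ) : planeCLM ρ = ((ρ.1 : ℂ), (ρ.2 : ℂ)) := rfl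

/-- The real part `ℂ² → ℝ²`. -/
noncomputable def rePlaneCLM : ℂ × ℂ →L[ℝ] ℝ × ℝ := Complex.reCLM.prodMap Complex.reCLM

theorem rePlaneCLM_apply (z : ℂ × ℂ) : rePlaneCLM z = (z.1.re, z.2.re) := rfl

/-- The inclusion of the real points. -/
noncomputable def realPoint (ι : M →L[ℝ] N) : M × (ℝ × ℝ) →L[ℝ] N × (ℂ × ℂ) :=
  ι.prodMap planeCLM

theorem realPoint_apply (ι : M →L[ℝ] N) (y : M × (ℝ × ℝ)) :
    realPoint ι y = (ι y.1, planeCLM y.2) := rfl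

theorem realPoint_center (ι : M →L[ℝ] N) (μ₀ : M) : realPoint ι (μ₀, 0) = (ι μ₀, 0) := by
  simp [realPoint_apply]

theorem tendsto_realPoint (ι : M →L[ℝ] N) (μ₀ : M) :
    Tendsto (realPoint ι) (𝓝 (μ₀, 0)) (𝓝 (ι μ₀, 0)) := by
  have := (realPoint ι).continuous.tendsto (μ₀, 0)
  rwa [realPoint_center] at this

/-- `F` takes real values at the real points near `(ι μ₀, 0)`. -/
def RealNear (ι : M →L[ℝ] N) (μ₀ : M) (F : N × (ℂ × ℂ) → ℂ) : Prop :=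
  ∀ᶠ y in 𝓝 (μ₀, (0 : ℝ × ℝ)), (F (realPoint ι y)).im = 0

theorem RealNear.mul {F G : N × (ℂ × ℂ) → ℂ} (hF : RealNear ι μ₀ F) (hG : RealNear ι μ₀ G) :
    RealNear ι μ₀ fun x => F x * G x := by
  filter_upwards [hF, hG] with y h1 h2
  simp [Complex.mul_im, h1, h2]

theorem RealNear.add {F G : N × (ℂ × ℂ) → ℂ} (hF : RealNear ι μ₀ F) (hG : RealNear ι μ₀ G) :
    RealNear ι μ₀ fun x => F x + G x := by
  filter_upwards [hF, hG] with y h1 h2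
  simp [h1, h2]

theorem RealNear.sub {F G : N × (ℂ × ℂ) → ℂ} (hF : RealNear ι μ₀ F) (hG : RealNear ι μ₀ G) :
    RealNear ι μ₀ fun x => F x - G x := by
  filter_upwards [hF, hG] with y h1 h2
  simp [h1, h2]

theorem RealNear.map {F : N × (ℂ × ℂ) → ℂ} (hF : RealNear ι μ₀ F) {h : ℂ → ℂ}
    (hh : ∀ r : ℝ, (h r).im = 0) : RealNear ι μ₀ fun x => h (F x) := by
  filter_upwards [hF] with y h1
  have h2 : ((F (realPoint ι y)).re : ℂ) = F (realPoint ι y) := Complex.ext rfl h1.symm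
  rw [← h2]
  exact hh _

/-- Needed for the square root, whose branch is known to be real only on the positive axis. -/
theorem RealNear.map_of_pos {F : N × (ℂ × ℂ) → ℂ} (hF : RealNear ι μ₀ F)
    (hc : ContinuousAt F (ι μ₀, 0)) (hpos : 0 < (F (ι μ₀, 0)).re) {h : ℂ → ℂ}
    (hh : ∀ r : ℝ, 0 < r → (h r).im = 0) : RealNear ι μ₀ fun x => h (F x) := by
  have h3 : ∀ᶠ x in 𝓝 (ι μ₀, (0 : ℂ × ℂ)), 0 < (F x).re :=
    (Complex.continuous_re.continuousAt.comp hc).eventually (lt_mem_nhds hpos)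
  filter_upwards [hF, (tendsto_realPoint ι μ₀).eventually h3] with y h1 h4
  have h2 : ((F (realPoint ι y)).re : ℂ) = F (realPoint ι y) := Complex.ext rfl h1.symm
  rw [← h2]
  exact hh _ h4

theorem RealNear.const (r : ℝ) : RealNear ι μ₀ fun _ => (r : ℂ) :=
  Eventually.of_forall fun _ => Complex.ofReal_im r

theorem RealNear.inv {F : N × (ℂ × ℂ) → ℂ} (hF : RealNear ι μ₀ F) :
    RealNear ι μ₀ fun x => (F x)⁻¹ :=
  hF.map fun r => by rw [← Complex.ofReal_inv]; exact Complex.ofReal_im _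

theorem RealNear.div {F G : N × (ℂ × ℂ) → ℂ} (hF : RealNear ι μ₀ F) (hG : RealNear ι μ₀ G) :
    RealNear ι μ₀ fun x => F x / G x := by
  simpa only [div_eq_mul_inv] using hF.mul hG.inv

theorem realNear_fst : RealNear ι μ₀ fun x => x.2.1 :=
  Eventually.of_forall fun _ => Complex.ofReal_im _

theorem realNear_snd : RealNear ι μ₀ fun x => x.2.2 :=
  Eventually.of_forall fun _ => Complex.ofReal_im _

theorem RealNear.eventually_eq {F : N × (ℂ × ℂ) → ℂ × ℂ} (h1 : RealNear ι μ₀ fun x => (F x).1)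
    (h2 : RealNear ι μ₀ fun x => (F x).2) :
    ∀ᶠ y in 𝓝 (μ₀, (0 : ℝ × ℝ)),
      planeCLM (rePlaneCLM (F (realPoint ι y))) = F (realPoint ι y) := by
  filter_upwards [h1, h2] with y e1 e2
  exact Prod.ext (Complex.ext rfl e1.symm) (Complex.ext rfl e2.symm)

theorem RealNear.subst {F : N × (ℂ × ℂ) → ℂ} {g : N × (ℂ × ℂ) → ℂ × ℂ}
    (hF : RealNear ι μ₀ F) (h1 : RealNear ι μ₀ fun x => (g x).1)
    (h2 : RealNear ι μ₀ fun x => (g x).2) (hg : ContinuousAt g (ι μ₀, 0)) (hg0 : g (ι μ₀, 0) = 0) :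
    RealNear ι μ₀ fun x => F (x.1, g x) := by
  have ht : Tendsto (fun y : M × (ℝ × ℝ) => (y.1, rePlaneCLM (g (realPoint ι y))))
      (𝓝 (μ₀, 0)) (𝓝 (μ₀, 0)) := by
    refine (continuous_fst.tendsto (μ₀, (0 : ℝ × ℝ))).prodMk_nhds ?_
    have h3 : Tendsto g (𝓝 (ι μ₀, 0)) (𝓝 0) := by
      have := hg.tendsto
      rwa [hg0] at this
    have h4 := rePlaneCLM.continuous.tendsto 0
    rw [map_zero] at h4
    exact h4.comp (h3.comp (tendsto_realPoint ι μ₀))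
  filter_upwards [ht.eventually hF, RealNear.eventually_eq h1 h2] with y e1 e2
  rw [realPoint_apply] at e1
  simp only [e2] at e1
  exact e1

/-- The imaginary part vanishes identically on nearby real points, hence so does its derivative in
real directions. -/
theorem fderiv_realPoint_im {F : N × (ℂ × ℂ) → ℂ} {y : M × (ℝ × ℝ)}
    (hF : DifferentiableAt ℝ F (realPoint ι y))
    (h : ∀ᶠ y' in 𝓝 y, (F (realPoint ι y')).im = 0) (v : M × (ℝ × ℝ)) :
    (fderiv ℝ F (realPoint ι y) (realPoint ι v)).im = 0 := by
  have h1 : HasFDerivAt (fun y' => (F (realPoint ι y')).im)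
      (Complex.imCLM.comp ((fderiv ℝ F (realPoint ι y)).comp (realPoint ι))) y :=
    Complex.imCLM.hasFDerivAt.comp y (hF.hasFDerivAt.comp y (realPoint ι).hasFDerivAt)
  have h2 : HasFDerivAt (fun y' => (F (realPoint ι y')).im) (0 : M × (ℝ × ℝ) →L[ℝ] ℝ) y :=
    (hasFDerivAt_const (0 : ℝ) y).congr_of_eventuallyEq h
  exact congrArg (fun T : M × (ℝ × ℝ) →L[ℝ] ℝ => T v) (h1.unique h2)

theorem RealNear.fderiv {F : N × (ℂ × ℂ) → ℂ} (hF : RealNear ι μ₀ F)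
    (h : ∀ᶠ x in 𝓝 (ι μ₀, (0 : ℂ × ℂ)), HolAt R F x) (v : ℝ × ℝ) :
    RealNear ι μ₀ fun x => fderiv ℝ F x (0, planeCLM v) := by
  filter_upwards [hF.eventually_nhds, (tendsto_realPoint ι μ₀).eventually h] with y h1 h2
  have := fderiv_realPoint_im h2.differentiableAt h1 (0, v)
  rwa [realPoint_apply ι (0, v), map_zero] at this

theorem RealNear.integral {F : N × (ℂ × ℂ) → ℂ} (hF : RealNear ι μ₀ F) {a b : ℝ}
    {A : ℝ → ℂ × ℂ →L[ℂ] ℂ × ℂ} {A' : ℝ → ℝ × ℝ →L[ℝ] ℝ × ℝ} (hA' : Continuous A')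
    (hAA' : ∀ t ρ, A t (planeCLM ρ) = planeCLM (A' t ρ)) (w : ℝ → ℝ) :
    RealNear ι μ₀ fun x => ∫ t in a..b, (w t : ℂ) • F (x.1, A t x.2) := by
  have hL : Continuous fun t => (ContinuousLinearMap.id ℝ M).prodMap (A' t) :=
    continuous_const.prod_mapL ℝ hA'
  have h := eventually_forall_uIcc (a := a) (b := b) hL
    (P := fun y => (F (realPoint ι y)).im = 0) (x := (μ₀, 0)) (fun t _ => by
      rw [show (ContinuousLinearMap.id ℝ M).prodMap (A' t) (μ₀, 0) = (μ₀, 0) by simp]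
      exact hF)
  filter_upwards [h] with y hy
  have h1 : ∫ t in a..b, (w t : ℂ) • F ((realPoint ι y).1, A t (realPoint ι y).2) =
      ∫ t in a..b, ((w t * (F (realPoint ι (y.1, A' t y.2))).re : ℝ) : ℂ) := by
    refine intervalIntegral.integral_congr fun t ht => ?_
    simp only [realPoint_apply, hAA', smul_eq_mul]
    have h2 : (F (ι y.1, planeCLM (A' t y.2))).im = 0 := hy t ht
    push_cast
    congr 1
    exact Complex.ext rfl h2
  rw [h1, intervalIntegral.integral_ofReal, Complex.ofReal_im]

/-- The local inverse of a map that is real at the real points is real at the real points. -/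
theorem realNear_inverse [CompleteSpace M] {Φ Ψ : N × (ℂ × ℂ) → ℂ × ℂ}
    (h : ∀ᶠ x in 𝓝 (ι μ₀, (0 : ℂ × ℂ)), HolAt R Φ x) (h0 : Φ (ι μ₀, 0) = 0)
    (hj : jac Φ (ι μ₀, 0) ≠ 0) (h1 : RealNear ι μ₀ fun x => (Φ x).1)
    (h2 : RealNear ι μ₀ fun x => (Φ x).2)
    (hΨ : ∀ᶠ x in 𝓝 (ι μ₀, (0 : ℂ × ℂ)), Ψ (x.1, Φ x) = x.2) :
    (RealNear ι μ₀ fun x => (Ψ x).1) ∧ RealNear ι μ₀ fun x => (Ψ x).2 := by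
  -- The map that `Φ` induces on real points. If it is locally onto, every nearby real point is the
  -- image of a real point, and `Ψ` sends it back to that point.
  let Θ : M × (ℝ × ℝ) → M × (ℝ × ℝ) := fun y => (y.1, rePlaneCLM (Φ (realPoint ι y)))
  have hx0 := h.self_of_nhds
  set D := fderiv ℝ Φ (ι μ₀, 0) with hD
  set Θ' : M × (ℝ × ℝ) →L[ℝ] M × (ℝ × ℝ) := (ContinuousLinearMap.fst ℝ M (ℝ × ℝ)).prod
    (rePlaneCLM.comp (D.comp (realPoint ι))) with hΘ'
  have hstrict : HasStrictFDerivAt Θ Θ' (μ₀, 0) := by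
    have h3 : HasStrictFDerivAt Φ D (realPoint ι (μ₀, 0)) := by
      rw [realPoint_center]
      exact hx0.1.hasStrictFDerivAt (by simp)
    exact hasStrictFDerivAt_fst.prodMk (rePlaneCLM.hasStrictFDerivAt.comp (μ₀, (0 : ℝ × ℝ))
      (h3.comp (μ₀, (0 : ℝ × ℝ)) (realPoint ι).hasStrictFDerivAt))
  have hreal : ∀ v, planeCLM (rePlaneCLM (D (realPoint ι v))) = D (realPoint ι v) := by
    intro v
    have hdΦ : DifferentiableAt ℝ Φ (realPoint ι (μ₀, 0)) := by
      rw [realPoint_center]; exact hx0.differentiableAt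
    have e1 := fderiv_realPoint_im (F := fun x => (Φ x).1) (hdΦ.fst) h1 v
    have e2 := fderiv_realPoint_im (F := fun x => (Φ x).2) (hdΦ.snd) h2 v
    rw [fderiv.fst hdΦ, realPoint_center] at e1
    rw [fderiv.snd hdΦ, realPoint_center] at e2
    exact Prod.ext (Complex.ext rfl e1.symm) (Complex.ext rfl e2.symm)
  have hsurj : LinearMap.range (Θ' : M × (ℝ × ℝ) →ₗ[ℝ] M × (ℝ × ℝ)) = ⊤ := by
    rw [LinearMap.range_eq_top]
    rintro ⟨m, w⟩
    set A := rePlaneCLM (D (0, (1, 0))) with hA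
    set B := rePlaneCLM (D (0, (0, 1))) with hB
    have hA' : planeCLM A = D (0, (1, 0)) := by
      have := hreal (0, (1, 0))
      rwa [realPoint_apply, map_zero, show planeCLM (1, 0) = (1, 0) by simp [planeCLM_apply]] at this
    have hB' : planeCLM B = D (0, (0, 1)) := by
      have := hreal (0, (0, 1))
      rwa [realPoint_apply, map_zero, show planeCLM (0, 1) = (0, 1) by simp [planeCLM_apply]] at this
    have hdet : A.1 * B.2 - B.1 * A.2 ≠ 0 := by
      intro hz
      apply hj
      rw [jac, ← hD, ← hA', ← hB']
      simp only [planeCLM_apply]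
      exact_mod_cast hz
    set w' := w - rePlaneCLM (D (ι m, 0)) with hw'
    refine ⟨(m, ((w'.1 * B.2 - B.1 * w'.2) / (A.1 * B.2 - B.1 * A.2),
      (A.1 * w'.2 - w'.1 * A.2) / (A.1 * B.2 - B.1 * A.2))), ?_⟩
    refine Prod.ext rfl ?_
    change rePlaneCLM (D (ι m, planeCLM ((w'.1 * B.2 - B.1 * w'.2) / (A.1 * B.2 - B.1 * A.2),
      (A.1 * w'.2 - w'.1 * A.2) / (A.1 * B.2 - B.1 * A.2)))) = w
    have hs : ∀ α β : ℝ, (ι m, planeCLM (α, β)) =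
        (ι m, (0 : ℂ × ℂ)) + (α • ((0 : N), ((1 : ℂ), (0 : ℂ))) + β • ((0 : N), ((0 : ℂ), (1 : ℂ)))) := by
      intro α β; simp [planeCLM_apply]
    rw [hs, map_add, map_add, map_add, map_add, map_smul, map_smul, map_smul, map_smul, ← hA, ← hB]
    have hw : w = rePlaneCLM (D (ι m, 0)) + w' := by rw [hw']; abel
    rw [hw, add_right_inj]
    ext
    · simp only [Prod.fst_add, Prod.smul_fst, smul_eq_mul]
      rw [div_mul_eq_mul_div, div_mul_eq_mul_div, ← add_div, div_eq_iff hdet]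
      ring
    · simp only [Prod.snd_add, Prod.smul_snd, smul_eq_mul]
      rw [div_mul_eq_mul_div, div_mul_eq_mul_div, ← add_div, div_eq_iff hdet]
      ring
  -- Local surjectivity: `Θ` maps the neighbourhood filter onto that of the image, so a property
  -- checked at the points `Θ y` holds at all nearby real points.
  have hmap := hstrict.map_nhds_eq_of_surj hsurj
  have hΘ0 : Θ (μ₀, 0) = (μ₀, 0) := by
    simp only [Θ, realPoint_center, h0, map_zero]
  rw [hΘ0] at hmap
  have hev : ∀ᶠ y in 𝓝 (μ₀, (0 : ℝ × ℝ)), Ψ (realPoint ι (Θ y)) = planeCLM y.2 := by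
    filter_upwards [RealNear.eventually_eq h1 h2, (tendsto_realPoint ι μ₀).eventually hΨ]
      with y e1 e2
    rw [realPoint_apply]
    simp only [Θ, e1]
    exact e2
  have key : ∀ᶠ y in 𝓝 (μ₀, (0 : ℝ × ℝ)), ∃ ρ : ℝ × ℝ, Ψ (realPoint ι y) = planeCLM ρ := by
    rw [← hmap, eventually_map]
    filter_upwards [hev] with y hy using ⟨_, hy⟩
  constructor
  · filter_upwards [key] with y hy
    obtain ⟨ρ, hρ⟩ := hy
    rw [hρ]; exact Complex.ofReal_im _
  · filter_upwards [key] with y hy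
    obtain ⟨ρ, hρ⟩ := hy
    rw [hρ]; exact Complex.ofReal_im _

end Reality

/-! ### The Morse lemma with parameters -/

section Morse

variable {N : Type} [NormedAddCommGroup N] [NormedSpace ℝ N] {R : N → N → Prop}
  {M : Type} [NormedAddCommGroup M] [NormedSpace ℝ M] {ι : M →L[ℝ] N} {μ₀ : M}

/-- Multiplication by a real number, as a complex linear map. -/
noncomputable def scaleCLM (Z : Type) [NormedAddCommGroup Z] [NormedSpace ℂ Z] (t : ℝ) :
    Z →L[ℂ] Z := (t : ℂ) • ContinuousLinearMap.id ℂ Z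

theorem continuous_scaleCLM (Z : Type) [NormedAddCommGroup Z] [NormedSpace ℂ Z] :
    Continuous (scaleCLM Z) := by
  unfold scaleCLM; fun_prop

theorem scaleCLM_apply {Z : Type} [NormedAddCommGroup Z] [NormedSpace ℂ Z] (t : ℝ) (z : Z) :
    scaleCLM Z t z = (t : ℂ) • z := rfl

/-- The mean of the derivative in the direction `v` along the segment from the origin. -/
noncomputable def hadamard (v : ℂ × ℂ) (F : N × (ℂ × ℂ) → ℂ) (x : N × (ℂ × ℂ)) : ℂ :=
  ∫ t in (0 : ℝ)..1, ((1 : ℝ) : ℂ) • fderiv ℝ F (x.1, scaleCLM (ℂ × ℂ) t x.2) (0, v)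

theorem eventually_holAt_hadamard {F : N × (ℂ × ℂ) → ℂ} {ν₀ : N}
    (hF : ∀ᶠ x in 𝓝 (ν₀, (0 : ℂ × ℂ)), HolAt R F x) (v : ℂ × ℂ) :
    ∀ᶠ x in 𝓝 (ν₀, (0 : ℂ × ℂ)), HolAt R (hadamard v F) x := by
  refine eventually_holAt_integral (F := fun y => fderiv ℝ F y (0, v))
    (continuous_scaleCLM (ℂ × ℂ)) continuous_const fun t _ => ?_
  simp only [map_zero]
  filter_upwards [hF.eventually_nhds] with y hy using HolAt.fderiv_apply hy v

theorem RealNear.hadamard {F : N × (ℂ × ℂ) → ℂ} (hr : RealNear ι μ₀ F)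
    (hF : ∀ᶠ x in 𝓝 (ι μ₀, (0 : ℂ × ℂ)), HolAt R F x) (v : ℝ × ℝ) :
    RealNear ι μ₀ (hadamard (planeCLM v) F) := by
  refine RealNear.integral (A' := fun t => t • ContinuousLinearMap.id ℝ (ℝ × ℝ)) (hr.fderiv hF v)
    (by fun_prop) (fun t ρ => ?_) (fun _ => 1)
  simp [scaleCLM_apply, planeCLM_apply]

/-- The fundamental theorem of calculus along the segment `t ↦ t z`, with the radial derivative
split over the two coordinates. -/
theorem eventually_eq_hadamard {F : N × (ℂ × ℂ) → ℂ} {ν₀ : N} (hR : R 0 0)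
    (hF : ∀ᶠ x in 𝓝 (ν₀, (0 : ℂ × ℂ)), HolAt R F x) :
    ∀ᶠ x in 𝓝 (ν₀, (0 : ℂ × ℂ)), F x = F (x.1, 0) + (x.2.1 * hadamard (1, 0) F x +
      x.2.2 * hadamard (0, 1) F x) := by
  have h := eventually_forall_uIcc (a := 0) (b := 1)
    (continuous_liftSnd (N := N) (continuous_scaleCLM (ℂ × ℂ))) (x := (ν₀, 0))
    (P := HolAt R F) (fun t _ => by rw [liftSnd_apply, map_zero]; exact hF)
  filter_upwards [h] with x hx
  have hline : ∀ t : ℝ, HasDerivAt (fun t : ℝ => liftSnd N (scaleCLM (ℂ × ℂ) t) x)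
      ((0 : N), x.2) t := by
    intro t
    have h1 : HasDerivAt (fun t : ℝ => (t : ℂ) • x.2) ((1 : ℂ) • x.2) t :=
      (Complex.ofRealCLM.hasDerivAt (x := t)).smul_const x.2
    rw [one_smul] at h1
    exact (hasDerivAt_const t x.1).prodMk h1
  have hc : ∀ v : N × (ℂ × ℂ), ContinuousOn
      (fun t => fderiv ℝ F (liftSnd N (scaleCLM (ℂ × ℂ) t) x) v) (uIcc 0 1) := by
    intro v t ht
    have h1 : ContinuousAt (fun t => fderiv ℝ F (liftSnd N (scaleCLM (ℂ × ℂ) t) x)) t :=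
      ContinuousAt.comp (f := fun t => liftSnd N (scaleCLM (ℂ × ℂ) t) x) (x := t)
        (g := fderiv ℝ F) (((hx t ht).1.fderiv_right (m := 0) (by simp)).continuousAt)
        (hline t).continuousAt
    exact (h1.clm_apply continuousAt_const).continuousWithinAt
  have hd : ∀ t ∈ uIcc (0 : ℝ) 1, HasDerivAt (fun t => F (liftSnd N (scaleCLM (ℂ × ℂ) t) x))
      (fderiv ℝ F (liftSnd N (scaleCLM (ℂ × ℂ) t) x) (0, x.2)) t := fun t ht =>
    (hx t ht).hasFDerivAt.comp_hasDerivAt t (hline t)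
  have hint := intervalIntegral.integral_eq_sub_of_hasDerivAt hd (hc _).intervalIntegrable
  have hsplit : ∫ t in (0 : ℝ)..1, fderiv ℝ F (liftSnd N (scaleCLM (ℂ × ℂ) t) x) (0, x.2) =
      x.2.1 * hadamard (1, 0) F x + x.2.2 * hadamard (0, 1) F x := by
    rw [hadamard, hadamard, ← intervalIntegral.integral_const_mul,
      ← intervalIntegral.integral_const_mul, ← intervalIntegral.integral_add]
    · refine intervalIntegral.integral_congr fun t ht => ?_
      simp only [Complex.ofReal_one, one_smul]
      exact (hx t ht).fderiv_pair hR x.2.1 x.2.2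
    · simp only [Complex.ofReal_one, one_smul]
      exact ((hc (0, (1, 0))).intervalIntegrable).const_mul _
    · simp only [Complex.ofReal_one, one_smul]
      exact ((hc (0, (0, 1))).intervalIntegrable).const_mul _
  rw [hsplit] at hint
  rw [hint]
  simp [liftSnd_apply, scaleCLM_apply]

theorem hadamard_center (v : ℂ × ℂ) (F : N × (ℂ × ℂ) → ℂ) (ν : N) :
    hadamard v F (ν, 0) = fderiv ℝ F (ν, 0) (0, v) := by
  simp [hadamard]

/-- A branch of the square root. -/
noncomputable def branchSqrt (z : ℂ) : ℂ := Complex.exp (Complex.log z / 2)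

theorem branchSqrt_mul_self {z : ℂ} (hz : z ≠ 0) : branchSqrt z * branchSqrt z = z := by
  rw [branchSqrt, ← Complex.exp_add, add_halves, Complex.exp_log hz]

theorem branchSqrt_ofReal {r : ℝ} (hr : 0 < r) :
    branchSqrt r = ((Real.exp (Real.log r / 2) : ℝ) : ℂ) := by
  rw [branchSqrt, ← Complex.ofReal_log hr.le]
  push_cast
  rfl

theorem contDiffAt_branchSqrt {z : ℂ} (hz : 0 < z.re) : ContDiffAt ℂ ∞ branchSqrt z := by
  have h1 : ContDiffAt ℂ ∞ Complex.log z := Complex.contDiffAt_log (Or.inl hz)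
  exact (h1.div_const 2).cexp

theorem HolAt.branchSqrt {Z : Type} [NormedAddCommGroup Z] [NormedSpace ℂ Z] {F : N × Z → ℂ}
    {x : N × Z} (hF : HolAt R F x) (h0 : 0 < (F x).re) :
    HolAt R (fun y => branchSqrt (F y)) x :=
  hF.comp_contDiffAt (contDiffAt_branchSqrt h0)

theorem RealNear.branchSqrt {F : N × (ℂ × ℂ) → ℂ} (hF : RealNear ι μ₀ F)
    (hc : ContinuousAt F (ι μ₀, 0)) (hpos : 0 < (F (ι μ₀, 0)).re) :
    RealNear ι μ₀ fun x => branchSqrt (F x) :=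
  hF.map_of_pos hc hpos fun r hr => by rw [branchSqrt_ofReal hr]; exact Complex.ofReal_im _

/-- The complexified harmonic oscillator. -/
noncomputable def oscillatorC (z : ℂ × ℂ) : ℂ := (z.1 ^ 2 + z.2 ^ 2) / 2

/-- At `z = 0` the derivatives of the coefficients are multiplied by zero and drop out. -/
theorem fderiv_lin_comb {f g : N × (ℂ × ℂ) → ℂ} {ν : N} (hf : DifferentiableAt ℝ f (ν, 0))
    (hg : DifferentiableAt ℝ g (ν, 0)) (v : ℂ × ℂ) :
    fderiv ℝ (fun x => f x * x.2.1 + g x * x.2.2) (ν, 0) (0, v) =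
      f (ν, 0) * v.1 + g (ν, 0) * v.2 := by
  have h1 : HasFDerivAt (fun x : N × (ℂ × ℂ) => x.2.1)
      ((ContinuousLinearMap.fst ℝ ℂ ℂ).comp (ContinuousLinearMap.snd ℝ N (ℂ × ℂ))) (ν, 0) :=
    ((ContinuousLinearMap.fst ℝ ℂ ℂ).comp (ContinuousLinearMap.snd ℝ N (ℂ × ℂ))).hasFDerivAt
  have h2 : HasFDerivAt (fun x : N × (ℂ × ℂ) => x.2.2)
      ((ContinuousLinearMap.snd ℝ ℂ ℂ).comp (ContinuousLinearMap.snd ℝ N (ℂ × ℂ))) (ν, 0) :=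
    ((ContinuousLinearMap.snd ℝ ℂ ℂ).comp (ContinuousLinearMap.snd ℝ N (ℂ × ℂ))).hasFDerivAt
  have h3 : HasFDerivAt (fun x : N × (ℂ × ℂ) => f x * x.2.1 + g x * x.2.2) _ (ν, 0) :=
    (hf.hasFDerivAt.mul h1).add (hg.hasFDerivAt.mul h2)
  rw [h3.fderiv]
  simp

/-- A real function comparable to the square is, at the real points, a positive definite quadratic
form with varying coefficients. -/
theorem exists_quadratic_form (hR : R 0 0) {G : N × (ℂ × ℂ) → ℂ} {p : M → ℝ × ℝ → ℝ}
    (hG : ∀ᶠ x in 𝓝 (ι μ₀, (0 : ℂ × ℂ)), HolAt R G x)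
    (hGp : ∀ᶠ y in 𝓝 (μ₀, (0 : ℝ × ℝ)), G (realPoint ι y) = (p y.1 y.2 : ℂ))
    (hp : ∀ᶠ μ in 𝓝 μ₀, ComparableToSquare (p μ)) :
    ∃ a b c : N × (ℂ × ℂ) → ℂ,
      (∀ᶠ x in 𝓝 (ι μ₀, (0 : ℂ × ℂ)), HolAt R a x) ∧
      (∀ᶠ x in 𝓝 (ι μ₀, (0 : ℂ × ℂ)), HolAt R b x) ∧
      (∀ᶠ x in 𝓝 (ι μ₀, (0 : ℂ × ℂ)), HolAt R c x) ∧
      RealNear ι μ₀ a ∧ RealNear ι μ₀ b ∧ RealNear ι μ₀ c ∧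
      (∀ᶠ y in 𝓝 (μ₀, (0 : ℝ × ℝ)), (p y.1 y.2 : ℂ) = a (realPoint ι y) * y.2.1 ^ 2 +
        2 * b (realPoint ι y) * y.2.1 * y.2.2 + c (realPoint ι y) * y.2.2 ^ 2) ∧
      0 < (a (ι μ₀, 0)).re ∧
      0 < (a (ι μ₀, 0)).re * (c (ι μ₀, 0)).re - (b (ι μ₀, 0)).re ^ 2 := by
  have hGr : RealNear ι μ₀ G := by
    filter_upwards [hGp] with y hy
    rw [hy]; exact Complex.ofReal_im _
  have p10 : planeCLM (1, 0) = (1, 0) := by simp [planeCLM_apply]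
  have p01 : planeCLM (0, 1) = (0, 1) := by simp [planeCLM_apply]
  have H1 := eventually_holAt_hadamard hG (1, 0)
  have H2 := eventually_holAt_hadamard hG (0, 1)
  have R1 := hGr.hadamard hG (1, 0)
  have R2 := hGr.hadamard hG (0, 1)
  rw [p10] at R1
  rw [p01] at R2
  have H11 := eventually_holAt_hadamard H1 (1, 0)
  have H12 := eventually_holAt_hadamard H1 (0, 1)
  have H21 := eventually_holAt_hadamard H2 (1, 0)
  have H22 := eventually_holAt_hadamard H2 (0, 1)
  have R11 := R1.hadamard H1 (1, 0)
  have R12 := R1.hadamard H1 (0, 1)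
  have R21 := R2.hadamard H2 (1, 0)
  have R22 := R2.hadamard H2 (0, 1)
  rw [p10] at R11 R21
  rw [p01] at R12 R22
  set h1 := hadamard (1, 0) G
  set h2 := hadamard (0, 1) G
  -- Comparability makes the origin a zero and a local minimum of `p μ` for every nearby `μ`, so the
  -- gradient vanishes there. Hence Hadamard's formula, applied to `G` and then to `h1` and `h2`,
  -- leaves only quadratic terms.
  have hcenter : ∀ᶠ μ in 𝓝 μ₀, G (ι μ, 0) = 0 ∧ h1 (ι μ, 0) = 0 ∧ h2 (ι μ, 0) = 0 := by
    have hG2 : ∀ᶠ y in 𝓝 (μ₀, (0 : ℝ × ℝ)), HolAt R G (realPoint ι y) :=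
      (tendsto_realPoint ι μ₀).eventually hG
    have hnn : ∀ᶠ y in 𝓝 (μ₀, (0 : ℝ × ℝ)), ∀ᶠ y' in 𝓝 y,
      G (realPoint ι y') = (p y'.1 y'.2 : ℂ) := hGp.eventually_nhds
    have hsl : Tendsto (fun μ : M => (μ, (0 : ℝ × ℝ))) (𝓝 μ₀) (𝓝 (μ₀, 0)) :=
      (continuous_id.prodMk continuous_const).tendsto μ₀
    filter_upwards [hp, hsl.eventually hG2, hsl.eventually hnn, hsl.eventually hGr.eventually_nhds]
      with μ hμ hol heq hre
    obtain ⟨c, C, hc, hC, hcomp⟩ := hμ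
    rw [realPoint_center] at hol
    have hp0 : p μ 0 = 0 := by
      have := hcomp.self_of_nhds
      simp at this
      linarith
    have hG0 : G (ι μ, 0) = 0 := by
      have := heq.self_of_nhds
      rw [realPoint_center] at this
      rw [this, hp0]; simp
    have hin : Tendsto (fun ρ : ℝ × ℝ => (μ, ρ)) (𝓝 0) (𝓝 (μ, 0)) :=
      (continuous_const.prodMk continuous_id).tendsto 0
    have hder : HasFDerivAt (fun ρ : ℝ × ℝ => (G (realPoint ι (μ, ρ))).re)
        (Complex.reCLM.comp ((fderiv ℝ G (ι μ, 0)).comp ((realPoint ι).comp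
          (ContinuousLinearMap.inr ℝ M (ℝ × ℝ))))) 0 := by
      have e1 : HasFDerivAt (fun ρ : ℝ × ℝ => (μ, ρ)) (ContinuousLinearMap.inr ℝ M (ℝ × ℝ)) 0 :=
        hasFDerivAt_prodMk_right μ 0
      have e2 : HasFDerivAt (fun ρ : ℝ × ℝ => realPoint ι (μ, ρ)) ((realPoint ι).comp
          (ContinuousLinearMap.inr ℝ M (ℝ × ℝ))) 0 := (realPoint ι).hasFDerivAt.comp 0 e1
      have e3 : HasFDerivAt G (fderiv ℝ G (ι μ, 0)) (realPoint ι (μ, 0)) := by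
        rw [realPoint_center]; exact hol.hasFDerivAt
      exact Complex.reCLM.hasFDerivAt.comp (0 : ℝ × ℝ) (e3.comp (0 : ℝ × ℝ) e2)
    have hmin : IsLocalMin (fun ρ : ℝ × ℝ => (G (realPoint ι (μ, ρ))).re) 0 := by
      filter_upwards [hcomp, hin.eventually heq] with ρ h3 h4
      rw [h4, realPoint_center, hG0, Complex.ofReal_re, Complex.zero_re]
      exact le_trans (by positivity) h3.1
    have hz := hmin.hasFDerivAt_eq_zero hder
    have hzero : ∀ v : ℝ × ℝ, fderiv ℝ G (ι μ, 0) (0, planeCLM v) = 0 := by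
      intro v
      have e1 := congrArg (fun T : ℝ × ℝ →L[ℝ] ℝ => T v) hz
      have e2 := fderiv_realPoint_im (y := (μ, (0 : ℝ × ℝ)))
        (by rw [realPoint_center]; exact hol.differentiableAt) hre (0, v)
      rw [realPoint_center, realPoint_apply, map_zero] at e2
      refine Complex.ext ?_ e2
      simpa [realPoint_apply] using e1
    refine ⟨hG0, ?_, ?_⟩
    · simp only [h1]
      rw [hadamard_center, ← p10, hzero]
    · simp only [h2]
      rw [hadamard_center, ← p01, hzero]
  have hform : ∀ᶠ y in 𝓝 (μ₀, (0 : ℝ × ℝ)), (p y.1 y.2 : ℂ) =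
      hadamard (1, 0) h1 (realPoint ι y) * y.2.1 ^ 2 +
        2 * ((hadamard (0, 1) h1 (realPoint ι y) + hadamard (1, 0) h2 (realPoint ι y)) * ((1 / 2 : ℝ) : ℂ)) *
          y.2.1 * y.2.2 + hadamard (0, 1) h2 (realPoint ι y) * y.2.2 ^ 2 := by
    have ht := tendsto_realPoint ι μ₀
    filter_upwards [hGp, (continuous_fst.tendsto (μ₀, (0 : ℝ × ℝ))).eventually hcenter,
      ht.eventually (eventually_eq_hadamard hR hG), ht.eventually (eventually_eq_hadamard hR H1),
      ht.eventually (eventually_eq_hadamard hR H2)] with y e0 e1 e2 e3 e4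
    obtain ⟨e5, e6, e7⟩ := e1
    have e8 : (realPoint ι y).1 = ι y.1 := rfl
    have e9 : (realPoint ι y).2.1 = (y.2.1 : ℂ) := rfl
    have e10 : (realPoint ι y).2.2 = (y.2.2 : ℂ) := rfl
    rw [e8, e5, e9, e10, e0] at e2
    change _ = 0 + (_ * h1 _ + _ * h2 _) at e2
    rw [e8, e6, e9, e10] at e3
    rw [e8, e7, e9, e10] at e4
    rw [e2, e3, e4]
    push_cast
    ring
  refine ⟨hadamard (1, 0) h1,
    fun x => (hadamard (0, 1) h1 x + hadamard (1, 0) h2 x) * ((1 / 2 : ℝ) : ℂ), hadamard (0, 1) h2,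
    H11, ?_, H22, R11, (R12.add R21).mul (RealNear.const _), R22, hform, ?_⟩
  · filter_upwards [H12, H21] with x e1 e2 using (e1.add e2).mul (holAt_const _ _)
  · set b : N × (ℂ × ℂ) → ℂ :=
      fun x => (hadamard (0, 1) h1 x + hadamard (1, 0) h2 x) * ((1 / 2 : ℝ) : ℂ) with hb
    have hbc : ContinuousAt b (ι μ₀, 0) :=
      (H12.self_of_nhds.continuousAt.add H21.self_of_nhds.continuousAt).mul continuousAt_const
    obtain ⟨k, K, hk, hK, hcomp⟩ := hp.self_of_nhds
    -- The lower bound on `p μ₀` at `s • ρ` is divided by `s ^ 2` and `s` tends to zero from the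
    -- right, which freezes the coefficients at the origin.
    have hq : ∀ ρ : ℝ × ℝ, k * (ρ.1 ^ 2 + ρ.2 ^ 2) ≤ (hadamard (1, 0) h1 (ι μ₀, 0)).re * ρ.1 ^ 2 +
        2 * (b (ι μ₀, 0)).re * ρ.1 * ρ.2 + (hadamard (0, 1) h2 (ι μ₀, 0)).re * ρ.2 ^ 2 := by
      intro ρ
      have hs0 : Tendsto (fun s : ℝ => s • ρ) (𝓝[>] 0) (𝓝 0) := by
        have : Tendsto (fun s : ℝ => s • ρ) (𝓝 0) (𝓝 ((0 : ℝ) • ρ)) :=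
          (continuous_id.smul continuous_const).tendsto 0
        rw [zero_smul] at this
        exact this.mono_left nhdsWithin_le_nhds
      have hs : Tendsto (fun s : ℝ => (μ₀, s • ρ)) (𝓝[>] 0) (𝓝 (μ₀, 0)) :=
        tendsto_const_nhds.prodMk_nhds hs0
      have hsr := (tendsto_realPoint ι μ₀).comp hs
      have hre : ∀ {F : N × (ℂ × ℂ) → ℂ}, ContinuousAt F (ι μ₀, 0) →
          Tendsto (fun s : ℝ => (F (realPoint ι (μ₀, s • ρ))).re) (𝓝[>] 0)
            (𝓝 (F (ι μ₀, 0)).re) := fun hF =>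
        (Complex.continuous_re.tendsto _).comp (hF.tendsto.comp hsr)
      have hlim := (((hre H11.self_of_nhds.continuousAt).mul_const (ρ.1 ^ 2)).add
        ((((hre hbc).const_mul 2).mul_const ρ.1).mul_const ρ.2)).add
        ((hre H22.self_of_nhds.continuousAt).mul_const (ρ.2 ^ 2))
      refine ge_of_tendsto hlim ?_
      filter_upwards [hs0.eventually hcomp, hs.eventually hform, self_mem_nhdsWithin] with s e1 e2 e3
      have hs3 : (0 : ℝ) < s := e3
      have e4 := congrArg Complex.re e2
      have e5 := e1.1
      simp only [Prod.smul_fst, Prod.smul_snd, smul_eq_mul] at e4 e5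
      have e6 : ∀ z : ℂ, ∀ r : ℝ, (z * (r : ℂ)).re = z.re * r := fun z r => by
        simp [Complex.mul_re]
      have e7 : ∀ z : ℂ, (2 * z).re = 2 * z.re := fun z => by simp [Complex.mul_re]
      rw [Complex.ofReal_re, Complex.add_re, Complex.add_re, ← Complex.ofReal_pow,
        ← Complex.ofReal_pow, e6, e6, e6, e6, e7] at e4
      change p μ₀ (s • ρ) = _ * _ + 2 * (b (realPoint ι (μ₀, s • ρ))).re * _ * _ + _ at e4
      rw [e4] at e5
      have hs2 : 0 < s ^ 2 := by positivity
      refine le_of_mul_le_mul_left (a := s ^ 2) ?_ hs2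
      calc s ^ 2 * (k * (ρ.1 ^ 2 + ρ.2 ^ 2)) = k * ((s * ρ.1) ^ 2 + (s * ρ.2) ^ 2) := by ring
        _ ≤ _ := e5
        _ = _ := by ring
    have ha := hq (1, 0)
    simp only at ha
    have ha' : 0 < (hadamard (1, 0) h1 (ι μ₀, 0)).re := by nlinarith
    refine ⟨ha', ?_⟩
    -- On the vector `(-B, A)` the form takes the value `A (A C - B ^ 2)`.
    have hdet := hq (-(b (ι μ₀, 0)).re, (hadamard (1, 0) h1 (ι μ₀, 0)).re)
    simp only at hdet
    set A := (hadamard (1, 0) h1 (ι μ₀, 0)).re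
    set B := (b (ι μ₀, 0)).re
    set C := (hadamard (0, 1) h2 (ι μ₀, 0)).re
    have h9 : 0 < A * (A * C - B ^ 2) := by
      have : 0 < k * ((-B) ^ 2 + A ^ 2) := by positivity
      nlinarith
    exact (mul_pos_iff_of_pos_left ha').1 h9

/-- The Morse lemma with parameters. -/
theorem exists_morse_chart (hR : R 0 0) {G : N × (ℂ × ℂ) → ℂ} {p : M → ℝ × ℝ → ℝ}
    (hG : ∀ᶠ x in 𝓝 (ι μ₀, (0 : ℂ × ℂ)), HolAt R G x)
    (hGp : ∀ᶠ y in 𝓝 (μ₀, (0 : ℝ × ℝ)), G (realPoint ι y) = (p y.1 y.2 : ℂ))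
    (hp : ∀ᶠ μ in 𝓝 μ₀, ComparableToSquare (p μ)) :
    ∃ φ : N × (ℂ × ℂ) → ℂ × ℂ,
      (∀ᶠ x in 𝓝 (ι μ₀, (0 : ℂ × ℂ)), HolAt R φ x) ∧ (∀ ν, φ (ν, 0) = 0) ∧
      (RealNear ι μ₀ fun x => (φ x).1) ∧ (RealNear ι μ₀ fun x => (φ x).2) ∧
      (∃ s : ℝ, 0 < s ∧ jac φ (ι μ₀, 0) = s) ∧
      ∀ᶠ y in 𝓝 (μ₀, (0 : ℝ × ℝ)), (p y.1 y.2 : ℂ) = oscillatorC (φ (realPoint ι y)) := by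
  obtain ⟨a, b, c, ha, hb, hc, ra, rb, rc, hform, hpos, hdet⟩ := exists_quadratic_form hR hG hGp hp
  have h0 : ∀ {F : N × (ℂ × ℂ) → ℂ}, RealNear ι μ₀ F → F (ι μ₀, 0) = ((F (ι μ₀, 0)).re : ℂ) := by
    intro F hF
    have := hF.self_of_nhds
    rw [realPoint_center] at this
    exact Complex.ext rfl this
  set A := (a (ι μ₀, 0)).re
  set B := (b (ι μ₀, 0)).re
  set C := (c (ι μ₀, 0)).re
  have hca := ha.self_of_nhds.continuousAt
  have hapos : ∀ᶠ x in 𝓝 (ι μ₀, (0 : ℂ × ℂ)), 0 < (a x).re :=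
    (Complex.continuous_re.continuousAt.comp hca).eventually (lt_mem_nhds hpos)
  -- Completing the square: `a x² + 2 b x ξ + c ξ² = a (x + (b/a) ξ)² + (c - b²/a) ξ²`. The factors
  -- `2` compensate the one half in the oscillator.
  let a2 : N × (ℂ × ℂ) → ℂ := fun x => ((2 : ℝ) : ℂ) * a x
  let c2 : N × (ℂ × ℂ) → ℂ := fun x => ((2 : ℝ) : ℂ) * (c x - b x * b x / a x)
  have hne : ∀ x, 0 < (a x).re → a x ≠ 0 := fun x hx h => by rw [h] at hx; simp at hx
  have ha2 : ∀ᶠ x in 𝓝 (ι μ₀, (0 : ℂ × ℂ)), HolAt R a2 x := by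
    filter_upwards [ha] with x h1 using (holAt_const _ _).mul h1
  have hc2 : ∀ᶠ x in 𝓝 (ι μ₀, (0 : ℂ × ℂ)), HolAt R c2 x := by
    filter_upwards [ha, hb, hc, hapos] with x h1 h2 h3 h4
    exact (holAt_const _ _).mul (h3.sub ((h2.mul h2).div h1 (hne x h4)))
  have ra2 : RealNear ι μ₀ a2 := (RealNear.const 2).mul ra
  have rc2 : RealNear ι μ₀ c2 := (RealNear.const 2).mul (rc.sub ((rb.mul rb).div ra))
  have ha20 : a2 (ι μ₀, 0) = ((2 * A : ℝ) : ℂ) := by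
    simp only [a2]; rw [h0 ra]; push_cast; rfl
  have hc20 : c2 (ι μ₀, 0) = ((2 * (C - B * B / A) : ℝ) : ℂ) := by
    simp only [c2]; rw [h0 ra, h0 rb, h0 rc]; push_cast; rfl
  have hA2 : 0 < 2 * A := by linarith
  have hC2 : 0 < 2 * (C - B * B / A) := by
    have : C - B * B / A = (A * C - B ^ 2) / A := by field_simp
    rw [this]; positivity
  have ha2pos : 0 < (a2 (ι μ₀, 0)).re := by rw [ha20]; exact hA2
  have hc2pos : 0 < (c2 (ι μ₀, 0)).re := by rw [hc20]; exact hC2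
  have hca2 := ha2.self_of_nhds.continuousAt
  have hcc2 := hc2.self_of_nhds.continuousAt
  have ha2pos' : ∀ᶠ x in 𝓝 (ι μ₀, (0 : ℂ × ℂ)), 0 < (a2 x).re :=
    (Complex.continuous_re.continuousAt.comp hca2).eventually (lt_mem_nhds ha2pos)
  have hc2pos' : ∀ᶠ x in 𝓝 (ι μ₀, (0 : ℂ × ℂ)), 0 < (c2 x).re :=
    (Complex.continuous_re.continuousAt.comp hcc2).eventually (lt_mem_nhds hc2pos)
  let S : N × (ℂ × ℂ) → ℂ := fun x => branchSqrt (a2 x)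
  let T : N × (ℂ × ℂ) → ℂ := fun x => S x * (b x / a x)
  let V : N × (ℂ × ℂ) → ℂ := fun x => branchSqrt (c2 x)
  have hS : ∀ᶠ x in 𝓝 (ι μ₀, (0 : ℂ × ℂ)), HolAt R S x := by
    filter_upwards [ha2, ha2pos'] with x h1 h2 using h1.branchSqrt h2
  have hV : ∀ᶠ x in 𝓝 (ι μ₀, (0 : ℂ × ℂ)), HolAt R V x := by
    filter_upwards [hc2, hc2pos'] with x h1 h2 using h1.branchSqrt h2
  have hT : ∀ᶠ x in 𝓝 (ι μ₀, (0 : ℂ × ℂ)), HolAt R T x := by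
    filter_upwards [hS, ha, hb, hapos] with x h1 h2 h3 h4
    exact h1.mul (h3.div h2 (hne x h4))
  have rS : RealNear ι μ₀ S := ra2.branchSqrt hca2 ha2pos
  have rV : RealNear ι μ₀ V := rc2.branchSqrt hcc2 hc2pos
  have rT : RealNear ι μ₀ T := rS.mul (rb.div ra)
  -- The zero coefficient is kept so that both components have the shape required by
  -- `fderiv_lin_comb`; the Jacobian at the centre is then `S V`.
  let φ : N × (ℂ × ℂ) → ℂ × ℂ :=
    fun x => (S x * x.2.1 + T x * x.2.2, (fun _ => (0 : ℂ)) x * x.2.1 + V x * x.2.2)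
  have hz1 : ∀ x : N × (ℂ × ℂ), HolAt R (fun x : N × (ℂ × ℂ) => x.2.1) x := fun x => (holAt_snd x).fst
  have hz2 : ∀ x : N × (ℂ × ℂ), HolAt R (fun x : N × (ℂ × ℂ) => x.2.2) x := fun x => (holAt_snd x).snd
  refine ⟨φ, ?_, ?_, ?_, ?_, ?_, ?_⟩
  · filter_upwards [hS, hT, hV] with x h1 h2 h3
    exact ((h1.mul (hz1 x)).add (h2.mul (hz2 x))).prodMk
      (((holAt_const 0 x).mul (hz1 x)).add (h3.mul (hz2 x)))
  · intro ν; simp [φ]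
  · exact (rS.mul realNear_fst).add (rT.mul realNear_snd)
  · exact ((by simpa using RealNear.const (ι := ι) (μ₀ := μ₀) 0 :
      RealNear ι μ₀ fun _ => (0 : ℂ)).mul realNear_fst).add (rV.mul realNear_snd)
  · refine ⟨Real.exp (Real.log (2 * A) / 2) * Real.exp (Real.log (2 * (C - B * B / A)) / 2),
      by positivity, ?_⟩
    have hdS := hS.self_of_nhds.differentiableAt
    have hdT := hT.self_of_nhds.differentiableAt
    have hdV := hV.self_of_nhds.differentiableAt
    have hd0 : DifferentiableAt ℝ (fun _ : N × (ℂ × ℂ) => (0 : ℂ)) (ι μ₀, 0) :=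
      differentiableAt_const _
    have hd1 : DifferentiableAt ℝ (fun x : N × (ℂ × ℂ) => S x * x.2.1 + T x * x.2.2) (ι μ₀, 0) :=
      (hdS.mul (hz1 _).differentiableAt).add (hdT.mul (hz2 _).differentiableAt)
    have hd2 : DifferentiableAt ℝ
        (fun x : N × (ℂ × ℂ) => (fun _ => (0 : ℂ)) x * x.2.1 + V x * x.2.2) (ι μ₀, 0) :=
      (hd0.mul (hz1 _).differentiableAt).add (hdV.mul (hz2 _).differentiableAt)
    have hfd : fderiv ℝ φ (ι μ₀, 0) = (fderiv ℝ _ (ι μ₀, 0)).prod (fderiv ℝ _ (ι μ₀, 0)) :=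
      (hd1.hasFDerivAt.prodMk hd2.hasFDerivAt).fderiv
    have hv : ∀ v, fderiv ℝ φ (ι μ₀, 0) (0, v) =
        (S (ι μ₀, 0) * v.1 + T (ι μ₀, 0) * v.2, 0 * v.1 + V (ι μ₀, 0) * v.2) := by
      intro v
      rw [hfd, ContinuousLinearMap.prod_apply, fderiv_lin_comb hdS hdT, fderiv_lin_comb hd0 hdV]
    rw [jac, hv, hv]
    simp only [S, V]
    rw [ha20, hc20, branchSqrt_ofReal hA2, branchSqrt_ofReal hC2]
    push_cast
    ring
  · have ht := tendsto_realPoint ι μ₀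
    filter_upwards [hform, ht.eventually hapos, ht.eventually ha2pos', ht.eventually hc2pos']
      with y e1 e2 e3 e4
    have n1 := hne _ e2
    have n2 : a2 (realPoint ι y) ≠ 0 := fun h => by rw [h] at e3; simp at e3
    have n3 : c2 (realPoint ι y) ≠ 0 := fun h => by rw [h] at e4; simp at e4
    have s1 : S (realPoint ι y) * S (realPoint ι y) = _ := branchSqrt_mul_self n2
    have s2 : V (realPoint ι y) * V (realPoint ι y) = _ := branchSqrt_mul_self n3
    rw [e1]
    simp only [oscillatorC, φ, T, realPoint_apply, planeCLM_apply] at s1 s2 n1 ⊢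
    set a' := a (ι y.1, ((y.2.1 : ℂ), (y.2.2 : ℂ)))
    set b' := b (ι y.1, ((y.2.1 : ℂ), (y.2.2 : ℂ)))
    set c' := c (ι y.1, ((y.2.1 : ℂ), (y.2.2 : ℂ)))
    set S' := S (ι y.1, ((y.2.1 : ℂ), (y.2.2 : ℂ)))
    set V' := V (ι y.1, ((y.2.1 : ℂ), (y.2.2 : ℂ)))
    have s1' : S' * S' = 2 * a' := by rw [s1]; simp [a2, a']
    have s2' : V' * V' = 2 * (c' - b' * b' / a') := by rw [s2]; simp [c2, a', b', c']
    have hS2 : (S' * y.2.1 + S' * (b' / a') * y.2.2) ^ 2 =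
        S' * S' * ((y.2.1 : ℂ) + b' / a' * y.2.2) ^ 2 := by ring
    have hV2 : (0 * (y.2.1 : ℂ) + V' * y.2.2) ^ 2 = V' * V' * (y.2.2 : ℂ) ^ 2 := by ring
    rw [hS2, hV2, s1', s2']
    field_simp
    ring

end Morse

/-! ### Means and moments over rotations -/

section Averaging

set_option linter.unusedSectionVars false

variable {N : Type} [NormedAddCommGroup N] [NormedSpace ℝ N] {R : N → N → Prop}
  {M : Type} [NormedAddCommGroup M] [NormedSpace ℝ M] {ι : M →L[ℝ] N} {μ₀ : M}

/-- The derivative of the rotation at angle zero. -/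
noncomputable def quarterTurn : ℂ × ℂ →L[ℂ] ℂ × ℂ :=
  (-ContinuousLinearMap.snd ℂ ℂ ℂ).prod (ContinuousLinearMap.fst ℂ ℂ ℂ)

theorem quarterTurn_apply (z : ℂ × ℂ) : quarterTurn z = (-z.2, z.1) := rfl

/-- The rotation of angle `t`. -/
noncomputable def planeRotation (t : ℝ) : ℂ × ℂ →L[ℂ] ℂ × ℂ :=
  (Real.cos t : ℂ) • ContinuousLinearMap.id ℂ (ℂ × ℂ) + (Real.sin t : ℂ) • quarterTurn

theorem planeRotation_apply (t : ℝ) (z : ℂ × ℂ) :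
    planeRotation t z = (Real.cos t * z.1 - Real.sin t * z.2, Real.cos t * z.2 + Real.sin t * z.1) := by
  ext <;> simp [planeRotation, quarterTurn_apply, sub_eq_add_neg]

theorem continuous_planeRotation : Continuous planeRotation := by
  unfold planeRotation
  have h1 : Continuous fun t : ℝ => (Real.cos t : ℂ) := by fun_prop
  have h2 : Continuous fun t : ℝ => (Real.sin t : ℂ) := by fun_prop
  fun_prop

theorem planeRotation_planeRotation (s t : ℝ) (z : ℂ × ℂ) : planeRotation t (planeRotation s z) = planeRotation (t + s) z := by
  simp only [planeRotation_apply, Real.cos_add, Real.sin_add]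
  push_cast
  ext <;> simp only <;> ring

theorem planeRotation_zero (z : ℂ × ℂ) : planeRotation 0 z = z := by
  simp [planeRotation_apply]

theorem planeRotation_periodic (z : ℂ × ℂ) : Function.Periodic (fun t => planeRotation t z) (2 * Real.pi) := by
  intro t
  simp [planeRotation_apply]

theorem hasDerivAt_planeRotation (z : ℂ × ℂ) : HasDerivAt (fun t => planeRotation t z) (quarterTurn z) 0 := by
  have h1 : HasDerivAt (fun t : ℝ => (Real.cos t : ℂ)) 0 0 := by
    have := (Real.hasDerivAt_cos 0).ofReal_comp
    simpa using this
  have h2 : HasDerivAt (fun t : ℝ => (Real.sin t : ℂ)) 1 0 := by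
    have := (Real.hasDerivAt_sin 0).ofReal_comp
    simpa using this
  have := (h1.smul_const z).add (h2.smul_const (quarterTurn z))
  simp only [zero_smul, one_smul, zero_add] at this
  exact this

/-- The rotation of the real plane. -/
noncomputable def realRotation (t : ℝ) : ℝ × ℝ →L[ℝ] ℝ × ℝ :=
  Real.cos t • ContinuousLinearMap.id ℝ (ℝ × ℝ) +
    Real.sin t • (-ContinuousLinearMap.snd ℝ ℝ ℝ).prod (ContinuousLinearMap.fst ℝ ℝ ℝ)

theorem realRotation_apply (t : ℝ) (ρ : ℝ × ℝ) :
    realRotation t ρ =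
      (Real.cos t * ρ.1 - Real.sin t * ρ.2, Real.cos t * ρ.2 + Real.sin t * ρ.1) := by
  ext <;> simp [realRotation, sub_eq_add_neg]

theorem continuous_realRotation : Continuous realRotation := by
  unfold realRotation
  have h1 : Continuous fun t : ℝ => Real.cos t := by fun_prop
  have h2 : Continuous fun t : ℝ => Real.sin t := by fun_prop
  fun_prop

theorem planeRotation_planeCLM (t : ℝ) (ρ : ℝ × ℝ) :
    planeRotation t (planeCLM ρ) = planeCLM (realRotation t ρ) := by
  simp only [planeRotation_apply, planeCLM_apply, realRotation_apply]
  push_cast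
  rfl

/-- The mean over the rotations. -/
noncomputable def circleMean (J : N × (ℂ × ℂ) → ℂ) (x : N × (ℂ × ℂ)) : ℂ :=
  ∫ t in (0 : ℝ)..2 * Real.pi, (((2 * Real.pi)⁻¹ : ℝ) : ℂ) • J (x.1, planeRotation t x.2)

/-- The first moment over the rotations. -/
noncomputable def circleMoment (J : N × (ℂ × ℂ) → ℂ) (x : N × (ℂ × ℂ)) : ℂ :=
  ∫ t in (0 : ℝ)..2 * Real.pi, (((2 * Real.pi)⁻¹ * t : ℝ) : ℂ) • J (x.1, planeRotation t x.2)

theorem eventually_holAt_circleMean {J : N × (ℂ × ℂ) → ℂ} {ν₀ : N}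
    (hJ : ∀ᶠ x in 𝓝 (ν₀, (0 : ℂ × ℂ)), HolAt R J x) :
    ∀ᶠ x in 𝓝 (ν₀, (0 : ℂ × ℂ)), HolAt R (circleMean J) x :=
  eventually_holAt_integral continuous_planeRotation (by fun_prop) fun t _ => by
    simpa only [map_zero] using hJ

theorem eventually_holAt_circleMoment {J : N × (ℂ × ℂ) → ℂ} {ν₀ : N}
    (hJ : ∀ᶠ x in 𝓝 (ν₀, (0 : ℂ × ℂ)), HolAt R J x) :
    ∀ᶠ x in 𝓝 (ν₀, (0 : ℂ × ℂ)), HolAt R (circleMoment J) x :=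
  eventually_holAt_integral continuous_planeRotation (by fun_prop) fun t _ => by
    simpa only [map_zero] using hJ

theorem RealNear.circleMean {J : N × (ℂ × ℂ) → ℂ} (hJ : RealNear ι μ₀ J) :
    RealNear ι μ₀ (circleMean J) :=
  hJ.integral continuous_realRotation planeRotation_planeCLM _

theorem RealNear.circleMoment {J : N × (ℂ × ℂ) → ℂ} (hJ : RealNear ι μ₀ J) :
    RealNear ι μ₀ (circleMoment J) :=
  hJ.integral continuous_realRotation planeRotation_planeCLM _

theorem circleMean_center (J : N × (ℂ × ℂ) → ℂ) (ν : N) : circleMean J (ν, 0) = J (ν, 0) := by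
  have h : (2 * Real.pi : ℂ) ≠ 0 := by
    exact_mod_cast Real.two_pi_pos.ne'
  simp only [circleMean, map_zero, intervalIntegral.integral_const, sub_zero]
  rw [← smul_assoc, Complex.real_smul]
  push_cast
  rw [mul_inv_cancel₀ h, one_smul]

/-- A rotation by `s` shifts the integration interval, which does not matter for a `2π`-periodic
integrand. This holds at complex points too. -/
theorem circleMean_planeRotation (J : N × (ℂ × ℂ) → ℂ) (ν : N) (z : ℂ × ℂ) (s : ℝ) :
    circleMean J (ν, planeRotation s z) = circleMean J (ν, z) := by
  have hp : Function.Periodic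
      (fun t => (((2 * Real.pi)⁻¹ : ℝ) : ℂ) • J (ν, planeRotation t z)) (2 * Real.pi) := by
    intro t
    have := planeRotation_periodic z t
    simp only at this
    simp only [this]
  simp only [circleMean, planeRotation_planeRotation]
  rw [intervalIntegral.integral_comp_add_right
    (fun t => (((2 * Real.pi)⁻¹ : ℝ) : ℂ) • J (ν, planeRotation t z)) s, zero_add, add_comm]
  rw [hp.intervalIntegral_add_eq s 0, zero_add]

theorem hasDerivAt_comp_planeRotation {F : N × (ℂ × ℂ) → ℂ} {ν : N} {z : ℂ × ℂ}
    (hF : DifferentiableAt ℝ F (ν, z)) :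
    HasDerivAt (fun s : ℝ => F (ν, planeRotation s z)) (fderiv ℝ F (ν, z) (0, quarterTurn z)) 0 := by
  have h1 : HasDerivAt (fun s : ℝ => (ν, planeRotation s z)) ((0 : N), quarterTurn z) 0 :=
    (hasDerivAt_const _ _).prodMk (hasDerivAt_planeRotation z)
  have h2 : HasFDerivAt F (fderiv ℝ F (ν, z)) (ν, planeRotation 0 z) := by
    rw [planeRotation_zero]; exact hF.hasFDerivAt
  exact h2.comp_hasDerivAt (0 : ℝ) h1

theorem fderiv_circleMean_quarterTurn {J : N × (ℂ × ℂ) → ℂ} {ν : N} {z : ℂ × ℂ}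
    (h : DifferentiableAt ℝ (circleMean J) (ν, z)) :
    fderiv ℝ (circleMean J) (ν, z) (0, quarterTurn z) = 0 := by
  have h1 := hasDerivAt_comp_planeRotation h
  simp only [circleMean_planeRotation] at h1
  exact h1.unique (hasDerivAt_const _ _)

/-- The weight `t / 2π` jumps by one at the ends of the period: the jump yields `J`, and the
constant slope of the weight yields minus the mean. -/
theorem fderiv_circleMoment_quarterTurn {J : N × (ℂ × ℂ) → ℂ} {ν : N} {z : ℂ × ℂ}
    (hJ : ∀ t ∈ uIcc 0 (2 * Real.pi), ContinuousAt J (ν, planeRotation t z))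
    (h : DifferentiableAt ℝ (circleMoment J) (ν, z)) :
    fderiv ℝ (circleMoment J) (ν, z) (0, quarterTurn z) = J (ν, z) - circleMean J (ν, z) := by
  set k : ℂ := (((2 * Real.pi)⁻¹ : ℝ) : ℂ) with hk
  have hper : Function.Periodic (fun t => J (ν, planeRotation t z)) (2 * Real.pi) := by
    intro t
    have := planeRotation_periodic z t
    simp only at this
    simp only [this]
  have hc : Continuous fun t => J (ν, planeRotation t z) := by
    rw [continuous_iff_continuousAt]
    intro t
    obtain ⟨t', ht', he⟩ := (planeRotation_periodic z).exists_mem_Ico₀ Real.two_pi_pos t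
    have h1 : ContinuousAt (fun t => (ν, planeRotation t z)) t := by
      have : Continuous fun t => planeRotation t z := continuous_planeRotation.clm_apply continuous_const
      fun_prop
    refine ContinuousAt.comp (f := fun t => (ν, planeRotation t z)) (x := t) (g := J) ?_ h1
    rw [he]
    refine hJ t' ?_
    rw [uIcc_of_le Real.two_pi_pos.le]
    exact ⟨ht'.1, ht'.2.le⟩
  set q : ℝ → ℂ := fun t => k * t * J (ν, planeRotation t z) with hq
  have hqc : Continuous q := (continuous_const.mul Complex.continuous_ofReal).mul hc
  have hmean : ∀ s : ℝ, ∫ t in s..s + 2 * Real.pi, k * J (ν, planeRotation t z) = circleMean J (ν, z) := by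
    intro s
    have hp : Function.Periodic (fun t => k * J (ν, planeRotation t z)) (2 * Real.pi) := by
      intro t
      exact congrArg (fun c => k * c) (hper t)
    rw [hp.intervalIntegral_add_eq s 0, zero_add]
    rfl
  -- Substituting `t - s` for `t` turns the rotation into moving endpoints plus a term linear in
  -- `s`; the derivative at `s = 0` is `q (2π) - q 0` minus the mean.
  have hform : ∀ s : ℝ, circleMoment J (ν, planeRotation s z) =
      (∫ t in (0 : ℝ)..s + 2 * Real.pi, q t) - (∫ t in (0 : ℝ)..s, q t) -
        s * circleMean J (ν, z) := by
    intro s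
    have hqs : Continuous fun t : ℝ => (s : ℂ) * (k * J (ν, planeRotation t z)) :=
      continuous_const.mul (continuous_const.mul hc)
    rw [intervalIntegral.integral_interval_sub_left (hqc.intervalIntegrable _ _)
      (hqc.intervalIntegrable _ _), ← hmean s, ← intervalIntegral.integral_const_mul,
      ← intervalIntegral.integral_sub (hqc.intervalIntegrable _ _)
        (hqs.intervalIntegrable _ _)]
    simp only [circleMoment, planeRotation_planeRotation]
    have := intervalIntegral.integral_comp_add_right (a := 0) (b := 2 * Real.pi)
      (fun t : ℝ => q t - s * (k * J (ν, planeRotation t z))) s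
    rw [zero_add, add_comm (2 * Real.pi)] at this
    rw [← this]
    refine intervalIntegral.integral_congr fun t _ => ?_
    simp only [hq, hk, smul_eq_mul]
    push_cast
    ring
  have h1 := hasDerivAt_comp_planeRotation h
  simp only [hform] at h1
  have d1 : HasDerivAt (fun s : ℝ => ∫ t in (0 : ℝ)..s + 2 * Real.pi, q t) (q (0 + 2 * Real.pi)) 0 := by
    have e1 := (intervalIntegral.integral_hasDerivAt_right (hqc.intervalIntegrable 0 (0 + 2 * Real.pi))
      (hqc.stronglyMeasurableAtFilter _ _) hqc.continuousAt)
    exact HasDerivAt.comp_add_const (f := fun s : ℝ => ∫ t in (0 : ℝ)..s, q t) 0 (2 * Real.pi) e1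
  have d2 : HasDerivAt (fun s : ℝ => ∫ t in (0 : ℝ)..s, q t) (q 0) 0 :=
    intervalIntegral.integral_hasDerivAt_right (hqc.intervalIntegrable 0 0)
      (hqc.stronglyMeasurableAtFilter _ _) hqc.continuousAt
  have d3 : HasDerivAt (fun s : ℝ => (s : ℂ) * circleMean J (ν, z)) (1 * circleMean J (ν, z)) 0 :=
    (Complex.ofRealCLM.hasDerivAt (x := 0)).mul_const _
  rw [h1.unique ((d1.sub d2).sub d3)]
  have hJ2 : J (ν, planeRotation (0 + 2 * Real.pi) z) = J (ν, z) := by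
    have := hper 0
    simp only at this
    rw [this, planeRotation_zero]
  have hpi : (Real.pi : ℂ) ≠ 0 := by exact_mod_cast Real.pi_ne_zero
  simp only [hq, hJ2, hk]
  push_cast
  field_simp
  ring

end Averaging

/-! ### Rotation-invariant functions as functions of the energy -/

section Radial

set_option linter.unusedSectionVars false

variable {N : Type} [NormedAddCommGroup N] [NormedSpace ℝ N] {R : N → N → Prop}
  {M : Type} [NormedAddCommGroup M] [NormedSpace ℝ M] {ι : M →L[ℝ] N} {μ₀ : M}

/-- The point of `ℂ²` with `x + iξ = w.1` and `x - iξ = w.2`. -/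
noncomputable def nullPoint (w : ℂ × ℂ) : ℂ × ℂ :=
  ((w.1 + w.2) / 2, (w.1 - w.2) * (-Complex.I / 2))

theorem norm_nullPoint_le {w : ℂ × ℂ} {δ : ℝ} (h1 : ‖w.1‖ ≤ δ) (h2 : ‖w.2‖ ≤ δ) :
    ‖nullPoint w‖ ≤ δ := by
  have e1 := norm_add_le w.1 w.2
  have e2 := norm_sub_le w.1 w.2
  rw [Prod.norm_def]
  refine max_le ?_ ?_
  · simp only [nullPoint, norm_div, Complex.norm_ofNat]
    linarith
  · simp only [nullPoint, norm_mul, norm_div, norm_neg, Complex.norm_I, Complex.norm_ofNat]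
    linarith

/-- In the coordinates `x + iξ` and `x - iξ` the generator of rotations is diagonal, with
eigenvalues `i` and `-i`. -/
theorem quarterTurn_nullPoint (a b : ℂ) :
    quarterTurn (nullPoint (a, b)) = Complex.I • nullPoint (a, -b) := by
  have hI : Complex.I * Complex.I = -1 := Complex.I_mul_I
  simp only [quarterTurn_apply, nullPoint, Prod.smul_mk, smul_eq_mul]
  ext
  · simp only; ring
  · simp only
    linear_combination ((a + b) / 2) * hI

theorem hasDerivAt_nullPoint {a b : ℝ → ℂ} {a' b' : ℂ} {s : ℝ} (ha : HasDerivAt a a' s)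
    (hb : HasDerivAt b b' s) :
    HasDerivAt (fun s => nullPoint (a s, b s)) (nullPoint (a', b')) s :=
  ((ha.add hb).div_const 2).prodMk ((ha.sub hb).mul_const _)

/-- A function whose derivative along the rotations vanishes takes equal values at a real point and
at the complex points of the same energy with `x - iξ = δ`. -/
theorem apply_nullPoint_eq (hR : R 0 0) {F : N × (ℂ × ℂ) → ℂ} {ν : N} {r δ : ℝ} (hδ : 0 < δ)
    (hr0 : 0 ≤ r) (hrδ : r ≤ δ)
    (h : ∀ z : ℂ × ℂ, ‖z‖ ≤ δ → HolAt R F (ν, z) ∧ fderiv ℝ F (ν, z) (0, quarterTurn z) = 0) :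
    F (ν, nullPoint ((r ^ 2 / δ : ℝ), (δ : ℝ))) = F (ν, ((r : ℝ), 0)) := by
  -- The path keeps the product `(x + iξ)(x - iξ) = a b` equal to `r ^ 2` for `s < 1`: `b` runs
  -- linearly from `δ` to `r` and `a = r ^ 2 / b`. It ends at the real point `(r, 0)`.
  set b : ℝ → ℝ := fun s => (1 - s) * δ + s * r with hb
  set a : ℝ → ℝ := fun s => r ^ 2 / b s with ha
  have hbr : ∀ s ∈ Icc (0 : ℝ) 1, r ≤ b s := fun s hs => by
    simp only [hb]; nlinarith [hs.1, hs.2]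
  have hbδ : ∀ s ∈ Icc (0 : ℝ) 1, b s ≤ δ := fun s hs => by
    simp only [hb]; nlinarith [hs.1, hs.2]
  have hbpos : ∀ s ∈ Ico (0 : ℝ) 1, 0 < b s := fun s hs => by
    have : 0 < (1 - s) * δ := mul_pos (by linarith [hs.2]) hδ
    have : 0 ≤ s * r := mul_nonneg hs.1 hr0
    simp only [hb]; linarith
  have hb0 : ∀ s ∈ Icc (0 : ℝ) 1, 0 ≤ b s := fun s hs => hr0.trans (hbr s hs)
  have har : ∀ s ∈ Icc (0 : ℝ) 1, 0 ≤ a s ∧ a s ≤ r := by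
    intro s hs
    refine ⟨div_nonneg (sq_nonneg r) (hb0 s hs), ?_⟩
    exact div_le_of_le_mul₀ (hb0 s hs) hr0 (by nlinarith [hbr s hs])
  set z : ℝ → ℂ × ℂ := fun s => nullPoint ((a s : ℂ), (b s : ℂ)) with hz
  have hzδ : ∀ s ∈ Icc (0 : ℝ) 1, ‖z s‖ ≤ δ := by
    intro s hs
    refine norm_nullPoint_le ?_ ?_
    · simp only [Complex.norm_real, Real.norm_eq_abs]
      rw [abs_of_nonneg (har s hs).1]
      exact (har s hs).2.trans hrδ
    · simp only [Complex.norm_real, Real.norm_eq_abs]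
      rw [abs_of_nonneg (hb0 s hs)]
      exact hbδ s hs
  have hbd : ∀ s, HasDerivAt b (r - δ) s := by
    intro s
    have := (((hasDerivAt_id s).const_sub 1).mul_const δ).add ((hasDerivAt_id s).mul_const r)
    exact this.congr_deriv (by ring)
  have had : ∀ s, b s ≠ 0 → HasDerivAt a (-(r ^ 2 * (r - δ)) / b s ^ 2) s := by
    intro s hs
    have := ((hbd s).inv hs).const_mul (r ^ 2)
    refine (this.congr_deriv (by ring)).congr_of_eventuallyEq ?_
    exact Eventually.of_forall fun s => by simp [ha, div_eq_mul_inv]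
  have hbc : Continuous b := by fun_prop
  have hac : ContinuousOn a (Icc 0 1) := by
    rcases hr0.eq_or_lt with h0 | h0
    · have : a = fun _ => 0 := by ext s; simp [ha, ← h0]
      rw [this]; exact continuousOn_const
    · exact continuousOn_const.div hbc.continuousOn fun s hs => (h0.trans_le (hbr s hs)).ne'
  have hzc : ContinuousOn z (Icc 0 1) := by
    have h1 : ContinuousOn (fun s => (a s : ℂ)) (Icc 0 1) :=
      Complex.continuous_ofReal.comp_continuousOn hac
    have h2 : ContinuousOn (fun s => (b s : ℂ)) (Icc 0 1) :=
      Complex.continuous_ofReal.comp_continuousOn hbc.continuousOn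
    exact ((h1.add h2).div_const 2).prodMk ((h1.sub h2).mul continuousOn_const)
  have hFc : ContinuousOn (fun s => F (ν, z s)) (Icc 0 1) := by
    intro s hs
    have h1 : ContinuousWithinAt (fun s => (ν, z s)) (Icc 0 1) s :=
      continuousWithinAt_const.prodMk (hzc s hs)
    exact ContinuousAt.comp_continuousWithinAt (f := fun s => (ν, z s)) (g := F)
      (h (z s) (hzδ s hs)).1.continuousAt h1
  -- The tangent is a complex multiple of the rotation generator, and `F` is complex linear to first
  -- order, so the derivative vanishes. The endpoint `s = 1` is left out because `b` is zero there
  -- if `r = 0`.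
  have hFd : ∀ s ∈ Ico (0 : ℝ) 1, HasDerivWithinAt (fun s => F (ν, z s)) 0 (Ici s) s := by
    intro s hs
    have hs' : s ∈ Icc (0 : ℝ) 1 := ⟨hs.1, hs.2.le⟩
    have hbne := (hbpos s hs).ne'
    have hbneC : (b s : ℂ) ≠ 0 := by exact_mod_cast hbne
    obtain ⟨hol, hq⟩ := h (z s) (hzδ s hs')
    have hzd := hasDerivAt_nullPoint (had s hbne).ofReal_comp (hbd s).ofReal_comp
    have hdir : nullPoint (((-(r ^ 2 * (r - δ)) / b s ^ 2 : ℝ) : ℂ), ((r - δ : ℝ) : ℂ)) =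
        (((r - δ : ℝ) : ℂ) / b s * Complex.I) • quarterTurn (z s) := by
      have hI : Complex.I * Complex.I = -1 := Complex.I_mul_I
      simp only [hz]
      rw [quarterTurn_nullPoint, smul_smul, mul_assoc, hI]
      simp only [nullPoint, ha, Prod.smul_mk, smul_eq_mul]
      push_cast
      ext
      · simp only; field_simp; ring
      · simp only; field_simp; ring
    have h1 : HasDerivAt (fun s => F (ν, z s)) (fderiv ℝ F (ν, z s) (0,
        nullPoint (((-(r ^ 2 * (r - δ)) / b s ^ 2 : ℝ) : ℂ), ((r - δ : ℝ) : ℂ)))) s :=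
      HasFDerivAt.comp_hasDerivAt (f := fun s => (ν, z s)) s hol.hasFDerivAt
        ((hasDerivAt_const s ν).prodMk hzd)
    rw [hdir, hol.fderiv_smul hR, hq, smul_zero] at h1
    exact h1.hasDerivWithinAt
  have hconst := constant_of_has_deriv_right_zero hFc hFd 1 (right_mem_Icc.2 zero_le_one)
  have z0 : z 0 = nullPoint ((r ^ 2 / δ : ℝ), (δ : ℝ)) := by
    simp [hz, ha, hb]
  have z1 : z 1 = (((r : ℝ) : ℂ), (0 : ℂ)) := by
    have hbb : b 1 = r := by simp [hb]
    have haa : a 1 = r := by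
      simp only [ha, hbb]
      rcases hr0.eq_or_lt with h0 | h0
      · simp [← h0]
      · field_simp
    simp [hz, haa, hbb, nullPoint]
  simp only [z0, z1] at hconst
  exact hconst.symm

theorem exists_planeRotation_eq (ρ : ℝ × ℝ) : ∃ r α : ℝ, 0 ≤ r ∧ r ^ 2 = ρ.1 ^ 2 + ρ.2 ^ 2 ∧
    planeCLM ρ = planeRotation α ((r : ℝ), 0) := by
  set w : ℂ := ⟨ρ.1, ρ.2⟩ with hw
  refine ⟨‖w‖, Complex.arg w, norm_nonneg _, ?_, ?_⟩
  · rw [Complex.sq_norm, Complex.normSq_apply]; ring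
  · have h1 : ‖w‖ * Real.cos (Complex.arg w) = ρ.1 := Complex.norm_mul_cos_arg w
    have h2 : ‖w‖ * Real.sin (Complex.arg w) = ρ.2 := Complex.norm_mul_sin_arg w
    rw [planeRotation_apply, planeCLM_apply, ← h1, ← h2]
    push_cast
    ext <;> simp only <;> ring

/-- The rotation mean of `J` is a holomorphic function of the energy. -/
theorem exists_radial_profile (hR : R 0 0) {J : N × (ℂ × ℂ) → ℂ} {ν₀ : N}
    (hJ : ∀ᶠ x in 𝓝 (ν₀, (0 : ℂ × ℂ)), HolAt R J x) :
    ∃ m : N × ℂ → ℂ, (∀ᶠ x in 𝓝 (ν₀, (0 : ℂ)), HolAt R m x) ∧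
      ∀ᶠ y in 𝓝 (ν₀, (0 : ℝ × ℝ)),
        m (y.1, oscillatorC (planeCLM y.2)) = circleMean J (y.1, planeCLM y.2) := by
  have hM := eventually_holAt_circleMean hJ
  obtain ⟨ε, hε, hball⟩ := Metric.eventually_nhds_iff_ball.1 hM
  set δ := ε / 2 with hδdef
  have hδ : 0 < δ := by positivity
  have hgood : ∀ ν ∈ Metric.ball ν₀ ε, ∀ z : ℂ × ℂ, ‖z‖ ≤ δ → HolAt R (circleMean J) (ν, z) := by
    intro ν hν z hz
    refine hball _ ?_
    rw [← ball_prod_same]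
    refine ⟨hν, ?_⟩
    rw [mem_ball_zero_iff]
    linarith
  -- The product of the two null coordinates is `2 E`, so this point has energy `E`; it depends
  -- affinely on `E`, also at `E = 0`.
  let e : N × ℂ → ℂ × ℂ := fun x => nullPoint (((2 / δ : ℝ) : ℂ) * x.2, (δ : ℝ))
  have he : ∀ x, HolAt R e x := fun x =>
    ((holAt_snd (R := R) x).comp_contDiffAt
      (h := fun E : ℂ => nullPoint (((2 / δ : ℝ) : ℂ) * E, (δ : ℝ))) (by
        unfold nullPoint; fun_prop))
  refine ⟨fun x => circleMean J (x.1, e x), ?_, ?_⟩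
  · have h1 : ∀ᶠ x : N × ℂ in 𝓝 (ν₀, (0 : ℂ)), x.1 ∈ Metric.ball ν₀ ε ∧ ‖((2 / δ : ℝ) : ℂ) * x.2‖ < δ := by
      refine Filter.Eventually.and ?_ ?_
      · exact (continuous_fst.tendsto (ν₀, (0 : ℂ))).eventually (Metric.ball_mem_nhds _ hε)
      · have hc : ContinuousAt (fun x : N × ℂ => ‖((2 / δ : ℝ) : ℂ) * x.2‖) (ν₀, 0) := by fun_prop
        exact hc.eventually (gt_mem_nhds (by simpa using hδ))
    filter_upwards [h1] with x hx
    refine HolAt.subst (hgood x.1 hx.1 (e x) (norm_nullPoint_le hx.2.le ?_)) (he x)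
    simp [abs_of_pos hδ]
  · have h1 : ∀ᶠ y : N × (ℝ × ℝ) in 𝓝 (ν₀, (0 : ℝ × ℝ)),
        y.1 ∈ Metric.ball ν₀ ε ∧ y.2.1 ^ 2 + y.2.2 ^ 2 < δ ^ 2 := by
      refine Filter.Eventually.and ?_ ?_
      · exact (continuous_fst.tendsto (ν₀, (0 : ℝ × ℝ))).eventually (Metric.ball_mem_nhds _ hε)
      · have hc : ContinuousAt (fun y : N × (ℝ × ℝ) => y.2.1 ^ 2 + y.2.2 ^ 2) (ν₀, 0) := by fun_prop
        exact hc.eventually (gt_mem_nhds (by simpa using by positivity))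
    filter_upwards [h1] with y hy
    obtain ⟨r, α, hr0, hr2, hrot⟩ := exists_planeRotation_eq y.2
    have hrδ : r ≤ δ := by
      rw [← hr2] at hy
      exact (lt_of_pow_lt_pow_left₀ 2 hδ.le hy.2).le
    have hE : oscillatorC (planeCLM y.2) = ((r ^ 2 / 2 : ℝ) : ℂ) := by
      rw [hr2]; simp [oscillatorC, planeCLM_apply]
    have key := apply_nullPoint_eq (N := N) hR (F := circleMean J) (ν := y.1) hδ hr0 hrδ
      fun z hz => ⟨hgood y.1 hy.1 z hz,
        fderiv_circleMean_quarterTurn (hgood y.1 hy.1 z hz).differentiableAt⟩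
    have h2 : e (y.1, oscillatorC (planeCLM y.2)) = nullPoint ((r ^ 2 / δ : ℝ), (δ : ℝ)) := by
      simp only [e, hE]
      congr 2
      rw [← Complex.ofReal_mul]
      congr 1
      field_simp
    simp only [h2, key]
    rw [hrot, circleMean_planeRotation]

/-- The mean of a function of the energy over the segment from zero. -/
noncomputable def energyMean (m : N × ℂ → ℂ) (x : N × ℂ) : ℂ :=
  ∫ t in (0 : ℝ)..1, ((1 : ℝ) : ℂ) • m (x.1, scaleCLM ℂ t x.2)

theorem eventually_holAt_energyMean {m : N × ℂ → ℂ} {ν₀ : N}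
    (hm : ∀ᶠ x in 𝓝 (ν₀, (0 : ℂ)), HolAt R m x) :
    ∀ᶠ x in 𝓝 (ν₀, (0 : ℂ)), HolAt R (energyMean m) x :=
  eventually_holAt_integral (continuous_scaleCLM ℂ) continuous_const fun t _ => by
    simpa only [map_zero] using hm

theorem energyMean_center (m : N × ℂ → ℂ) (ν : N) : energyMean m (ν, 0) = m (ν, 0) := by
  simp [energyMean]

/-- This is `(E a)' = m` for `a` the mean of `m`: differentiate `τ ↦ τ a(τ E)`, which equals the
integral of `m(s E)` over `[0, τ]`, at `τ = 1`. -/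
theorem energyMean_add_fderiv {m : N × ℂ → ℂ} {ν₀ : N}
    (hm : ∀ᶠ x in 𝓝 (ν₀, (0 : ℂ)), HolAt R m x) :
    ∀ᶠ x in 𝓝 (ν₀, (0 : ℂ)),
      energyMean m x + fderiv ℝ (energyMean m) x (0, x.2) = m x := by
  -- The segment is taken up to `2` so that `τ = 1` is an interior point.
  have h := eventually_forall_uIcc (a := 0) (b := 2)
    (continuous_liftSnd (N := N) (continuous_scaleCLM ℂ)) (x := (ν₀, 0))
    (P := HolAt R m) (fun t _ => by rw [liftSnd_apply, map_zero]; exact hm)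
  filter_upwards [h, eventually_holAt_energyMean hm] with x hx hol
  obtain ⟨ν, E⟩ := x
  set q : ℝ → ℂ := fun s => m (ν, (s : ℂ) * E) with hq
  have hqc : ContinuousOn q (uIcc 0 2) := by
    intro t ht
    have h1 : ContinuousAt (fun t : ℝ => (ν, (t : ℂ) * E)) t := by fun_prop
    exact (ContinuousAt.comp (f := fun t : ℝ => (ν, (t : ℂ) * E)) (x := t) (g := m)
      (hx t ht).continuousAt h1).continuousWithinAt
  rw [uIcc_of_le (by norm_num)] at hqc
  have hform : ∀ τ : ℝ, (τ : ℂ) * energyMean m (ν, (τ : ℂ) * E) = ∫ s in (0 : ℝ)..τ, q s := by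
    intro τ
    have h1 := intervalIntegral.smul_integral_comp_mul_right (a := 0) (b := 1) (f := q) τ
    rw [zero_mul, one_mul] at h1
    rw [← h1, Complex.real_smul]
    congr 1
    refine intervalIntegral.integral_congr fun s _ => ?_
    simp only [hq, scaleCLM_apply, smul_eq_mul, Complex.ofReal_one, one_mul]
    push_cast
    rw [mul_assoc]
  have hline : HasDerivAt (fun τ : ℝ => (ν, (τ : ℂ) * E)) ((0 : N), E) 1 := by
    have h1 : HasDerivAt (fun t : ℝ => (t : ℂ) * E) ((1 : ℂ) * E) 1 :=
      (Complex.ofRealCLM.hasDerivAt (x := 1)).mul_const E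
    rw [one_mul] at h1
    exact (hasDerivAt_const _ _).prodMk h1
  have hd1 : HasDerivAt (fun τ : ℝ => energyMean m (ν, (τ : ℂ) * E))
      (fderiv ℝ (energyMean m) (ν, E) (0, E)) 1 := by
    have h2 : HasFDerivAt (energyMean m) (fderiv ℝ (energyMean m) (ν, E)) (ν, ((1 : ℝ) : ℂ) * E) := by
      rw [Complex.ofReal_one, one_mul]; exact hol.hasFDerivAt
    exact HasFDerivAt.comp_hasDerivAt (f := fun τ : ℝ => (ν, (τ : ℂ) * E)) 1 h2 hline
  have hd2 := (Complex.ofRealCLM.hasDerivAt (x := 1)).mul hd1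
  have hd3 : HasDerivAt (fun τ : ℝ => ∫ s in (0 : ℝ)..τ, q s) (q 1) 1 := by
    have hsub : Ioo (0 : ℝ) 2 ⊆ Icc 0 2 := Ioo_subset_Icc_self
    have hmem : (1 : ℝ) ∈ Ioo (0 : ℝ) 2 := by norm_num
    refine intervalIntegral.integral_hasDerivAt_right ?_ ?_ ?_
    · refine (hqc.mono ?_).intervalIntegrable
      rw [uIcc_of_le zero_le_one]
      exact Icc_subset_Icc_right (by norm_num)
    · exact (hqc.mono hsub).stronglyMeasurableAtFilter isOpen_Ioo _ hmem
    · exact (hqc.mono hsub).continuousAt (isOpen_Ioo.mem_nhds hmem)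
  have hd4 : HasDerivAt (fun τ : ℝ => (τ : ℂ) * energyMean m (ν, (τ : ℂ) * E)) (q 1) 1 := by
    simp only [hform]; exact hd3
  have huniq := hd2.unique hd4
  simpa [hq] using huniq

end Radial

/-! ### Scaling and rotating by functions: the Jacobian -/

section Twist

set_option linter.unusedSectionVars false

variable {N : Type} [NormedAddCommGroup N] [NormedSpace ℝ N] {R : N → N → Prop}
  {M : Type} [NormedAddCommGroup M] [NormedSpace ℝ M] {ι : M →L[ℝ] N} {μ₀ : M}

/-- The map of `ℂ²` that multiplies by `S` of the energy and rotates by the angle `u`. -/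
noncomputable def twist (S : N × ℂ → ℂ) (u : N × (ℂ × ℂ) → ℂ) (x : N × (ℂ × ℂ)) : ℂ × ℂ :=
  (S (x.1, oscillatorC x.2) * (Complex.cos (u x) * x.2.1 - Complex.sin (u x) * x.2.2),
    S (x.1, oscillatorC x.2) * (Complex.cos (u x) * x.2.2 + Complex.sin (u x) * x.2.1))

theorem oscillatorC_twist (S : N × ℂ → ℂ) (u : N × (ℂ × ℂ) → ℂ) (x : N × (ℂ × ℂ)) :
    oscillatorC (twist S u x) =
      S (x.1, oscillatorC x.2) * S (x.1, oscillatorC x.2) * oscillatorC x.2 := by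
  have h := Complex.sin_sq_add_cos_sq (u x)
  have ho : ∀ z, oscillatorC z = (z.1 ^ 2 + z.2 ^ 2) / 2 := fun _ => rfl
  unfold twist
  generalize S (x.1, oscillatorC x.2) = σ
  rw [ho, ho]
  linear_combination (σ ^ 2 * (x.2.1 ^ 2 + x.2.2 ^ 2) / 2) * h

theorem holAt_oscillatorC (x : N × (ℂ × ℂ)) :
    HolAt R (fun y : N × (ℂ × ℂ) => oscillatorC y.2) x :=
  (holAt_snd x).comp_contDiffAt (h := oscillatorC) (by unfold oscillatorC; fun_prop)

theorem fderiv_oscillatorC (x : N × (ℂ × ℂ)) (v : ℂ × ℂ) :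
    fderiv ℝ (fun y : N × (ℂ × ℂ) => oscillatorC y.2) x (0, v) = x.2.1 * v.1 + x.2.2 * v.2 := by
  have h1 : HasFDerivAt (fun x : N × (ℂ × ℂ) => x.2.1)
      ((ContinuousLinearMap.fst ℝ ℂ ℂ).comp (ContinuousLinearMap.snd ℝ N (ℂ × ℂ))) x :=
    ((ContinuousLinearMap.fst ℝ ℂ ℂ).comp (ContinuousLinearMap.snd ℝ N (ℂ × ℂ))).hasFDerivAt
  have h2 : HasFDerivAt (fun x : N × (ℂ × ℂ) => x.2.2)
      ((ContinuousLinearMap.snd ℝ ℂ ℂ).comp (ContinuousLinearMap.snd ℝ N (ℂ × ℂ))) x :=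
    ((ContinuousLinearMap.snd ℝ ℂ ℂ).comp (ContinuousLinearMap.snd ℝ N (ℂ × ℂ))).hasFDerivAt
  have h3 : HasFDerivAt (fun y : N × (ℂ × ℂ) => oscillatorC y.2) _ x :=
    (((h1.mul h1).add (h2.mul h2)).mul_const (1 / 2 : ℂ)).congr_of_eventuallyEq
      (Eventually.of_forall fun y => by
        simp only [oscillatorC, Pi.add_apply, Pi.mul_apply]; ring)
  rw [h3.fderiv]
  simp
  ring

theorem HolAt.twist {S : N × ℂ → ℂ} {u : N × (ℂ × ℂ) → ℂ} {x : N × (ℂ × ℂ)}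
    (hS : HolAt R S (x.1, oscillatorC x.2)) (hu : HolAt R u x) : HolAt R (twist S u) x := by
  have h1 : HolAt R (fun y : N × (ℂ × ℂ) => S (y.1, oscillatorC y.2)) x :=
    HolAt.subst hS (holAt_oscillatorC x)
  have h2 := hu.comp_contDiffAt (h := Complex.cos) Complex.contDiff_cos.contDiffAt
  have h3 := hu.comp_contDiffAt (h := Complex.sin) Complex.contDiff_sin.contDiffAt
  have h4 := (holAt_snd (R := R) x).fst
  have h5 := (holAt_snd (R := R) x).snd
  exact (h1.mul ((h2.mul h4).sub (h3.mul h5))).prodMk (h1.mul ((h2.mul h5).add (h3.mul h4)))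

/-- In action-angle coordinates the map sends `E` to `E S(E)²` and the angle to itself plus `u`, so
its matrix is triangular. The first factors are `(E S²)' = S (S + 2 E S')`, the last is the
derivative of the new angle in the old one. -/
theorem jac_twist (hR : R 0 0) {S : N × ℂ → ℂ} {u : N × (ℂ × ℂ) → ℂ} {x : N × (ℂ × ℂ)}
    (hS : HolAt R S (x.1, oscillatorC x.2)) (hu : HolAt R u x) :
    jac (twist S u) x = S (x.1, oscillatorC x.2) * (S (x.1, oscillatorC x.2) +
      fderiv ℝ S (x.1, oscillatorC x.2) (0, 2 * oscillatorC x.2)) *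
        (1 + fderiv ℝ u x (0, quarterTurn x.2)) := by
  have h1 : HolAt R (fun y : N × (ℂ × ℂ) => S (y.1, oscillatorC y.2)) x :=
    HolAt.subst hS (holAt_oscillatorC x)
  have hdσ : ∀ v, fderiv ℝ (fun y : N × (ℂ × ℂ) => S (y.1, oscillatorC y.2)) x (0, v) =
      (x.2.1 * v.1 + x.2.2 * v.2) * fderiv ℝ S (x.1, oscillatorC x.2) (0, 1) := by
    intro v
    rw [fderiv_subst hS.differentiableAt (holAt_oscillatorC (R := R) x).differentiableAt,
      fderiv_oscillatorC]
    simpa using hS.fderiv_smul hR (x.2.1 * v.1 + x.2.2 * v.2) 1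
  have hS2 : fderiv ℝ S (x.1, oscillatorC x.2) (0, 2 * oscillatorC x.2) =
      2 * oscillatorC x.2 * fderiv ℝ S (x.1, oscillatorC x.2) (0, 1) := by
    simpa using hS.fderiv_smul hR (2 * oscillatorC x.2) 1
  have hcos : HasFDerivAt (fun y => Complex.cos (u y)) _ x :=
    ((Complex.hasDerivAt_cos (u x)).hasFDerivAt.restrictScalars ℝ).comp x hu.hasFDerivAt
  have hsin : HasFDerivAt (fun y => Complex.sin (u y)) _ x :=
    ((Complex.hasDerivAt_sin (u x)).hasFDerivAt.restrictScalars ℝ).comp x hu.hasFDerivAt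
  have hx1 : HasFDerivAt (fun x : N × (ℂ × ℂ) => x.2.1)
      ((ContinuousLinearMap.fst ℝ ℂ ℂ).comp (ContinuousLinearMap.snd ℝ N (ℂ × ℂ))) x :=
    ((ContinuousLinearMap.fst ℝ ℂ ℂ).comp (ContinuousLinearMap.snd ℝ N (ℂ × ℂ))).hasFDerivAt
  have hx2 : HasFDerivAt (fun x : N × (ℂ × ℂ) => x.2.2)
      ((ContinuousLinearMap.snd ℝ ℂ ℂ).comp (ContinuousLinearMap.snd ℝ N (ℂ × ℂ))) x :=
    ((ContinuousLinearMap.snd ℝ ℂ ℂ).comp (ContinuousLinearMap.snd ℝ N (ℂ × ℂ))).hasFDerivAt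
  have hψ : HasFDerivAt (twist S u) _ x :=
    (h1.hasFDerivAt.mul ((hcos.mul hx1).sub (hsin.mul hx2))).prodMk
      (h1.hasFDerivAt.mul ((hcos.mul hx2).add (hsin.mul hx1)))
  have hq : fderiv ℝ u x (0, quarterTurn x.2) =
      -x.2.2 * fderiv ℝ u x (0, (1, 0)) + x.2.1 * fderiv ℝ u x (0, (0, 1)) := by
    rw [quarterTurn_apply, hu.fderiv_pair hR, smul_eq_mul, smul_eq_mul]
  have hpy := Complex.sin_sq_add_cos_sq (u x)
  have hE : 2 * oscillatorC x.2 = x.2.1 ^ 2 + x.2.2 ^ 2 := by simp only [oscillatorC]; ring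
  rw [jac, hψ.fderiv, hq, hS2, hE]
  simp only [ContinuousLinearMap.prod_apply, add_apply, sub_apply,
    smul_apply, Pi.sub_apply, Pi.mul_apply, ContinuousLinearMap.comp_apply, hdσ, smul_eq_mul,
    ContinuousLinearMap.coe_fst', ContinuousLinearMap.coe_snd',
    ContinuousLinearMap.coe_restrictScalars', ContinuousLinearMap.toSpanSingleton_apply]
  generalize S (x.1, oscillatorC x.2) = σ
  generalize fderiv ℝ S (x.1, oscillatorC x.2) (0, 1) = a
  generalize fderiv ℝ u x (0, (1, 0)) = u1
  generalize fderiv ℝ u x (0, (0, 1)) = u2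
  linear_combination ((σ ^ 2 + σ * a * (x.2.1 ^ 2 + x.2.2 ^ 2)) * (1 - x.2.2 * u1 + x.2.1 * u2)) * hpy

end Twist

/-! ### Prescribing the Jacobian by a twist -/

section AreaNormalization

set_option linter.unusedSectionVars false

variable {N : Type} [NormedAddCommGroup N] [NormedSpace ℝ N] {R : N → N → Prop}
  {M : Type} [NormedAddCommGroup M] [NormedSpace ℝ M] {ι : M →L[ℝ] N} {μ₀ : M}

theorem RealNear.congr {F G : N × (ℂ × ℂ) → ℂ} (hF : RealNear ι μ₀ F)
    (h : ∀ᶠ y in 𝓝 (μ₀, (0 : ℝ × ℝ)), G (realPoint ι y) = F (realPoint ι y)) :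
    RealNear ι μ₀ G := by
  filter_upwards [hF, h] with y h1 h2
  rw [h2, h1]

theorem RealNear.jac {F : N × (ℂ × ℂ) → ℂ × ℂ}
    (h : ∀ᶠ x in 𝓝 (ι μ₀, (0 : ℂ × ℂ)), HolAt R F x)
    (h1 : RealNear ι μ₀ fun x => (F x).1) (h2 : RealNear ι μ₀ fun x => (F x).2) :
    RealNear ι μ₀ (jac F) := by
  have e1 := h1.fderiv (h.mono fun x hx => hx.fst)
  have e2 := h2.fderiv (h.mono fun x hx => hx.snd)
  have h10 : planeCLM (1, 0) = ((1 : ℂ), (0 : ℂ)) := by simp [planeCLM_apply]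
  have h01 : planeCLM (0, 1) = ((0 : ℂ), (1 : ℂ)) := by simp [planeCLM_apply]
  have key := ((e1 (1, 0)).mul (e2 (0, 1))).sub ((e1 (0, 1)).mul (e2 (1, 0)))
  refine key.congr ?_
  filter_upwards [(tendsto_realPoint ι μ₀).eventually h] with y hy
  have f1 : ∀ v, _root_.fderiv ℝ (fun x => (F x).1) (realPoint ι y) v =
      (_root_.fderiv ℝ F (realPoint ι y) v).1 := fun v => by
    rw [hy.hasFDerivAt.fst.fderiv]; rfl
  have f2 : ∀ v, _root_.fderiv ℝ (fun x => (F x).2) (realPoint ι y) v =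
      (_root_.fderiv ℝ F (realPoint ι y) v).2 := fun v => by
    rw [hy.hasFDerivAt.snd.fderiv]; rfl
  simp only [f1, f2, h10, h01, _root_.jac]

theorem oscillatorC_smul (t : ℂ) (z : ℂ × ℂ) : oscillatorC (t • z) = t ^ 2 * oscillatorC z := by
  simp only [oscillatorC, Prod.smul_fst, Prod.smul_snd, smul_eq_mul]
  ring

theorem oscillatorC_zero : oscillatorC 0 = 0 := by simp [oscillatorC]

theorem tendsto_energy (ν₀ : N) : Tendsto (fun x : N × (ℂ × ℂ) => (x.1, oscillatorC x.2))
    (𝓝 (ν₀, 0)) (𝓝 (ν₀, 0)) := by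
  have hc : ContinuousAt (fun x : N × (ℂ × ℂ) => (x.1, oscillatorC x.2)) (ν₀, 0) := by
    unfold oscillatorC; fun_prop
  have := hc.tendsto
  simpa only [oscillatorC_zero] using this

/-- Multiplying the energy by `t` is multiplying the point by `√t`, so reality at real points passes
to the integral over `t`. -/
theorem RealNear.energyMean {m : N × ℂ → ℂ}
    (hm : RealNear ι μ₀ fun x => m (x.1, oscillatorC x.2)) :
    RealNear ι μ₀ fun x => energyMean m (x.1, oscillatorC x.2) := by
  have h := hm.integral (a := 0) (b := 1) (A := fun t => scaleCLM (ℂ × ℂ) (Real.sqrt t))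
    (A' := fun t => Real.sqrt t • ContinuousLinearMap.id ℝ (ℝ × ℝ))
    (by have := Real.continuous_sqrt; fun_prop)
    (fun t ρ => by simp [scaleCLM_apply, planeCLM_apply]) (fun _ => 1)
  refine h.congr (Eventually.of_forall fun y => ?_)
  refine intervalIntegral.integral_congr fun t ht => ?_
  rw [uIcc_of_le zero_le_one] at ht
  simp only [scaleCLM_apply, oscillatorC_smul]
  rw [← Complex.ofReal_pow, Real.sq_sqrt ht.1, smul_eq_mul, smul_eq_mul, smul_eq_mul]

theorem fderiv_div_of_eq_zero {F G : N × (ℂ × ℂ) → ℂ} {x : N × (ℂ × ℂ)} (hF : DifferentiableAt ℝ F x)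
    (hG : DifferentiableAt ℝ G x) (hG0 : G x ≠ 0) {v : N × (ℂ × ℂ)} (hv : fderiv ℝ G x v = 0) :
    fderiv ℝ (fun y => F y / G y) x v = fderiv ℝ F x v / G x := by
  have h1 : HasFDerivAt (fun y => F y * (G y)⁻¹) _ x :=
    hF.hasFDerivAt.mul (((hasDerivAt_inv hG0).hasFDerivAt.restrictScalars ℝ).comp x hG.hasFDerivAt)
  simp only [div_eq_mul_inv]
  rw [h1.fderiv]
  simp [hv, mul_comm]

/-- An area-preserving correction: a map that multiplies the energy by a function of the energy and
has a prescribed Jacobian at the real points. -/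
theorem exists_twist (hR : R 0 0) {J : N × (ℂ × ℂ) → ℂ}
    (hJ : ∀ᶠ x in 𝓝 (ι μ₀, (0 : ℂ × ℂ)), HolAt R J x) (rJ : RealNear ι μ₀ J)
    (hpos : 0 < (J (ι μ₀, 0)).re) :
    ∃ (a : N × ℂ → ℂ) (ψ : N × (ℂ × ℂ) → ℂ × ℂ),
      (∀ᶠ x in 𝓝 (ι μ₀, (0 : ℂ)), HolAt R a x) ∧ 0 < (a (ι μ₀, 0)).re ∧
      (RealNear ι μ₀ fun x => a (x.1, oscillatorC x.2)) ∧
      (∀ᶠ x in 𝓝 (ι μ₀, (0 : ℂ × ℂ)), HolAt R ψ x) ∧ (∀ ν, ψ (ν, 0) = 0) ∧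
      (RealNear ι μ₀ fun x => (ψ x).1) ∧ (RealNear ι μ₀ fun x => (ψ x).2) ∧
      (∀ᶠ y in 𝓝 (μ₀, (0 : ℝ × ℝ)), jac ψ (realPoint ι y) = J (realPoint ι y)) ∧
      ∀ᶠ x in 𝓝 (ι μ₀, (0 : ℂ × ℂ)),
        oscillatorC (ψ x) = oscillatorC x.2 * a (x.1, oscillatorC x.2) := by
  obtain ⟨m, hm, hmJ⟩ := exists_radial_profile hR hJ
  have hMn := eventually_holAt_circleMean hJ
  have hK := eventually_holAt_circleMoment hJ
  have hMn0 : circleMean J (ι μ₀, 0) = J (ι μ₀, 0) := circleMean_center J _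
  have hMnpos : ∀ᶠ x in 𝓝 (ι μ₀, (0 : ℂ × ℂ)), 0 < (circleMean J x).re :=
    (Complex.continuous_re.continuousAt.comp hMn.self_of_nhds.continuousAt).eventually
      (lt_mem_nhds (by simpa [hMn0] using hpos))
  have hne : ∀ {w : ℂ}, 0 < w.re → w ≠ 0 := fun h h0 => by simp [h0] at h
  -- The denominator is constant along rotations, so `1 + ∂u = 1 + (J - mean) / mean = J / mean`.
  set u : N × (ℂ × ℂ) → ℂ := fun x => circleMoment J x / circleMean J x with hu
  have hholu : ∀ᶠ x in 𝓝 (ι μ₀, (0 : ℂ × ℂ)), HolAt R u x := by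
    filter_upwards [hMn, hK, hMnpos] with x h1 h2 h3 using h2.div h1 (hne h3)
  set a := energyMean m with ha
  have hhola : ∀ᶠ x in 𝓝 (ι μ₀, (0 : ℂ)), HolAt R a x := eventually_holAt_energyMean hm
  have hmJ' : ∀ᶠ y in 𝓝 (μ₀, (0 : ℝ × ℝ)),
      m (ι y.1, oscillatorC (planeCLM y.2)) = circleMean J (realPoint ι y) := by
    have ht : Tendsto (fun y : M × (ℝ × ℝ) => (ι y.1, y.2)) (𝓝 (μ₀, 0)) (𝓝 (ι μ₀, 0)) :=
      Continuous.tendsto (by fun_prop) (μ₀, (0 : ℝ × ℝ))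
    exact ht.eventually hmJ
  have hm0 : m (ι μ₀, 0) = J (ι μ₀, 0) := by
    have := hmJ'.self_of_nhds
    simpa [realPoint_apply, oscillatorC_zero, hMn0] using this
  have ha0 : a (ι μ₀, 0) = J (ι μ₀, 0) := by rw [ha, energyMean_center, hm0]
  have rm : RealNear ι μ₀ fun x => m (x.1, oscillatorC x.2) := rJ.circleMean.congr hmJ'
  have ra : RealNear ι μ₀ fun x => a (x.1, oscillatorC x.2) := rm.energyMean
  have hapos : ∀ᶠ x in 𝓝 (ι μ₀, (0 : ℂ)), 0 < (a x).re :=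
    (Complex.continuous_re.continuousAt.comp hhola.self_of_nhds.continuousAt).eventually
      (lt_mem_nhds (by simpa [ha0] using hpos))
  set S : N × ℂ → ℂ := fun x => branchSqrt (a x) with hS
  have hholS : ∀ᶠ x in 𝓝 (ι μ₀, (0 : ℂ)), HolAt R S x := by
    filter_upwards [hhola, hapos] with x h1 h2 using h1.branchSqrt h2
  have hSS : ∀ᶠ x in 𝓝 (ι μ₀, (0 : ℂ)), S x * S x = a x := by
    filter_upwards [hapos] with x h1 using branchSqrt_mul_self (hne h1)
  -- With `S² = a` the radial factor is `a + E a'`, which is `m`. In `hjac` it cancels the circle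
  -- mean at real points, where `m` of the energy equals that mean, and `J` remains.
  have hSm : ∀ᶠ x in 𝓝 (ι μ₀, (0 : ℂ)),
      S x * (S x + fderiv ℝ S x (0, 2 * x.2)) = m x := by
    filter_upwards [hSS.eventually_nhds, hholS, energyMean_add_fderiv hm] with x h1 h2 h3
    have h4 : HasFDerivAt (fun y => S y * S y) _ x := h2.hasFDerivAt.mul h2.hasFDerivAt
    have h5 := (h4.congr_of_eventuallyEq (h1.mono fun y hy => hy.symm)).fderiv
    have h6 : fderiv ℝ S x (0, 2 * x.2) = 2 * fderiv ℝ S x (0, x.2) := by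
      simpa using h2.fderiv_smul hR 2 x.2
    rw [← h3, ← ha, h5, ← h1.self_of_nhds, h6]
    simp only [add_apply, smul_apply, smul_eq_mul]
    ring
  have hac : ContinuousAt (fun x : N × (ℂ × ℂ) => a (x.1, oscillatorC x.2)) (ι μ₀, 0) := by
    have h1 : ContinuousAt a (ι μ₀, 0) := hhola.self_of_nhds.continuousAt
    have h2 := h1.tendsto.comp (tendsto_energy (ι μ₀))
    change Tendsto (fun x : N × (ℂ × ℂ) => a (x.1, oscillatorC x.2)) _ _
    simpa only [oscillatorC_zero, Function.comp_def] using h2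
  have rS : RealNear ι μ₀ fun x => S (x.1, oscillatorC x.2) :=
    ra.branchSqrt hac (by simpa only [oscillatorC_zero, ha0] using hpos)
  have ru : RealNear ι μ₀ u := rJ.circleMoment.div rJ.circleMean
  have rc : RealNear ι μ₀ fun x => Complex.cos (u x) :=
    ru.map fun r => by rw [← Complex.ofReal_cos]; exact Complex.ofReal_im _
  have rs : RealNear ι μ₀ fun x => Complex.sin (u x) :=
    ru.map fun r => by rw [← Complex.ofReal_sin]; exact Complex.ofReal_im _
  have hE := tendsto_energy (ι μ₀)
  have hrot := eventually_forall_uIcc (a := 0) (b := 2 * Real.pi)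
    (continuous_liftSnd (N := N) continuous_planeRotation) (x := (ι μ₀, 0))
    (P := HolAt R J) (fun t _ => by rw [liftSnd_apply, map_zero]; exact hJ)
  have hjac : ∀ᶠ x in 𝓝 (ι μ₀, (0 : ℂ × ℂ)), jac (twist S u) x =
      m (x.1, oscillatorC x.2) * (J x / circleMean J x) := by
    filter_upwards [hE.eventually hholS, hholu, hE.eventually hSm, hMn, hK, hMnpos, hrot]
      with x h1 h2 h3 h4 h5 h6 h7
    rw [jac_twist hR h1 h2, h3, hu,
      fderiv_div_of_eq_zero h5.differentiableAt h4.differentiableAt (hne h6)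
        (fderiv_circleMean_quarterTurn h4.differentiableAt)]
    have h8 : fderiv ℝ (circleMoment J) x (0, quarterTurn x.2) = J x - circleMean J x :=
      fderiv_circleMoment_quarterTurn (fun t ht => (h7 t ht).continuousAt) h5.differentiableAt
    rw [h8]
    have := hne h6
    field_simp
    ring
  refine ⟨a, twist S u, hhola, by rwa [ha0], ra, ?_, fun ν => by simp [twist], ?_, ?_, ?_, ?_⟩
  · filter_upwards [hE.eventually hholS, hholu] with x h1 h2 using h1.twist h2
  · exact rS.mul ((rc.mul realNear_fst).sub (rs.mul realNear_snd))
  · exact rS.mul ((rc.mul realNear_snd).add (rs.mul realNear_fst))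
  · filter_upwards [(tendsto_realPoint ι μ₀).eventually hjac, hmJ',
      (tendsto_realPoint ι μ₀).eventually hMnpos] with y h1 h2 h3
    rw [h1]
    have h4 : m ((realPoint ι y).1, oscillatorC (realPoint ι y).2) =
        circleMean J (realPoint ι y) := h2
    rw [h4, mul_div_cancel₀ _ (hne h3)]
  · filter_upwards [hE.eventually hSS] with x h1
    rw [oscillatorC_twist, h1, mul_comm]

end AreaNormalization

/-! ### The complexified normal form -/

section ComplexNormalForm

set_option linter.unusedSectionVars false

variable {N : Type} [NormedAddCommGroup N] [NormedSpace ℝ N] {R : N → N → Prop}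
  {M : Type} [NormedAddCommGroup M] [NormedSpace ℝ M] {ι : M →L[ℝ] N} {μ₀ : M}

theorem HolAt.slice {Z W : Type} [NormedAddCommGroup Z] [NormedSpace ℂ Z] [NormedAddCommGroup W]
    [NormedSpace ℂ W] {F : N × Z → W} {ν : N} {z : Z} (hR : R 0 0) (h : HolAt R F (ν, z)) :
    ComplexSmoothAt (fun w => F (ν, w)) z := by
  have h1 : HasFDerivAt (fun w : Z => (ν, w)) (ContinuousLinearMap.inr ℝ N Z) z :=
    hasFDerivAt_prodMk_right ν z
  have h2 : HasFDerivAt (fun w => F (ν, w)) _ z := HasFDerivAt.comp z h.hasFDerivAt h1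
  refine ⟨ContDiffAt.comp z h.1 (contDiffAt_const.prodMk contDiffAt_id), fun v => ?_⟩
  rw [h2.fderiv]
  exact h.2 0 0 v hR

/-- A property of the real points is inherited along a real map that fixes the origin. -/
theorem eventually_realPoint_subst {P : N × (ℂ × ℂ) → Prop} {g : N × (ℂ × ℂ) → ℂ × ℂ}
    (hP : ∀ᶠ y in 𝓝 (μ₀, (0 : ℝ × ℝ)), P (realPoint ι y)) (h1 : RealNear ι μ₀ fun x => (g x).1)
    (h2 : RealNear ι μ₀ fun x => (g x).2) (hg : ContinuousAt g (ι μ₀, 0)) (hg0 : g (ι μ₀, 0) = 0) :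
    ∀ᶠ y in 𝓝 (μ₀, (0 : ℝ × ℝ)), P (ι y.1, g (realPoint ι y)) := by
  have ht : Tendsto (fun y : M × (ℝ × ℝ) => (y.1, rePlaneCLM (g (realPoint ι y))))
      (𝓝 (μ₀, 0)) (𝓝 (μ₀, 0)) := by
    refine (continuous_fst.tendsto (μ₀, (0 : ℝ × ℝ))).prodMk_nhds ?_
    have h3 : Tendsto g (𝓝 (ι μ₀, 0)) (𝓝 0) := by
      have := hg.tendsto
      rwa [hg0] at this
    have h4 := rePlaneCLM.continuous.tendsto 0
    rw [map_zero] at h4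
    exact h4.comp (h3.comp (tendsto_realPoint ι μ₀))
  filter_upwards [ht.eventually hP, RealNear.eventually_eq h1 h2] with y e1 e2
  rw [realPoint_apply] at e1
  simpa only [e2] using e1

theorem tendsto_subst {g : N × (ℂ × ℂ) → ℂ × ℂ} {ν₀ : N} (hg : ContinuousAt g (ν₀, 0))
    (hg0 : g (ν₀, 0) = 0) : Tendsto (fun x : N × (ℂ × ℂ) => (x.1, g x)) (𝓝 (ν₀, 0)) (𝓝 (ν₀, 0)) := by
  have h : ContinuousAt (fun x : N × (ℂ × ℂ) => (x.1, g x)) (ν₀, 0) :=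
    continuousAt_fst.prodMk hg
  have := h.tendsto
  simpa only [hg0] using this

theorem jac_mul_jac_of_inverse (hR : R 0 0) {F g : N × (ℂ × ℂ) → ℂ × ℂ} {x : N × (ℂ × ℂ)}
    (hF : HolAt R F (x.1, g x)) (hg : HolAt R g x) (h : ∀ᶠ y in 𝓝 x, F (y.1, g y) = y.2) :
    jac F (x.1, g x) * jac g x = 1 := by
  rw [← jac_subst hR hF hg, jac_congr h, jac_snd]

/-- A holomorphic function that is real for positive small energies is real for all small real
energies. -/
theorem eventually_im_eq_zero_of_energy (hR : R 0 0) {a : N × ℂ → ℂ}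
    (ha : ∀ᶠ x in 𝓝 (ι μ₀, (0 : ℂ)), HolAt R a x)
    (h : RealNear ι μ₀ fun x => a (x.1, oscillatorC x.2)) :
    ∀ᶠ y : M × ℝ in 𝓝 (μ₀, (0 : ℝ)), (a (ι y.1, (y.2 : ℂ))).im = 0 := by
  obtain ⟨ε, hε, hball⟩ := Metric.eventually_nhds_iff_ball.1 h
  obtain ⟨δ, hδ, hball'⟩ := Metric.eventually_nhds_iff_ball.1 ha
  have hι : ∀ᶠ μ in 𝓝 μ₀, ι μ ∈ Metric.ball (ι μ₀) δ :=
    ι.continuous.continuousAt.eventually (Metric.ball_mem_nhds _ hδ)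
  have h1 : ∀ᶠ y : M × ℝ in 𝓝 (μ₀, (0 : ℝ)), y.1 ∈ Metric.ball μ₀ ε ∧
      ι y.1 ∈ Metric.ball (ι μ₀) δ ∧ y.2 ∈ Metric.ball (0 : ℝ) δ := by
    have t1 : Tendsto (fun y : M × ℝ => y.1) (𝓝 (μ₀, (0 : ℝ))) (𝓝 μ₀) := continuousAt_fst
    have t2 : Tendsto (fun y : M × ℝ => y.2) (𝓝 (μ₀, (0 : ℝ))) (𝓝 0) := continuousAt_snd
    exact (t1.eventually (Metric.ball_mem_nhds _ hε)).and
      ((t1.eventually hι).and (t2.eventually (Metric.ball_mem_nhds _ hδ)))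
  filter_upwards [h1] with y hy
  obtain ⟨hy1, hy2, hy3⟩ := hy
  have hd : AnalyticOnNhd ℂ (fun E => a (ι y.1, E)) (Metric.ball 0 δ) := by
    refine DifferentiableOn.analyticOnNhd (fun E hE => ?_) Metric.isOpen_ball
    refine (HolAt.slice hR (hball' (ι y.1, E) ?_)).differentiableAt.differentiableWithinAt
    rw [← ball_prod_same]
    exact ⟨hy2, hE⟩
  -- Real points only reach nonnegative energies, `E` being attained at `(√(2E), 0)`. Negative
  -- energies follow from the identity theorem for this real analytic function.
  have hr : AnalyticOnNhd ℝ (fun E : ℝ => (a (ι y.1, (E : ℂ))).im) (Metric.ball 0 δ) := by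
    intro E hE
    have e1 : AnalyticAt ℝ (fun E => a (ι y.1, E)) (Complex.ofRealCLM E) :=
      (hd (E : ℂ) (by simpa using hE)).restrictScalars
    exact (Complex.imCLM.analyticAt _).comp (e1.comp (Complex.ofRealCLM.analyticAt E))
  have hzero : ∀ᶠ E : ℝ in 𝓝[>] (0 : ℝ), (a (ι y.1, (E : ℂ))).im = 0 := by
    have h2 : ∀ᶠ E : ℝ in 𝓝[>] (0 : ℝ), E < ε ^ 2 / 2 :=
      mem_nhdsWithin_of_mem_nhds (Iio_mem_nhds (by positivity))
    filter_upwards [h2, self_mem_nhdsWithin] with E hE hE0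
    have hE0' : 0 ≤ 2 * E := by have : 0 < E := hE0; linarith
    have h3 := hball (y.1, (Real.sqrt (2 * E), 0)) (by
      rw [← ball_prod_same]
      refine ⟨hy1, ?_⟩
      rw [mem_ball_zero_iff, Prod.norm_def, max_lt_iff]
      refine ⟨?_, by simpa using hε⟩
      simp only [Real.norm_eq_abs, abs_of_nonneg (Real.sqrt_nonneg _)]
      rw [Real.sqrt_lt' hε]
      linarith)
    have h4 : oscillatorC (planeCLM (Real.sqrt (2 * E), 0)) = (E : ℂ) := by
      simp only [oscillatorC, planeCLM_apply]
      rw [← Complex.ofReal_pow, Real.sq_sqrt hE0']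
      push_cast; ring
    simpa only [realPoint_apply, h4] using h3
  have hpre : IsPreconnected (Metric.ball (0 : ℝ) δ) := (convex_ball 0 δ).isPreconnected
  have hfr : ∃ᶠ E : ℝ in 𝓝[≠] (0 : ℝ), (a (ι y.1, (E : ℂ))).im = 0 :=
    (hzero.frequently).filter_mono (nhdsWithin_mono _ fun E (hE : 0 < E) => hE.ne')
  exact hr.eqOn_zero_of_preconnected_of_frequently_eq_zero hpre (Metric.mem_ball_self hδ) hfr hy3

/-- The complexified normal form: an area-preserving chart `χ`, with inverse `κ`, in which the
harmonic oscillator is `p` times a function of `p`. -/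
theorem exists_normal_form [CompleteSpace N] [CompleteSpace M] (hR : R 0 0)
    {G : N × (ℂ × ℂ) → ℂ} {p : M → ℝ × ℝ → ℝ}
    (hG : ∀ᶠ x in 𝓝 (ι μ₀, (0 : ℂ × ℂ)), HolAt R G x)
    (hGp : ∀ᶠ y in 𝓝 (μ₀, (0 : ℝ × ℝ)), G (realPoint ι y) = (p y.1 y.2 : ℂ))
    (hp : ∀ᶠ μ in 𝓝 μ₀, ComparableToSquare (p μ)) :
    ∃ (a : N × ℂ → ℂ) (χ κ : N × (ℂ × ℂ) → ℂ × ℂ),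
      (∀ᶠ x in 𝓝 (ι μ₀, (0 : ℂ)), HolAt R a x) ∧ 0 < (a (ι μ₀, 0)).re ∧
      (∀ᶠ y : M × ℝ in 𝓝 (μ₀, (0 : ℝ)), (a (ι y.1, (y.2 : ℂ))).im = 0) ∧
      (∀ᶠ x in 𝓝 (ι μ₀, (0 : ℂ × ℂ)), HolAt R χ x) ∧
      (∀ᶠ x in 𝓝 (ι μ₀, (0 : ℂ × ℂ)), HolAt R κ x) ∧
      (∀ ν, χ (ν, 0) = 0) ∧ κ (ι μ₀, 0) = 0 ∧
      (RealNear ι μ₀ fun x => (χ x).1) ∧ (RealNear ι μ₀ fun x => (χ x).2) ∧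
      (RealNear ι μ₀ fun x => (κ x).1) ∧ (RealNear ι μ₀ fun x => (κ x).2) ∧
      (∀ᶠ y in 𝓝 (μ₀, (0 : ℝ × ℝ)), jac κ (realPoint ι y) = 1) ∧
      (∀ᶠ x in 𝓝 (ι μ₀, (0 : ℂ × ℂ)), κ (x.1, χ x) = x.2) ∧
      (∀ᶠ x in 𝓝 (ι μ₀, (0 : ℂ × ℂ)), χ (x.1, κ x) = x.2) ∧
      ∀ᶠ y in 𝓝 (μ₀, (0 : ℝ × ℝ)),
        oscillatorC (χ (realPoint ι y)) = p y.1 y.2 * a (ι y.1, p y.1 y.2) := by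
  obtain ⟨φ, hφ, hφ0, rφ1, rφ2, ⟨s, hs, hjs⟩, hpφ⟩ := exists_morse_chart hR hG hGp hp
  have hj0 : jac φ (ι μ₀, 0) ≠ 0 := by rw [hjs]; exact_mod_cast hs.ne'
  obtain ⟨η, hη, hη0, hηφ, hφη⟩ := exists_inverse hR hφ (hφ0 _) hj0
  obtain ⟨rη1, rη2⟩ := realNear_inverse hφ (hφ0 _) hj0 rφ1 rφ2 hηφ
  have cφ : ContinuousAt φ (ι μ₀, 0) := hφ.self_of_nhds.continuousAt
  have tφ := tendsto_subst cφ (hφ0 _)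
  -- The target of the twist is the Jacobian of `η = φ⁻¹`, so that at real points `jac ψ`, taken at
  -- `φ`, times `jac φ` equals one.
  have hJ : ∀ᶠ x in 𝓝 (ι μ₀, (0 : ℂ × ℂ)), HolAt R (jac η) x := by
    filter_upwards [hη.eventually_nhds] with x hx using HolAt.jac hx
  have hjj : ∀ᶠ x in 𝓝 (ι μ₀, (0 : ℂ × ℂ)), jac η (x.1, φ x) * jac φ x = 1 := by
    filter_upwards [tφ.eventually hη, hφ, hηφ.eventually_nhds] with x h1 h2 h3
      using jac_mul_jac_of_inverse hR h1 h2 h3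
  have hJpos : 0 < (jac η (ι μ₀, 0)).re := by
    have h1 := hjj.self_of_nhds
    simp only [hφ0, hjs] at h1
    have h2 : jac η (ι μ₀, 0) = ((s⁻¹ : ℝ) : ℂ) := by
      rw [Complex.ofReal_inv]; exact eq_inv_of_mul_eq_one_left h1
    rw [h2, Complex.ofReal_re]
    positivity
  obtain ⟨a, ψ, ha, hapos, ra, hψ, hψ0, rψ1, rψ2, hjψ, hψE⟩ :=
    exists_twist hR hJ (RealNear.jac hη rη1 rη2) hJpos
  set χ : N × (ℂ × ℂ) → ℂ × ℂ := fun x => ψ (x.1, φ x) with hχdef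
  have hχ : ∀ᶠ x in 𝓝 (ι μ₀, (0 : ℂ × ℂ)), HolAt R χ x := by
    filter_upwards [tφ.eventually hψ, hφ] with x h1 h2 using HolAt.subst h1 h2
  have hχ0 : ∀ ν, χ (ν, 0) = 0 := fun ν => by simp only [hχdef, hφ0, hψ0]
  have rχ1 : RealNear ι μ₀ fun x => (χ x).1 := RealNear.subst rψ1 rφ1 rφ2 cφ (hφ0 _)
  have rχ2 : RealNear ι μ₀ fun x => (χ x).2 := RealNear.subst rψ2 rφ1 rφ2 cφ (hφ0 _)
  have hjχ : ∀ᶠ y in 𝓝 (μ₀, (0 : ℝ × ℝ)), jac χ (realPoint ι y) = 1 := by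
    have t := tendsto_realPoint ι μ₀
    filter_upwards [eventually_realPoint_subst (P := fun x => jac ψ x = jac η x) hjψ rφ1 rφ2 cφ
      (hφ0 _), t.eventually hjj, t.eventually (tφ.eventually hψ), t.eventually hφ] with y h1 h2 h3 h4
    rw [jac_subst hR h3 h4]
    rw [← h2]
    congr 1
  have hjχ0 : jac χ (ι μ₀, 0) ≠ 0 := by
    have := hjχ.self_of_nhds
    rw [realPoint_center] at this
    rw [this]
    exact one_ne_zero
  obtain ⟨κ, hκ, hκ0, hκχ, hχκ⟩ := exists_inverse hR hχ (hχ0 _) hjχ0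
  obtain ⟨rκ1, rκ2⟩ := realNear_inverse hχ (hχ0 _) hjχ0 rχ1 rχ2 hκχ
  have cκ : ContinuousAt κ (ι μ₀, 0) := hκ.self_of_nhds.continuousAt
  have tκ := tendsto_subst cκ hκ0
  refine ⟨a, χ, κ, ha, hapos, eventually_im_eq_zero_of_energy hR ha ra, hχ, hκ, hχ0, hκ0, rχ1, rχ2,
    rκ1, rκ2, ?_, hκχ, hχκ, ?_⟩
  · have t := tendsto_realPoint ι μ₀
    filter_upwards [eventually_realPoint_subst (P := fun x => jac χ x = 1) hjχ rκ1 rκ2 cκ hκ0,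
      t.eventually (tκ.eventually hχ), t.eventually hκ, t.eventually hχκ.eventually_nhds]
      with y h1 h2 h3 h4
    have h5 := jac_mul_jac_of_inverse hR h2 h3 h4
    have h6 : jac χ ((realPoint ι y).1, κ (realPoint ι y)) = 1 := h1
    rwa [h6, one_mul] at h5
  · filter_upwards [(tendsto_realPoint ι μ₀).eventually (tφ.eventually hψE), hpφ] with y h1 h2
    rw [h2]
    exact h1

end ComplexNormalForm

/-! ### Hamilton flows in normal form and minimal periods -/

section Flow

theorem realRotation_zero (r : ℝ × ℝ) : realRotation 0 r = r := by
  simp [realRotation_apply]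

theorem harmonicOscillator_realRotation (t : ℝ) (r : ℝ × ℝ) :
    harmonicOscillator (realRotation t r) = harmonicOscillator r := by
  simp only [harmonicOscillator, realRotation_apply]
  linear_combination (r.1 ^ 2 + r.2 ^ 2) / 2 * Real.sin_sq_add_cos_sq t

theorem continuous_harmonicOscillator : Continuous harmonicOscillator := by
  unfold harmonicOscillator; fun_prop

theorem harmonicOscillator_zero : harmonicOscillator 0 = 0 := by simp [harmonicOscillator]

theorem harmonicOscillator_pos {r : ℝ × ℝ} (hr : r ≠ 0) : 0 < harmonicOscillator r := by
  unfold harmonicOscillator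
  by_cases h1 : r.1 = 0
  · have h2 : r.2 ≠ 0 := fun h2 => hr (Prod.ext h1 h2)
    positivity
  · positivity

theorem hasFDerivAt_harmonicOscillator (r : ℝ × ℝ) :
    HasFDerivAt harmonicOscillator
      (r.1 • ContinuousLinearMap.fst ℝ ℝ ℝ + r.2 • ContinuousLinearMap.snd ℝ ℝ ℝ) r := by
  have h1 : HasFDerivAt (fun r : ℝ × ℝ => r.1) (ContinuousLinearMap.fst ℝ ℝ ℝ) r := hasFDerivAt_fst
  have h2 : HasFDerivAt (fun r : ℝ × ℝ => r.2) (ContinuousLinearMap.snd ℝ ℝ ℝ) r := hasFDerivAt_snd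
  have h3 := (((h1.mul h1).add (h2.mul h2)).mul_const (1 / 2 : ℝ)).congr_of_eventuallyEq
    (f₁ := harmonicOscillator) (Eventually.of_forall fun y => by
      simp only [harmonicOscillator, Pi.add_apply, Pi.mul_apply]; ring)
  have e : r.1 • ContinuousLinearMap.fst ℝ ℝ ℝ + r.2 • ContinuousLinearMap.snd ℝ ℝ ℝ =
      (1 / 2 : ℝ) • (r.1 • ContinuousLinearMap.fst ℝ ℝ ℝ + r.1 • ContinuousLinearMap.fst ℝ ℝ ℝ +
        (r.2 • ContinuousLinearMap.snd ℝ ℝ ℝ + r.2 • ContinuousLinearMap.snd ℝ ℝ ℝ)) := by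
    module
  rw [e]
  exact h3

/-- A property that holds near the origin holds along the circles near the origin. -/
theorem eventually_forall_realRotation {P : ℝ × ℝ → Prop} (h : ∀ᶠ r in 𝓝 (0 : ℝ × ℝ), P r) :
    ∀ᶠ r in 𝓝 (0 : ℝ × ℝ), ∀ t, P (realRotation t r) := by
  obtain ⟨ε, hε, hball⟩ := Metric.eventually_nhds_iff_ball.1 h
  filter_upwards [Metric.ball_mem_nhds (0 : ℝ × ℝ) (half_pos hε)] with r hr t
  refine hball _ ?_
  rw [mem_ball_zero_iff, Prod.norm_def, max_lt_iff] at hr ⊢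
  simp only [Real.norm_eq_abs, realRotation_apply] at hr ⊢
  have hc := Real.abs_cos_le_one t
  have hs := Real.abs_sin_le_one t
  have e1 : ∀ a b : ℝ, |a| ≤ 1 → |a * b| ≤ |b| := fun a b ha => by
    rw [abs_mul]; exact mul_le_of_le_one_left (abs_nonneg _) ha
  constructor
  · refine (abs_sub _ _).trans_lt ?_
    linarith [e1 _ r.1 hc, e1 _ r.2 hs]
  · refine (abs_add_le _ _).trans_lt ?_
    linarith [e1 _ r.2 hc, e1 _ r.1 hs]

/-- The minus sign is due to the orientation: the Hamilton flow of the oscillator turns against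
`realRotation`. -/
theorem hasDerivAt_realRotation (w : ℝ) (r : ℝ × ℝ) (t : ℝ) :
    HasDerivAt (fun t => realRotation (-(w * t)) r)
      (w • ((realRotation (-(w * t)) r).2, -(realRotation (-(w * t)) r).1)) t := by
  have h0 : HasDerivAt (fun t : ℝ => -(w * t)) (-w) t := by
    have := (hasDerivAt_id t).const_mul (-w)
    simpa [neg_mul] using this
  have hc := (Real.hasDerivAt_cos (-(w * t))).comp t h0
  have hs := (Real.hasDerivAt_sin (-(w * t))).comp t h0
  have h := ((hc.mul_const r.1).sub (hs.mul_const r.2)).prodMk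
    ((hc.mul_const r.2).add (hs.mul_const r.1))
  simp only [realRotation_apply]
  have e : w • (Real.cos (-(w * t)) * r.2 + Real.sin (-(w * t)) * r.1,
        -(Real.cos (-(w * t)) * r.1 - Real.sin (-(w * t)) * r.2)) =
      (-Real.sin (-(w * t)) * -w * r.1 - Real.cos (-(w * t)) * -w * r.2,
        -Real.sin (-(w * t)) * -w * r.2 + Real.cos (-(w * t)) * -w * r.1) := by
    simp only [Prod.smul_mk, smul_eq_mul]
    ext <;> simp only <;> ring
  rw [e]
  exact h

theorem eq_of_realRotation_eq {s t : ℝ} {r : ℝ × ℝ} (hr : r ≠ 0)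
    (h : realRotation s r = realRotation t r) : Real.cos (s - t) = 1 := by
  have h1 : realRotation (s - t) r = r := by
    rw [realRotation_apply, Prod.ext_iff] at h ⊢
    simp only [realRotation_apply] at h
    have e := Real.sin_sq_add_cos_sq t
    rw [Real.cos_sub, Real.sin_sub]
    constructor
    · simp only
      linear_combination Real.cos t * h.1 + Real.sin t * h.2 + r.1 * e
    · simp only
      linear_combination Real.cos t * h.2 - Real.sin t * h.1 + r.2 * e
  have hpos := harmonicOscillator_pos hr
  rw [realRotation_apply, Prod.ext_iff] at h1
  obtain ⟨e1, e2⟩ := h1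
  simp only at e1 e2
  unfold harmonicOscillator at hpos
  have : (Real.cos (s - t) - 1) * (r.1 ^ 2 + r.2 ^ 2) = 0 := by
    linear_combination r.1 * e1 + r.2 * e2
  rcases mul_eq_zero.1 this with h | h
  · linarith
  · linarith

/-- A canonical transformation maps Hamilton vector fields to Hamilton vector fields. -/
theorem hamiltonField_eq_of_comp {H : ℝ × ℝ → ℝ} {κ : ℝ × ℝ → ℝ × ℝ} {g : ℝ → ℝ} {r : ℝ × ℝ}
    (hκ : DifferentiableAt ℝ κ r)
    (hw : ∀ u v, symplecticForm (fderiv ℝ κ r u) (fderiv ℝ κ r v) = symplecticForm u v)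
    (hH : DifferentiableAt ℝ H (κ r)) (hg : DifferentiableAt ℝ g (harmonicOscillator r))
    (h : ∀ᶠ s in 𝓝 r, H (κ s) = g (harmonicOscillator s)) :
    hamiltonField H (κ r) = fderiv ℝ κ r (deriv g (harmonicOscillator r) • (r.2, -r.1)) := by
  have h1 : HasFDerivAt (fun s => H (κ s)) ((fderiv ℝ H (κ r)).comp (fderiv ℝ κ r)) r :=
    hH.hasFDerivAt.comp r hκ.hasFDerivAt
  have h2 : HasFDerivAt (fun s => g (harmonicOscillator s)) _ r :=
    hg.hasDerivAt.hasFDerivAt.comp r (hasFDerivAt_harmonicOscillator r)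
  have h3 := (h1.congr_of_eventuallyEq (h.mono fun s hs => hs.symm)).unique h2
  have e1 := congrArg (fun L : ℝ × ℝ →L[ℝ] ℝ => L (1, 0)) h3
  have e2 := congrArg (fun L : ℝ × ℝ →L[ℝ] ℝ => L (0, 1)) h3
  simp at e1 e2
  set g' := deriv g (harmonicOscillator r)
  -- On the basis vectors, invariance of the form says that the Jacobian is one. This solves the
  -- linear system for the gradient of `H` without inverting the derivative of `κ`.
  have hdet := hw (1, 0) (0, 1)
  set A := fderiv ℝ κ r (1, 0) with hA
  set B := fderiv ℝ κ r (0, 1) with hB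
  have hlin : ∀ (L : ℝ × ℝ →L[ℝ] ℝ) (a : ℝ × ℝ), L a = a.1 * L (1, 0) + a.2 * L (0, 1) := by
    intro L a
    rw [← smul_eq_mul, ← smul_eq_mul, ← map_smul, ← map_smul, ← map_add]
    simp
  have hlin2 : fderiv ℝ κ r (g' • (r.2, -r.1)) = (g' * r.2) • A + (-(g' * r.1)) • B := by
    rw [hA, hB, ← map_smul, ← map_smul, ← map_add]
    simp
  rw [hlin] at e1 e2
  rw [hlin2]
  simp only [symplecticForm] at hdet
  simp only [hamiltonField]
  ext
  · simp
    linear_combination (fderiv ℝ H (κ r) (0, 1)) * hdet - B.1 * e1 + A.1 * e2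
  · simp
    linear_combination (-fderiv ℝ H (κ r) (1, 0)) * hdet - B.2 * e1 + A.2 * e2

section Chart

variable {H : ℝ × ℝ → ℝ} {κ χ : ℝ × ℝ → ℝ × ℝ} {g : ℝ → ℝ}

/-- In canonical coordinates that reduce `H` to a function of the harmonic oscillator, the
trajectories are rotations. -/
theorem eventually_trajectory
    (hκ : ∀ᶠ r in 𝓝 (0 : ℝ × ℝ), DifferentiableAt ℝ κ r ∧
      ∀ u v, symplecticForm (fderiv ℝ κ r u) (fderiv ℝ κ r v) = symplecticForm u v)
    (hκ0 : κ 0 = 0) (hH : ∀ᶠ ρ in 𝓝 (0 : ℝ × ℝ), DifferentiableAt ℝ H ρ)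
    (hg : ∀ᶠ s in 𝓝 (0 : ℝ), DifferentiableAt ℝ g s)
    (h : ∀ᶠ r in 𝓝 (0 : ℝ × ℝ), H (κ r) = g (harmonicOscillator r)) :
    ∀ᶠ r in 𝓝 (0 : ℝ × ℝ), ∀ t, HasDerivAt
      (fun t => κ (realRotation (-(deriv g (harmonicOscillator r) * t)) r))
      (hamiltonField H (κ (realRotation (-(deriv g (harmonicOscillator r) * t)) r))) t := by
  have tκ : Tendsto κ (𝓝 0) (𝓝 0) := by
    have := hκ.self_of_nhds.1.continuousAt.tendsto
    rwa [hκ0] at this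
  have tp : Tendsto harmonicOscillator (𝓝 0) (𝓝 0) := by
    have := continuous_harmonicOscillator.tendsto 0
    rwa [harmonicOscillator_zero] at this
  have key := eventually_forall_realRotation
    (hκ.and ((tκ.eventually hH).and ((tp.eventually hg).and h.eventually_nhds)))
  filter_upwards [key] with r hr t
  obtain ⟨⟨h1, h2⟩, h3, h4, h5⟩ := hr (-(deriv g (harmonicOscillator r) * t))
  have h6 := hamiltonField_eq_of_comp h1 h2 h3 h4 h5
  rw [harmonicOscillator_realRotation] at h6
  rw [h6]
  exact h1.hasFDerivAt.comp_hasDerivAt t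
    (hasDerivAt_realRotation (deriv g (harmonicOscillator r)) r t)

/-- The trajectory through `ρ` is the `κ`-image of the circle through `χ ρ`, run at unit speed. A
shorter period would pass to the circle, because `χ` inverts `κ` along it. -/
theorem hamiltonFlowTwoPiPeriodic_of_normalForm
    (hκ : ∀ᶠ r in 𝓝 (0 : ℝ × ℝ), DifferentiableAt ℝ κ r ∧
      ∀ u v, symplecticForm (fderiv ℝ κ r u) (fderiv ℝ κ r v) = symplecticForm u v)
    (hκ0 : κ 0 = 0) (hH : ∀ᶠ ρ in 𝓝 (0 : ℝ × ℝ), DifferentiableAt ℝ H ρ)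
    (h : ∀ᶠ r in 𝓝 (0 : ℝ × ℝ), H (κ r) = harmonicOscillator r)
    (hχ : ContinuousAt χ 0) (hχ0 : χ 0 = 0) (hκχ : ∀ᶠ ρ in 𝓝 (0 : ℝ × ℝ), κ (χ ρ) = ρ)
    (hχκ : ∀ᶠ r in 𝓝 (0 : ℝ × ℝ), χ (κ r) = r) :
    HamiltonFlowTwoPiPeriodic H := by
  have hT := eventually_trajectory (g := id) hκ hκ0 hH
    (Eventually.of_forall fun s => differentiableAt_id) h
  have tχ : Tendsto χ (𝓝 0) (𝓝 0) := by
    have := hχ.tendsto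
    rwa [hχ0] at this
  filter_upwards [hκχ, tχ.eventually hT, tχ.eventually (eventually_forall_realRotation hχκ)]
    with ρ h1 h2 h3
  simp only [deriv_id, one_mul] at h2
  refine ⟨fun t => κ (realRotation (-t) (χ ρ)), ?_, h2, fun t => ?_, fun hρ T hT hper => ?_⟩
  · simp only [neg_zero, realRotation_zero, h1]
  · simp only [realRotation_apply, neg_add, ← sub_eq_add_neg, Real.cos_sub_two_pi,
      Real.sin_sub_two_pi]
  · have h4 := hper 0
    simp only [zero_add] at h4
    have h5 : realRotation (-T) (χ ρ) = realRotation (-0) (χ ρ) := by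
      rw [← h3 (-T), ← h3 (-0), h4]
    have h6 : χ ρ ≠ 0 := fun h0 => hρ (by rw [← h1, h0, hκ0])
    have h7 := eq_of_realRotation_eq h6 h5
    rw [neg_zero, sub_zero, Real.cos_neg, Real.cos_eq_one_iff_of_lt_of_lt
      (by linarith [hT.1, Real.two_pi_pos]) hT.2] at h7
    exact hT.1.ne' h7

theorem hamiltonField_contDiffAt {ρ : ℝ × ℝ} (hH : ContDiffAt ℝ 2 H ρ) :
    ContDiffAt ℝ 1 (hamiltonField H) ρ := by
  have h1 : ContDiffAt ℝ 1 (fderiv ℝ H) ρ := hH.fderiv_right (by norm_num)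
  exact (h1.clm_apply contDiffAt_const).prodMk (h1.clm_apply contDiffAt_const).neg

/-- The set of times at which the curves agree is closed by continuity and open by local uniqueness.
Regularity is needed only along `γ₂`, since openness is tested at common points. -/
theorem trajectory_unique {γ₁ γ₂ : ℝ → ℝ × ℝ} (h1 : ∀ t, HasDerivAt γ₁ (hamiltonField H (γ₁ t)) t)
    (h2 : ∀ t, HasDerivAt γ₂ (hamiltonField H (γ₂ t)) t) (hH : ∀ t, ContDiffAt ℝ 2 H (γ₂ t))
    (h0 : γ₁ 0 = γ₂ 0) : γ₁ = γ₂ := by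
  have c1 : Continuous γ₁ := continuous_iff_continuousAt.2 fun t => (h1 t).continuousAt
  have c2 : Continuous γ₂ := continuous_iff_continuousAt.2 fun t => (h2 t).continuousAt
  have hcl : IsClosed {t | γ₁ t = γ₂ t} := isClosed_eq c1 c2
  have hop : IsOpen {t | γ₁ t = γ₂ t} := by
    refine isOpen_iff_mem_nhds.2 fun t ht => ?_
    obtain ⟨K, s, hs, hK⟩ := (hamiltonField_contDiffAt (hH t)).exists_lipschitzOnWith
    have hs1 : s ∈ 𝓝 (γ₁ t) := by rw [show γ₁ t = γ₂ t from ht]; exact hs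
    exact ODE_solution_unique_of_eventually (v := fun _ => hamiltonField H) (s := fun _ => s)
      (Eventually.of_forall fun _ => hK)
      ((Eventually.of_forall h1).and (c1.continuousAt.eventually hs1))
      ((Eventually.of_forall h2).and (c2.continuousAt.eventually hs)) ht
  have := IsClopen.eq_univ ⟨hcl, hop⟩ ⟨0, h0⟩
  funext t
  exact (this ▸ mem_univ t : t ∈ {t | γ₁ t = γ₂ t})

/-- If the flow is `2π`-periodic with minimal period `2π`, then in canonical coordinates that reduce
`H` to an increasing function of the harmonic oscillator, this function is the identity. -/
theorem eq_harmonicOscillator_of_twoPiPeriodic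
    (hκ : ∀ᶠ r in 𝓝 (0 : ℝ × ℝ), DifferentiableAt ℝ κ r ∧
      ∀ u v, symplecticForm (fderiv ℝ κ r u) (fderiv ℝ κ r v) = symplecticForm u v)
    (hκ0 : κ 0 = 0) (hH : ∀ᶠ ρ in 𝓝 (0 : ℝ × ℝ), ContDiffAt ℝ 2 H ρ)
    (hg : ∀ᶠ s in 𝓝 (0 : ℝ), DifferentiableAt ℝ g s) (hg' : ContinuousAt (deriv g) 0)
    (hg0 : g 0 = 0) (hpos : 0 < deriv g 0)
    (h : ∀ᶠ r in 𝓝 (0 : ℝ × ℝ), H (κ r) = g (harmonicOscillator r))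
    (hχκ : ∀ᶠ r in 𝓝 (0 : ℝ × ℝ), χ (κ r) = r) (hflow : HamiltonFlowTwoPiPeriodic H) :
    ∀ᶠ r in 𝓝 (0 : ℝ × ℝ), H (κ r) = harmonicOscillator r := by
  have hT := eventually_trajectory hκ hκ0
    (hH.mono fun ρ hρ => hρ.differentiableAt (by norm_num)) hg h
  have tκ : Tendsto κ (𝓝 0) (𝓝 0) := by
    have := hκ.self_of_nhds.1.continuousAt.tendsto
    rwa [hκ0] at this
  have tp : Tendsto harmonicOscillator (𝓝 0) (𝓝 0) := by
    have := continuous_harmonicOscillator.tendsto 0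
    rwa [harmonicOscillator_zero] at this
  have hderiv : ∀ᶠ r in 𝓝 (0 : ℝ × ℝ), r ≠ 0 → deriv g (harmonicOscillator r) = 1 := by
    filter_upwards [hT, eventually_forall_realRotation (tκ.eventually hH),
      eventually_forall_realRotation hχκ, tκ.eventually hflow,
      tp.eventually (hg'.eventually (lt_mem_nhds hpos))] with r h1 h2 h3 ⟨γ, h4, h5, h6, h7⟩ h8 hr
    set w := deriv g (harmonicOscillator r)
    have hκr : κ r ≠ 0 := fun h0 => hr (by
      have e1 := h3 0
      rw [realRotation_zero] at e1
      have e2 := hχκ.self_of_nhds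
      rw [hκ0] at e2
      rw [← e1, h0, e2])
    -- Uniqueness identifies the given `2π`-periodic trajectory with the rotation at speed `w`,
    -- which forces `w` to be an integer.
    have hγ : γ = fun t => κ (realRotation (-(w * t)) r) :=
      trajectory_unique h5 h1 (fun t => h2 _) (by simp [h4, realRotation_zero])
    have e1 : γ (2 * Real.pi) = γ 0 := by simpa using h6 0
    rw [hγ] at e1
    have e2 : realRotation (-(w * (2 * Real.pi))) r = realRotation (-(w * 0)) r := by
      rw [← h3 (-(w * (2 * Real.pi))), ← h3 (-(w * 0))]
      exact congrArg χ e1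
    have e3 := eq_of_realRotation_eq hr e2
    rw [mul_zero, neg_zero, sub_zero, Real.cos_neg, Real.cos_eq_one_iff] at e3
    obtain ⟨n, hn⟩ := e3
    have hw : w = n := (mul_right_cancel₀ Real.two_pi_pos.ne' hn).symm
    have hn0 : (0 : ℝ) < n := hw ▸ h8
    have hn1 : 1 ≤ n := by exact_mod_cast hn0
    rcases hn1.eq_or_lt with hn1 | hn1
    · rw [hw, ← hn1, Int.cast_one]
    · exfalso
      have hn2 : (1 : ℝ) < n := by exact_mod_cast hn1
      -- At speed `n > 1` the curve already closes after `2π / n`, against minimality.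
      refine h7 hκr (2 * Real.pi / n) ⟨by positivity, ?_⟩ fun t => ?_
      · rw [div_lt_iff₀ hn0]
        nlinarith [Real.two_pi_pos]
      · rw [hγ]
        have e4 : -(w * (t + 2 * Real.pi / n)) = -(w * t) - 2 * Real.pi := by
          rw [hw]; field_simp; ring
        simp only [e4, realRotation_apply, Real.cos_sub_two_pi, Real.sin_sub_two_pi]
  obtain ⟨ε, hε, hball⟩ := Metric.eventually_nhds_iff_ball.1 hderiv
  obtain ⟨δ, hδ, hball'⟩ := Metric.eventually_nhds_iff_ball.1 hg
  have h1 : ∀ s ∈ Ioo (0 : ℝ) (ε ^ 2 / 2), deriv g s = 1 := by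
    intro s hs
    have hs2 : 0 ≤ 2 * s := by linarith [hs.1]
    have e1 : harmonicOscillator (Real.sqrt (2 * s), 0) = s := by
      simp only [harmonicOscillator]
      rw [Real.sq_sqrt hs2]; ring
    have e2 := hball (Real.sqrt (2 * s), 0) (by
      rw [mem_ball_zero_iff, Prod.norm_def, max_lt_iff]
      refine ⟨?_, by simpa using hε⟩
      simp only [Real.norm_eq_abs, abs_of_nonneg (Real.sqrt_nonneg _)]
      rw [Real.sqrt_lt' hε]
      linarith [hs.2]) (fun h0 => by
        have := e1
        rw [h0, harmonicOscillator_zero] at this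
        exact hs.1.ne this)
    rwa [e1] at e2
  -- Mean value theorem from `g 0 = 0`. Only `s ≥ 0` is accessible, and only those values are taken
  -- by the oscillator.
  have h2 : ∀ᶠ s in 𝓝 (0 : ℝ), 0 ≤ s → g s = s := by
    filter_upwards [Metric.ball_mem_nhds (0 : ℝ) hδ, gt_mem_nhds (show (0 : ℝ) < ε ^ 2 / 2 by positivity)]
      with s hs1 hs2 hs0
    rcases hs0.eq_or_lt with rfl | hs0
    · exact hg0
    have hd : ∀ x ∈ Icc 0 s, DifferentiableAt ℝ g x := fun x hx => hball' x (by
      rw [mem_ball_zero_iff, Real.norm_eq_abs] at hs1 ⊢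
      rw [abs_of_nonneg hx.1]
      exact hx.2.trans_lt ((le_abs_self s).trans_lt hs1))
    obtain ⟨c, hc, hc'⟩ := exists_deriv_eq_slope g hs0
      (fun x hx => (hd x hx).continuousAt.continuousWithinAt)
      (fun x hx => (hd x (Ioo_subset_Icc_self hx)).differentiableWithinAt)
    rw [h1 c ⟨hc.1, hc.2.trans hs2⟩, hg0, sub_zero, sub_zero, eq_div_iff hs0.ne', one_mul] at hc'
    exact hc'.symm
  filter_upwards [h, tp.eventually h2] with r e1 e2
  rw [e1, e2 (by unfold harmonicOscillator; positivity)]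

end Chart

end Flow

/-! ### Descent to the real plane -/

section RealNormalForm

set_option linter.unusedSectionVars false

variable {N : Type} [NormedAddCommGroup N] [NormedSpace ℝ N] {R : N → N → Prop}
  {M : Type} [NormedAddCommGroup M] [NormedSpace ℝ M] {ι : M →L[ℝ] N} {μ₀ : M}

/-- The map of the plane that a complexified map induces for the parameter `μ`. -/
noncomputable def realMap (ι : M →L[ℝ] N) (F : N × (ℂ × ℂ) → ℂ × ℂ) (μ : M) (ρ : ℝ × ℝ) : ℝ × ℝ :=
  rePlaneCLM (F (realPoint ι (μ, ρ)))

/-- The real function that a complexified function induces for the parameter `μ`. -/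
noncomputable def realFun (ι : M →L[ℝ] N) (F : N × ℂ → ℂ) (μ : M) (E : ℝ) : ℝ :=
  (F (ι μ, (E : ℂ))).re

theorem HolAt.analyticAt_slice {Z W : Type} [NormedAddCommGroup Z] [NormedSpace ℂ Z]
    [NormedAddCommGroup W] [NormedSpace ℂ W] [CompleteSpace W] {F : N × Z → W} {ν : N} {z : Z}
    (hR : R 0 0) (h : ∀ᶠ x in 𝓝 (ν, z), HolAt R F x) : AnalyticAt ℝ (fun w => F (ν, w)) z := by
  refine analyticAt_of_complexSmooth ?_
  have hc : ContinuousAt (fun w : Z => (ν, w)) z := by fun_prop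
  filter_upwards [hc.eventually h] with w hw using HolAt.slice hR hw

theorem analyticAt_realMap (hR : R 0 0) {F : N × (ℂ × ℂ) → ℂ × ℂ}
    (hF : ∀ᶠ x in 𝓝 (ι μ₀, (0 : ℂ × ℂ)), HolAt R F x) :
    ∀ᶠ y in 𝓝 (μ₀, (0 : ℝ × ℝ)), AnalyticAt ℝ (realMap ι F y.1) y.2 := by
  filter_upwards [(tendsto_realPoint ι μ₀).eventually hF.eventually_nhds] with y hy
  have h1 : AnalyticAt ℝ (fun w => F (ι y.1, w)) (planeCLM y.2) := HolAt.analyticAt_slice hR hy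
  exact (rePlaneCLM.analyticAt _).comp (h1.comp (planeCLM.analyticAt y.2))

theorem analyticAt_re_slice (hR : R 0 0) {F : N × (ℂ × ℂ) → ℂ}
    (hF : ∀ᶠ x in 𝓝 (ι μ₀, (0 : ℂ × ℂ)), HolAt R F x) :
    ∀ᶠ y in 𝓝 (μ₀, (0 : ℝ × ℝ)),
      AnalyticAt ℝ (fun ρ => (F (realPoint ι (y.1, ρ))).re) y.2 := by
  filter_upwards [(tendsto_realPoint ι μ₀).eventually hF.eventually_nhds] with y hy
  have h1 : AnalyticAt ℝ (fun w => F (ι y.1, w)) (planeCLM y.2) := HolAt.analyticAt_slice hR hy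
  exact (Complex.reCLM.analyticAt _).comp (h1.comp (planeCLM.analyticAt y.2))

/-- At real points the complex derivative has real entries, so it is the derivative of the induced
plane map; in dimension two, preserving the form means having determinant one. -/
theorem symplectic_realMap (hR : R 0 0) {F : N × (ℂ × ℂ) → ℂ × ℂ}
    (hF : ∀ᶠ x in 𝓝 (ι μ₀, (0 : ℂ × ℂ)), HolAt R F x)
    (h1 : RealNear ι μ₀ fun x => (F x).1) (h2 : RealNear ι μ₀ fun x => (F x).2)
    (hj : ∀ᶠ y in 𝓝 (μ₀, (0 : ℝ × ℝ)), jac F (realPoint ι y) = 1) :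
    ∀ᶠ y in 𝓝 (μ₀, (0 : ℝ × ℝ)), ∀ u v : ℝ × ℝ,
      symplecticForm (fderiv ℝ (realMap ι F y.1) y.2 u) (fderiv ℝ (realMap ι F y.1) y.2 v) =
        symplecticForm u v := by
  filter_upwards [(tendsto_realPoint ι μ₀).eventually hF, h1.eventually_nhds, h2.eventually_nhds, hj]
    with y hy e1 e2 e3 u v
  have hd : HasFDerivAt (realMap ι F y.1) (rePlaneCLM.comp
      ((fderiv ℝ F (realPoint ι y)).comp ((realPoint ι).comp (ContinuousLinearMap.inr ℝ M (ℝ × ℝ)))))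
      y.2 := by
    have h3 : HasFDerivAt (fun ρ : ℝ × ℝ => (y.1, ρ)) (ContinuousLinearMap.inr ℝ M (ℝ × ℝ)) y.2 :=
      hasFDerivAt_prodMk_right y.1 y.2
    have h4 := (realPoint ι).hasFDerivAt.comp y.2 h3
    have h5 : HasFDerivAt F (fderiv ℝ F (realPoint ι y)) (realPoint ι (y.1, y.2)) :=
      hy.hasFDerivAt
    exact rePlaneCLM.hasFDerivAt.comp y.2 (h5.comp y.2 h4)
  have f1 : ∀ v, fderiv ℝ (fun x => (F x).1) (realPoint ι y) v =
      (fderiv ℝ F (realPoint ι y) v).1 := fun v => by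
    rw [hy.hasFDerivAt.fst.fderiv]; rfl
  have f2 : ∀ v, fderiv ℝ (fun x => (F x).2) (realPoint ι y) v =
      (fderiv ℝ F (realPoint ι y) v).2 := fun v => by
    rw [hy.hasFDerivAt.snd.fderiv]; rfl
  have i1 : ∀ w : ℝ × ℝ, (fderiv ℝ F (realPoint ι y) (0, planeCLM w)).1.im = 0 := fun w => by
    have := fderiv_realPoint_im hy.fst.differentiableAt e1 (0, w)
    rwa [realPoint_apply ι (0, w), map_zero, f1] at this
  have i2 : ∀ w : ℝ × ℝ, (fderiv ℝ F (realPoint ι y) (0, planeCLM w)).2.im = 0 := fun w => by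
    have := fderiv_realPoint_im hy.snd.differentiableAt e2 (0, w)
    rwa [realPoint_apply ι (0, w), map_zero, f2] at this
  have h10 : planeCLM (1, 0) = ((1 : ℂ), (0 : ℂ)) := by simp [planeCLM_apply]
  have h01 : planeCLM (0, 1) = ((0 : ℂ), (1 : ℂ)) := by simp [planeCLM_apply]
  have a1 := i1 (1, 0)
  have a2 := i2 (1, 0)
  have b1 := i1 (0, 1)
  have b2 := i2 (0, 1)
  rw [h10] at a1 a2
  rw [h01] at b1 b2
  have hval : ∀ w : ℝ × ℝ, fderiv ℝ (realMap ι F y.1) y.2 w =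
      (w.1 * (fderiv ℝ F (realPoint ι y) (0, (1, 0))).1.re +
        w.2 * (fderiv ℝ F (realPoint ι y) (0, (0, 1))).1.re,
       w.1 * (fderiv ℝ F (realPoint ι y) (0, (1, 0))).2.re +
        w.2 * (fderiv ℝ F (realPoint ι y) (0, (0, 1))).2.re) := by
    intro w
    rw [hd.fderiv]
    have : realPoint ι (0, w) = (0, ((w.1 : ℂ), (w.2 : ℂ))) := by
      rw [realPoint_apply, map_zero, planeCLM_apply]
    simp only [ContinuousLinearMap.comp_apply, ContinuousLinearMap.inr_apply, this]
    rw [hy.fderiv_pair hR, rePlaneCLM_apply]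
    simp
  have hre := congrArg Complex.re e3
  simp only [jac, Complex.sub_re, Complex.mul_re, a1, a2, b1, b2, mul_zero, sub_zero,
    Complex.one_re] at hre
  rw [hval, hval]
  simp only [symplecticForm]
  linear_combination (u.2 * v.1 - u.1 * v.2) * hre

/-- The normal form, for a family of functions with a complexification. -/
theorem exists_real_normal_form [CompleteSpace N] [CompleteSpace M] (hR : R 0 0)
    {G : N × (ℂ × ℂ) → ℂ} {p : M → ℝ × ℝ → ℝ}
    (hG : ∀ᶠ x in 𝓝 (ι μ₀, (0 : ℂ × ℂ)), HolAt R G x)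
    (hGp : ∀ᶠ y in 𝓝 (μ₀, (0 : ℝ × ℝ)), G (realPoint ι y) = (p y.1 y.2 : ℂ))
    (hp : ∀ᶠ μ in 𝓝 μ₀, ComparableToSquare (p μ)) :
    ∃ (f : N × ℂ → ℂ) (κ : N × (ℂ × ℂ) → ℂ × ℂ) (χ : M → ℝ × ℝ → ℝ × ℝ) (V : Set (ℝ × ℝ)),
      (∀ᶠ x in 𝓝 (ι μ₀, (0 : ℂ)), HolAt R f x) ∧
      (∀ᶠ y : M × ℝ in 𝓝 (μ₀, (0 : ℝ)), (f (ι y.1, (y.2 : ℂ))).im = 0) ∧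
      (∀ᶠ x in 𝓝 (ι μ₀, (0 : ℂ × ℂ)), HolAt R κ x) ∧
      (RealNear ι μ₀ fun x => (κ x).1) ∧ (RealNear ι μ₀ fun x => (κ x).2) ∧
      ∀ᶠ μ in 𝓝 μ₀, NormalizesPeriod (p μ) (realFun ι f μ) ∧
        IsAnalyticCanonicalOn (realMap ι κ μ) V ∧
        (∀ ρ ∈ V, χ μ (realMap ι κ μ ρ) = ρ) ∧
        ∀ ρ ∈ V, realFun ι f μ (p μ (realMap ι κ μ ρ)) = harmonicOscillator ρ := by
  obtain ⟨a, χ, κ, ha, hapos, ra, hχ, hκ, hχ0, hκ0, rχ1, rχ2, rκ1, rκ2, hj, hκχ, hχκ, hE⟩ :=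
    exists_normal_form hR hG hGp hp
  have t := tendsto_realPoint ι μ₀
  have cκ : ContinuousAt κ (ι μ₀, 0) := hκ.self_of_nhds.continuousAt
  -- The energy in the chart is `p a(p)`, so this function of `p` is the candidate; its derivative
  -- at zero is `a(0)`.
  set f : N × ℂ → ℂ := fun x => x.2 * a x with hf
  have hholf : ∀ᶠ x in 𝓝 (ι μ₀, (0 : ℂ)), HolAt R f x := by
    filter_upwards [ha] with x h1 using (holAt_snd x).mul h1
  have tμ : Tendsto (fun μ => (ι μ, (0 : ℂ))) (𝓝 μ₀) (𝓝 (ι μ₀, 0)) :=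
    Continuous.tendsto (by fun_prop) μ₀
  have tμ' : Tendsto (fun μ => (μ, (0 : ℝ × ℝ))) (𝓝 μ₀) (𝓝 (μ₀, 0)) :=
    Continuous.tendsto (by fun_prop) μ₀
  have tμ'' : Tendsto (fun μ => (ι μ, (0 : ℂ × ℂ))) (𝓝 μ₀) (𝓝 (ι μ₀, 0)) :=
    Continuous.tendsto (by fun_prop) μ₀
  have hcompl := RealNear.eventually_eq rκ1 rκ2
  have hcompl' := RealNear.eventually_eq rχ1 rχ2
  have hleft : ∀ᶠ y in 𝓝 (μ₀, (0 : ℝ × ℝ)), realMap ι χ y.1 (realMap ι κ y.1 y.2) = y.2 := by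
    filter_upwards [hcompl, t.eventually hχκ] with y h1 h2
    simp only [realMap]
    rw [realPoint_apply]
    change rePlaneCLM (χ (ι y.1, planeCLM (rePlaneCLM (κ (realPoint ι y))))) = y.2
    rw [h1]
    have h3 : χ (ι y.1, κ (realPoint ι y)) = planeCLM y.2 := h2
    rw [h3]
    rfl
  have hright : ∀ᶠ y in 𝓝 (μ₀, (0 : ℝ × ℝ)), realMap ι κ y.1 (realMap ι χ y.1 y.2) = y.2 := by
    filter_upwards [hcompl', t.eventually hκχ] with y h1 h2
    simp only [realMap]
    rw [realPoint_apply]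
    change rePlaneCLM (κ (ι y.1, planeCLM (rePlaneCLM (χ (realPoint ι y))))) = y.2
    rw [h1]
    have h3 : κ (ι y.1, χ (realPoint ι y)) = planeCLM y.2 := h2
    rw [h3]
    rfl
  have hκμ0 : ∀ᶠ μ in 𝓝 μ₀, realMap ι κ μ 0 = 0 := by
    filter_upwards [tμ''.eventually hκχ] with μ h1
    simp only [hχ0] at h1
    simp only [realMap, realPoint_apply, map_zero, h1]
  have hmain : ∀ᶠ y in 𝓝 (μ₀, (0 : ℝ × ℝ)),
      realFun ι f y.1 (p y.1 (realMap ι κ y.1 y.2)) = harmonicOscillator y.2 := by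
    have ht : Tendsto (fun y : M × (ℝ × ℝ) => (y.1, realMap ι κ y.1 y.2)) (𝓝 (μ₀, 0))
        (𝓝 (μ₀, 0)) := by
      have h1 : Tendsto (fun y : M × (ℝ × ℝ) => realMap ι κ y.1 y.2) (𝓝 (μ₀, 0)) (𝓝 0) := by
        have h2 := cκ.tendsto.comp t
        rw [hκ0] at h2
        have h3 := (rePlaneCLM.continuous.tendsto 0).comp h2
        rwa [map_zero] at h3
      exact (continuous_fst.tendsto (μ₀, (0 : ℝ × ℝ))).prodMk_nhds h1
    filter_upwards [ht.eventually hE, hcompl, t.eventually hχκ] with y h1 h2 h3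
    have h4 : realPoint ι (y.1, realMap ι κ y.1 y.2) = (ι y.1, κ (realPoint ι y)) := by
      rw [realPoint_apply]
      exact congrArg (Prod.mk (ι y.1)) h2
    have h5 : χ (ι y.1, κ (realPoint ι y)) = planeCLM y.2 := h3
    simp only [h4, h5] at h1
    have h6 : oscillatorC (planeCLM y.2) = (harmonicOscillator y.2 : ℂ) := by
      simp [oscillatorC, planeCLM_apply, harmonicOscillator]
    rw [h6] at h1
    simp only [realFun, hf]
    rw [← h1, Complex.ofReal_re]
  have hpan : ∀ᶠ μ in 𝓝 μ₀, AnalyticAt ℝ (p μ) 0 := by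
    filter_upwards [tμ'.eventually (analyticAt_re_slice hR hG), tμ'.eventually hGp.eventually_nhds]
      with μ h1 h2
    refine h1.congr ?_
    have hc : ContinuousAt (fun ρ : ℝ × ℝ => (μ, ρ)) 0 := by fun_prop
    filter_upwards [hc.eventually h2] with ρ h3
    rw [h3, Complex.ofReal_re]
  have hfan : ∀ᶠ μ in 𝓝 μ₀, AnalyticAt ℝ (realFun ι f μ) 0 := by
    filter_upwards [tμ.eventually hholf.eventually_nhds] with μ h1
    have h2 : AnalyticAt ℝ (fun E => f (ι μ, E)) (Complex.ofRealCLM 0) := by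
      simpa using HolAt.analyticAt_slice hR h1
    exact (Complex.reCLM.analyticAt _).comp (h2.comp (Complex.ofRealCLM.analyticAt 0))
  have hfderiv : ∀ᶠ μ in 𝓝 μ₀, 0 < deriv (realFun ι f μ) 0 := by
    have h0 : ∀ᶠ x in 𝓝 (ι μ₀, (0 : ℂ)), 0 < (a x).re :=
      (Complex.continuous_re.continuousAt.comp ha.self_of_nhds.continuousAt).eventually
        (lt_mem_nhds hapos)
    filter_upwards [tμ.eventually h0, tμ.eventually ha] with μ h1 h2
    have h3 := (HolAt.slice hR h2).differentiableAt.hasDerivAt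
    have h4 : HasDerivAt (fun E : ℂ => f (ι μ, E)) (a (ι μ, 0)) ((0 : ℝ) : ℂ) := by
      rw [Complex.ofReal_zero]
      have h5 : HasDerivAt (fun E : ℂ => f (ι μ, E)) _ 0 := (hasDerivAt_id (0 : ℂ)).mul h3
      rwa [one_mul, id, zero_mul, add_zero] at h5
    have h6 : HasDerivAt (realFun ι f μ) (a (ι μ, 0)).re 0 := h4.real_of_complex
    rw [h6.deriv]
    exact h1
  have hall : ∀ᶠ y in 𝓝 (μ₀, (0 : ℝ × ℝ)), AnalyticAt ℝ (realMap ι κ y.1) y.2 ∧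
      (∀ u v : ℝ × ℝ, symplecticForm (fderiv ℝ (realMap ι κ y.1) y.2 u)
        (fderiv ℝ (realMap ι κ y.1) y.2 v) = symplecticForm u v) ∧
      realMap ι χ y.1 (realMap ι κ y.1 y.2) = y.2 ∧
      realMap ι κ y.1 (realMap ι χ y.1 y.2) = y.2 ∧
      realFun ι f y.1 (p y.1 (realMap ι κ y.1 y.2)) = harmonicOscillator y.2 := by
    filter_upwards [analyticAt_realMap hR hκ, symplectic_realMap hR hκ rκ1 rκ2 hj, hleft, hright,
      hmain] with y h1 h2 h3 h4 h5 using ⟨h1, h2, h3, h4, h5⟩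
  -- A product ball around `(μ₀, 0)` provides one neighbourhood of the origin for all nearby `μ`.
  obtain ⟨ε, hε, hball⟩ := Metric.eventually_nhds_iff_ball.1 hall
  refine ⟨f, κ, realMap ι χ, Metric.ball 0 ε, hholf, ?_, hκ, rκ1, rκ2, ?_⟩
  · filter_upwards [ra] with y h1
    simp [hf, Complex.mul_im, h1]
  · filter_upwards [hκμ0, hpan, hfan, hfderiv, Metric.ball_mem_nhds μ₀ hε, hp,
      tμ'.eventually (analyticAt_realMap hR hχ)] with μ e1 e2 e3 e4 e5 e6 e7
    have hV : ∀ ρ ∈ Metric.ball (0 : ℝ × ℝ) ε, _ := fun ρ hρ => hball (μ, ρ) (by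
      rw [← ball_prod_same]; exact ⟨e5, hρ⟩)
    have hVe : ∀ᶠ ρ in 𝓝 (0 : ℝ × ℝ), ρ ∈ Metric.ball (0 : ℝ × ℝ) ε := Metric.ball_mem_nhds _ hε
    have hp0 : p μ 0 = 0 := by
      obtain ⟨c, C, -, -, hcC⟩ := e6
      have := hcC.self_of_nhds
      simp only [Prod.fst_zero, Prod.snd_zero] at this
      linarith [this.1, this.2]
    have hfp : AnalyticAt ℝ (realFun ι f μ ∘ p μ) 0 := by
      refine AnalyticAt.comp ?_ e2
      rwa [hp0]
    refine ⟨⟨e3, by simp [realFun, hf], e4, ?_⟩, ⟨Metric.isOpen_ball, Metric.mem_ball_self hε, e1,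
      fun ρ hρ => (hV ρ hρ).1, fun ρ hρ σ hσ h => ?_, fun ρ hρ => (hV ρ hρ).2.1⟩,
      fun ρ hρ => (hV ρ hρ).2.2.1, fun ρ hρ => (hV ρ hρ).2.2.2.2⟩
    · refine hamiltonFlowTwoPiPeriodic_of_normalForm (κ := realMap ι κ μ) (χ := realMap ι χ μ)
        (hVe.mono fun ρ hρ => ⟨(hV ρ hρ).1.differentiableAt, (hV ρ hρ).2.1⟩) e1
        (hfp.eventually_analyticAt.mono fun ρ hρ => hρ.differentiableAt)
        (hVe.mono fun ρ hρ => (hV ρ hρ).2.2.2.2) e7.continuousAt ?_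
        (hVe.mono fun ρ hρ => (hV ρ hρ).2.2.2.1) (hVe.mono fun ρ hρ => (hV ρ hρ).2.2.1)
      simp only [realMap, realPoint_apply, map_zero, hχ0]
    · have h1 := (hV ρ hρ).2.2.1
      have h2 := (hV σ hσ).2.2.1
      simp only at h1 h2
      rw [← h1, ← h2, h]

end RealNormalForm

/-! ### Analytic and smooth families as two instances -/

section Parameters

variable {d : ℕ}

/-- The inclusion `ℝᵈ → ℂᵈ`. -/
noncomputable def complexParam (d : ℕ) : (Fin d → ℝ) →L[ℝ] (Fin d → ℂ) :=
  ContinuousLinearMap.pi fun i => Complex.ofRealCLM.comp (ContinuousLinearMap.proj i)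

/-- Two parameter directions of which the second is `i` times the first. -/
def ComplexDirections (n n' : Fin d → ℂ) : Prop := n' = Complex.I • n

theorem complexDirections_zero : ComplexDirections (0 : Fin d → ℂ) 0 := (smul_zero _).symm

theorem AnalyticAt.holAt {Z W : Type} [NormedAddCommGroup Z] [NormedSpace ℂ Z]
    [NormedAddCommGroup W] [NormedSpace ℂ W] [CompleteSpace W] {F : (Fin d → ℂ) × Z → W}
    {x : (Fin d → ℂ) × Z} (h : AnalyticAt ℂ F x) : HolAt ComplexDirections F x := by
  refine HolAt.of_hasFDerivAt (h.contDiffAt.restrict_scalars ℝ)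
    (h.differentiableAt.hasFDerivAt.restrictScalars ℝ) fun n n' z hn => ?_
  rw [ContinuousLinearMap.coe_restrictScalars', hn, ← map_smul]
  rfl

/-- With every direction related to its product with `i`, the derivative is complex linear in
parameters and `z` jointly. -/
theorem HolAt.complexSmoothAt {Z W : Type} [NormedAddCommGroup Z] [NormedSpace ℂ Z]
    [NormedAddCommGroup W] [NormedSpace ℂ W] {F : (Fin d → ℂ) × Z → W} {x : (Fin d → ℂ) × Z}
    (h : HolAt ComplexDirections F x) : ComplexSmoothAt F x :=
  ⟨h.1, fun v => h.2 v.1 (Complex.I • v.1) v.2 rfl⟩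

/-- Two parameter directions that both vanish. -/
def NoDirections (n n' : Fin d → ℝ) : Prop := n = 0 ∧ n' = 0

theorem noDirections_zero : NoDirections (0 : Fin d → ℝ) 0 := ⟨rfl, rfl⟩

theorem holAt_of_contDiffAt {Z W : Type} [NormedAddCommGroup Z] [NormedSpace ℂ Z]
    [NormedAddCommGroup W] [NormedSpace ℂ W] {F : (Fin d → ℝ) × Z → W} {μ : Fin d → ℝ} {z : Z}
    (h : ContDiffAt ℝ ∞ F (μ, z)) (hs : DifferentiableAt ℂ (fun w => F (μ, w)) z) :
    HolAt NoDirections F (μ, z) := by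
  refine ⟨h, ?_⟩
  rintro n n' v ⟨rfl, rfl⟩
  have h1 : HasFDerivAt (fun w : Z => (μ, w)) (ContinuousLinearMap.inr ℝ (Fin d → ℝ) Z) z :=
    hasFDerivAt_prodMk_right μ z
  have h2 : HasFDerivAt (fun w => F (μ, w)) _ z :=
    HasFDerivAt.comp z (h.differentiableAt (by simp)).hasFDerivAt h1
  have h3 := h2.unique (hs.hasFDerivAt.restrictScalars ℝ)
  have h4 : ∀ v, fderiv ℝ F (μ, z) (0, v) = fderiv ℂ (fun w => F (μ, w)) z v := fun v =>
    congrArg (fun L : Z →L[ℝ] W => L v) h3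
  rw [h4, h4, map_smul]

/-- Since `c` preserves norms, one radius works for both the extension and the real points inside
its domain. -/
theorem dependsSmoothlyNear_of_holAt {E Ec : Type} [NormedAddCommGroup E] [NormedAddCommGroup Ec]
    [NormedSpace ℂ Ec] {c : E → Ec} (hc : ∀ ρ, ‖c ρ‖ = ‖ρ‖) {μ₀ : Fin d → ℝ}
    {F : (Fin d → ℝ) × Ec → ℂ} {g : (Fin d → ℝ) → E → ℝ}
    (hF : ∀ᶠ x in 𝓝 (μ₀, (0 : Ec)), HolAt NoDirections F x)
    (hg : ∀ᶠ y in 𝓝 (μ₀, (0 : E)), F (y.1, c y.2) = (g y.1 y.2 : ℂ)) :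
    DependsSmoothlyNear c μ₀ g := by
  obtain ⟨ε, hε, hball⟩ := Metric.eventually_nhds_iff_ball.1 hF
  obtain ⟨δ, hδ, hball'⟩ := Metric.eventually_nhds_iff_ball.1 hg
  have hmin : 0 < min ε δ := lt_min hε hδ
  have h1 : ∀ μ ∈ Metric.ball μ₀ (min ε δ), ∀ z ∈ Metric.ball (0 : Ec) (min ε δ),
      HolAt NoDirections F (μ, z) := fun μ hμ z hz => hball _ (by
    rw [← ball_prod_same]
    exact ⟨Metric.ball_subset_ball (min_le_left _ _) hμ,
      Metric.ball_subset_ball (min_le_left _ _) hz⟩)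
  refine ⟨Metric.ball μ₀ (min ε δ), Metric.ball 0 (min ε δ), F, Metric.isOpen_ball,
    Metric.mem_ball_self hmin, Metric.isOpen_ball, Metric.mem_ball_self hmin,
    fun x hx => (h1 x.1 hx.1 x.2 hx.2).1.contDiffWithinAt,
    fun μ hμ z hz => (HolAt.slice noDirections_zero (h1 μ hμ z hz)).differentiableAt
      |>.differentiableWithinAt, fun μ hμ ρ hρ => hball' (μ, ρ) ?_⟩
  rw [← ball_prod_same]
  refine ⟨Metric.ball_subset_ball (min_le_right _ _) hμ, ?_⟩
  rw [mem_ball_zero_iff, hc] at hρ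
  rw [mem_ball_zero_iff]
  exact hρ.trans_le (min_le_right _ _)

theorem norm_complexifyPlane (ρ : ℝ × ℝ) : ‖complexifyPlane ρ‖ = ‖ρ‖ := by
  simp [complexifyPlane, Prod.norm_def]

/-- The normal form for analytic families. -/
theorem exists_analytic_normal_form {μ₀ : Fin d → ℝ} {p : (Fin d → ℝ) → ℝ × ℝ → ℝ}
    (hp : AnalyticAt ℝ (fun q : (Fin d → ℝ) × (ℝ × ℝ) => p q.1 q.2) (μ₀, 0))
    (hpc : ∀ᶠ μ in 𝓝 μ₀, ComparableToSquare (p μ)) :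
    ∃ (f : (Fin d → ℝ) → ℝ → ℝ) (κ χ : (Fin d → ℝ) → ℝ × ℝ → ℝ × ℝ) (V : Set (ℝ × ℝ)),
      AnalyticAt ℝ (fun q : (Fin d → ℝ) × ℝ => f q.1 q.2) (μ₀, 0) ∧
      AnalyticAt ℝ (fun q : (Fin d → ℝ) × (ℝ × ℝ) => κ q.1 q.2) (μ₀, 0) ∧
      ∀ᶠ μ in 𝓝 μ₀, NormalizesPeriod (p μ) (f μ) ∧ IsAnalyticCanonicalOn (κ μ) V ∧
        (∀ ρ ∈ V, χ μ (κ μ ρ) = ρ) ∧ ∀ ρ ∈ V, f μ (p μ (κ μ ρ)) = harmonicOscillator ρ := by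
  obtain ⟨G, hG, hGp⟩ := exists_complex_extension_plane hp
  have hGh : ∀ᶠ x in 𝓝 (complexParam d μ₀, (0 : ℂ × ℂ)), HolAt ComplexDirections G x := by
    filter_upwards [hG.eventually_analyticAt] with x hx using hx.holAt
  obtain ⟨f, κ, χ, V, hf, -, hκ, -, -, h⟩ :=
    exists_real_normal_form (ι := complexParam d) (μ₀ := μ₀) complexDirections_zero hGh hGp hpc
  refine ⟨realFun (complexParam d) f, realMap (complexParam d) κ, χ, V, ?_, ?_, h⟩
  · have h1 : AnalyticAt ℝ f ((complexParam d).prodMap Complex.ofRealCLM (μ₀, 0)) := by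
      have : (complexParam d).prodMap Complex.ofRealCLM (μ₀, 0) = (complexParam d μ₀, 0) := by simp
      rw [this]
      exact analyticAt_of_complexSmooth (hf.mono fun x hx => hx.complexSmoothAt)
    exact (Complex.reCLM.analyticAt _).comp
      (h1.comp (((complexParam d).prodMap Complex.ofRealCLM).analyticAt _))
  · have h1 : AnalyticAt ℝ κ (realPoint (complexParam d) (μ₀, 0)) := by
      rw [realPoint_center]
      exact analyticAt_of_complexSmooth (hκ.mono fun x hx => hx.complexSmoothAt)
    exact (rePlaneCLM.analyticAt _).comp (h1.comp ((realPoint (complexParam d)).analyticAt _))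

/-- The normal form for smooth families. -/
theorem exists_smooth_normal_form {μ₀ : Fin d → ℝ} {p : (Fin d → ℝ) → ℝ × ℝ → ℝ}
    (hp : DependsSmoothlyNear complexifyPlane μ₀ p)
    (hpc : ∀ᶠ μ in 𝓝 μ₀, ComparableToSquare (p μ)) :
    ∃ (f : (Fin d → ℝ) → ℝ → ℝ) (κ : (Fin d → ℝ) → ℝ × ℝ → ℝ × ℝ) (V : Set (ℝ × ℝ)),
      DependsSmoothlyNear Complex.ofReal μ₀ f ∧
      DependsSmoothlyNear complexifyPlane μ₀ (fun μ ρ => (κ μ ρ).1) ∧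
      DependsSmoothlyNear complexifyPlane μ₀ (fun μ ρ => (κ μ ρ).2) ∧
      ∀ᶠ μ in 𝓝 μ₀, NormalizesPeriod (p μ) (f μ) ∧ IsAnalyticCanonicalOn (κ μ) V ∧
        ∀ ρ ∈ V, f μ (p μ (κ μ ρ)) = harmonicOscillator ρ := by
  obtain ⟨U, V', G, hU, hμU, hV', h0V', hGc, hGd, hGp⟩ := hp
  set ι := ContinuousLinearMap.id ℝ (Fin d → ℝ) with hι
  have hUV : ∀ᶠ x in 𝓝 (ι μ₀, (0 : ℂ × ℂ)), x ∈ U ×ˢ V' :=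
    (hU.prod hV').mem_nhds ⟨hμU, h0V'⟩
  have hGh : ∀ᶠ x in 𝓝 (ι μ₀, (0 : ℂ × ℂ)), HolAt NoDirections G x := by
    filter_upwards [hUV] with x hx
    exact holAt_of_contDiffAt (hGc.contDiffAt ((hU.prod hV').mem_nhds hx))
      ((hGd x.1 hx.1).differentiableAt (hV'.mem_nhds hx.2))
  have hGp' : ∀ᶠ y in 𝓝 (μ₀, (0 : ℝ × ℝ)), G (realPoint ι y) = (p y.1 y.2 : ℂ) := by
    filter_upwards [(tendsto_realPoint ι μ₀).eventually hUV] with y hy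
    exact hGp y.1 hy.1 y.2 hy.2
  obtain ⟨f, κ, χ, V, hf, rf, hκ, r1, r2, h⟩ :=
    exists_real_normal_form (ι := ι) (μ₀ := μ₀) noDirections_zero hGh hGp' hpc
  refine ⟨realFun ι f, realMap ι κ, V, ?_, ?_, ?_, h.mono fun μ hμ => ⟨hμ.1, hμ.2.1, hμ.2.2.2⟩⟩
  · refine dependsSmoothlyNear_of_holAt (fun ρ => by simp) hf ?_
    filter_upwards [rf] with y hy
    exact Complex.ext rfl hy
  · refine dependsSmoothlyNear_of_holAt norm_complexifyPlane (hF := hκ.mono fun x hx => hx.fst) ?_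
    filter_upwards [r1] with y hy
    exact Complex.ext rfl hy
  · refine dependsSmoothlyNear_of_holAt norm_complexifyPlane (hF := hκ.mono fun x hx => hx.snd) ?_
    filter_upwards [r2] with y hy
    exact Complex.ext rfl hy

end Parameters

/-! ### Independence of the normalizing function, and conclusion -/

section NormalizingFunctions

theorem exists_contDiffAt_inverse {f : ℝ → ℝ} (hf : ContDiffAt ℝ 2 f 0) (hf0 : f 0 = 0)
    (hf' : deriv f 0 ≠ 0) :
    ∃ h : ℝ → ℝ, ContDiffAt ℝ 2 h 0 ∧ h 0 = 0 ∧ ∀ᶠ s in 𝓝 (0 : ℝ), h (f s) = s := by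
  have h2 : (2 : WithTop ℕ∞) ≠ 0 := by norm_num
  have h1 := (hf.differentiableAt h2).hasDerivAt.hasFDerivAt_equiv hf'
  have h3 := hf.to_localInverse h1 h2
  have h4 := hf.localInverse_apply_image h1 h2
  rw [hf0] at h3 h4
  exact ⟨hf.localInverse h1 h2, h3, h4, (hf.hasStrictFDerivAt' h1 h2).eventually_left_inverse⟩

theorem ComparableToSquare.apply_zero {p : ℝ × ℝ → ℝ} (hp : ComparableToSquare p) : p 0 = 0 := by
  obtain ⟨c, C, -, -, h⟩ := hp
  have := h.self_of_nhds
  simp only [Prod.fst_zero, Prod.snd_zero] at this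
  linarith [this.1, this.2]

theorem IsAnalyticCanonicalOn.mono {κ : ℝ × ℝ → ℝ × ℝ} {V W : Set (ℝ × ℝ)}
    (h : IsAnalyticCanonicalOn κ V) (hW : IsOpen W) (h0 : (0 : ℝ × ℝ) ∈ W) (hWV : W ⊆ V) :
    IsAnalyticCanonicalOn κ W :=
  ⟨hW, h0, h.2.2.1, fun ρ hρ => h.2.2.2.1 ρ (hWV hρ), h.2.2.2.2.1.mono hWV,
    fun ρ hρ => h.2.2.2.2.2 ρ (hWV hρ)⟩

/-- A canonical transformation that normalizes `p` with one normalizing function does so with every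
other. -/
theorem eventually_eq_harmonicOscillator {p : ℝ × ℝ → ℝ} (hp : AnalyticAt ℝ p 0)
    (hpc : ComparableToSquare p) {f f₁ : ℝ → ℝ} (hf : NormalizesPeriod p f)
    (hf₁ : NormalizesPeriod p f₁) {κ χ : ℝ × ℝ → ℝ × ℝ} {V : Set (ℝ × ℝ)}
    (hκ : IsAnalyticCanonicalOn κ V) (hχ : ∀ ρ ∈ V, χ (κ ρ) = ρ)
    (h : ∀ ρ ∈ V, f₁ (p (κ ρ)) = harmonicOscillator ρ) :
    ∀ᶠ ρ in 𝓝 (0 : ℝ × ℝ), f (p (κ ρ)) = harmonicOscillator ρ := by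
  obtain ⟨hV, h0V, hκ0, hκa, -, hκs⟩ := hκ
  obtain ⟨hfa, hf0, hfpos, hflow⟩ := hf
  obtain ⟨hf₁a, hf₁0, hf₁pos, -⟩ := hf₁
  -- With `g` the local inverse of `f₁`, one has `p ∘ κ = g ∘ p₀`, so `f ∘ p ∘ κ` is the function `f
  -- ∘ g` of the oscillator, with positive derivative at zero.
  obtain ⟨g, hg, hg0, hgf⟩ := exists_contDiffAt_inverse (hf₁a.contDiffAt (n := 2)) hf₁0 hf₁pos.ne'
  have hVe : ∀ᶠ ρ in 𝓝 (0 : ℝ × ℝ), ρ ∈ V := hV.mem_nhds h0V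
  have hp0 := hpc.apply_zero
  have hfg : ContDiffAt ℝ 2 (f ∘ g) 0 := by
    refine ContDiffAt.comp 0 ?_ hg
    rw [hg0]
    exact hfa.contDiffAt
  have hfg1 : ∀ᶠ s in 𝓝 (0 : ℝ), ContDiffAt ℝ 2 (f ∘ g) s := hfg.eventually (by norm_num)
  have hfg' : ContinuousAt (deriv (f ∘ g)) 0 := by
    have h1 : ContDiffAt ℝ 1 (deriv (f ∘ g)) 0 := by
      have h2 : ContDiffAt ℝ 1 (fderiv ℝ (f ∘ g)) 0 := hfg.fderiv_right (by norm_num)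
      exact h2.clm_apply contDiffAt_const
    exact h1.continuousAt
  have hfgpos : 0 < deriv (f ∘ g) 0 := by
    have h1 : HasDerivAt ((f ∘ g) ∘ f₁) (deriv (f ∘ g) 0 * deriv f₁ 0) 0 := by
      refine HasDerivAt.comp 0 ?_ hf₁a.differentiableAt.hasDerivAt
      rw [hf₁0]
      exact (hfg.differentiableAt (by norm_num)).hasDerivAt
    have h2 : HasDerivAt ((f ∘ g) ∘ f₁) (deriv f 0) 0 :=
      hfa.differentiableAt.hasDerivAt.congr_of_eventuallyEq
        (hgf.mono fun s hs => by simp only [Function.comp_apply, hs])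
    have h3 := h1.unique h2
    rw [← h3] at hfpos
    exact (mul_pos_iff_of_pos_right hf₁pos).1 hfpos
  have hH : AnalyticAt ℝ (f ∘ p) 0 := by
    refine AnalyticAt.comp ?_ hp
    rwa [hp0]
  have tpκ : Tendsto (fun ρ => p (κ ρ)) (𝓝 0) (𝓝 0) := by
    have h1 : ContinuousAt (fun ρ => p (κ ρ)) 0 := by
      refine ContinuousAt.comp ?_ (hκa 0 h0V).continuousAt
      rw [hκ0]
      exact hp.continuousAt
    have := h1.tendsto
    rwa [hκ0, hp0] at this
  refine eq_harmonicOscillator_of_twoPiPeriodic (H := f ∘ p) (g := f ∘ g) (χ := χ)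
    (hVe.mono fun ρ hρ => ⟨(hκa ρ hρ).differentiableAt, hκs ρ hρ⟩) hκ0
    (hH.eventually_analyticAt.mono fun ρ hρ => hρ.contDiffAt)
    (hfg1.mono fun s hs => hs.differentiableAt (by norm_num)) hfg'
    (by simp only [Function.comp_apply, hg0, hf0]) hfgpos ?_ (hVe.mono hχ) hflow
  filter_upwards [hVe, tpκ.eventually hgf] with ρ h1 h2
  rw [← h ρ h1]
  simp only [Function.comp_apply, h2]

end NormalizingFunctions

theorem lemma5p2 :
    -- the lemma itself
    (∀ p : ℝ × ℝ → ℝ, AnalyticAt ℝ p 0 → ComparableToSquare p →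
      (∃ f : ℝ → ℝ, NormalizesPeriod p f) ∧
      ∀ f : ℝ → ℝ, NormalizesPeriod p f →
        ∃ (κ : ℝ × ℝ → ℝ × ℝ) (V : Set (ℝ × ℝ)), IsAnalyticCanonicalOn κ V ∧
          ∀ ρ ∈ V, f (p (κ ρ)) = harmonicOscillator ρ) ∧
    -- analytic dependence on parameters
    (∀ (d : ℕ) (μ₀ : Fin d → ℝ) (p : (Fin d → ℝ) → ℝ × ℝ → ℝ),
      AnalyticAt ℝ (fun q : (Fin d → ℝ) × (ℝ × ℝ) => p q.1 q.2) (μ₀, 0) →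
      (∀ᶠ μ in 𝓝 μ₀, ComparableToSquare (p μ)) →
      ∃ (f : (Fin d → ℝ) → ℝ → ℝ) (κ : (Fin d → ℝ) → ℝ × ℝ → ℝ × ℝ) (V : Set (ℝ × ℝ)),
        AnalyticAt ℝ (fun q : (Fin d → ℝ) × ℝ => f q.1 q.2) (μ₀, 0) ∧
        AnalyticAt ℝ (fun q : (Fin d → ℝ) × (ℝ × ℝ) => κ q.1 q.2) (μ₀, 0) ∧
        ∀ᶠ μ in 𝓝 μ₀, NormalizesPeriod (p μ) (f μ) ∧ IsAnalyticCanonicalOn (κ μ) V ∧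
          ∀ ρ ∈ V, f μ (p μ (κ μ ρ)) = harmonicOscillator ρ) ∧
    -- smooth dependence on parameters
    (∀ (d : ℕ) (μ₀ : Fin d → ℝ) (p : (Fin d → ℝ) → ℝ × ℝ → ℝ),
      DependsSmoothlyNear complexifyPlane μ₀ p →
      (∀ᶠ μ in 𝓝 μ₀, ComparableToSquare (p μ)) →
      ∃ (f : (Fin d → ℝ) → ℝ → ℝ) (κ : (Fin d → ℝ) → ℝ × ℝ → ℝ × ℝ) (V : Set (ℝ × ℝ)),
        DependsSmoothlyNear Complex.ofReal μ₀ f ∧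
        DependsSmoothlyNear complexifyPlane μ₀ (fun μ ρ => (κ μ ρ).1) ∧
        DependsSmoothlyNear complexifyPlane μ₀ (fun μ ρ => (κ μ ρ).2) ∧
        ∀ᶠ μ in 𝓝 μ₀, NormalizesPeriod (p μ) (f μ) ∧ IsAnalyticCanonicalOn (κ μ) V ∧
          ∀ ρ ∈ V, f μ (p μ (κ μ ρ)) = harmonicOscillator ρ) := by
  refine ⟨fun p hp hpc => ?_, fun d μ₀ p hp hpc => ?_, fun d μ₀ p hp hpc =>
    exists_smooth_normal_form hp hpc⟩
  -- A single function is a family over the zero-dimensional parameter space. For an arbitrary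
  -- normalizing `f` the same `κ` is used, restricted to where the identity with that `f` holds.
  · have hpa : AnalyticAt ℝ (fun q : (Fin 0 → ℝ) × (ℝ × ℝ) => p q.2) (0, 0) :=
      AnalyticAt.fun_comp (f := fun q : (Fin 0 → ℝ) × (ℝ × ℝ) => q.2) hp analyticAt_snd
    obtain ⟨f₁, κ, χ, V, -, -, h⟩ := exists_analytic_normal_form (p := fun _ => p) hpa
      (Eventually.of_forall fun _ => hpc)
    obtain ⟨h1, h2, h3, h4⟩ := h.self_of_nhds
    refine ⟨⟨f₁ 0, h1⟩, fun f hf => ?_⟩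
    obtain ⟨W, hW, hWo, h0W⟩ := eventually_nhds_iff.1
      (eventually_eq_harmonicOscillator hp hpc hf h1 h2 h3 h4)
    exact ⟨κ 0, V ∩ W, h2.mono (h2.1.inter hWo) ⟨h2.2.1, h0W⟩ inter_subset_left,
      fun ρ hρ => hW ρ hρ.2⟩
  · obtain ⟨f, κ, χ, V, hf, hκ, h⟩ := exists_analytic_normal_form hp hpc
    exact ⟨f, κ, V, hf, hκ, h.mono fun μ hμ => ⟨hμ.1, hμ.2.1, hμ.2.2.2⟩⟩
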